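/- **Conventions.** An involution of a group $G$ is an element of order $2$; $I(G)^{(2)}$ is the set of ordered pairs of distinct involutions; a translation is a product $rs$ with $(r,s)\in I(G)^{(2)}$, and $Tr(G)$ is the set of translations. Write $D_{r,s}=\langle r,s\rangle$. Let $p$ be an odd prime. A pair $(r,s)\in I(G)^{(2)}$ is of *$p$-minimal type* if $rs$ has order $p$ and $N_G(\langle rs\rangle)=D_{r,s}$; it is of *$p$-affine type* if $D_{r,s}$ is contained in a subgroup of $G$ isomorphic to $\mathrm{AGL}(1,\mathbb F_p)$. $G$ is *almost sharply 2-transitive of characteristic $p$* if: (1) every translation has order $p$ or infinite order, and every $(r,s)\in I(G)^{(2)}$ with $rs$ of order $p$ is of $p$-minimal or of $p$-affine type; (2) $\langle Tr(G)\rangle$ contains no involution; (3) the set of pairs of $p$-affine type is non-empty and $G$ acts transitively on it by conjugation; (4) for every $(r,s)\in I(G)^{(2)}$ the centralizer of $rs$ is cyclic, generated by a translation. $G$ is in $\mathcal{ST}(p)$ if moreover all translations have order $p$. For a group $G$ acting by isometries on a hyperbolic space $X$, $\partial H$ denotes the limit set in the Gromov boundary $\partial X$ of a subgroup $H$; $H$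 is elementary if $|\partial H|\le 2$ and loxodromic if $|\partial H|=2$; $g$ is loxodromic if $\langle g\rangle$ is; $[g]=\inf_x d(x,gx)$ and $[g]^\infty=\lim_n \frac1n d(x,g^nx)$. The action is *acylindrical* if for every $\varepsilon\ge 0$ there are $M,L>0$ such that $d(x,y)\ge L$ implies $|\{g: d(x,gx)\le\varepsilon,\ d(y,gy)\le\varepsilon\}|\le M$. It is *WPD* if for every loxodromic $h\in G$, every $x\in X$ and every $\varepsilon\ge0$ there are $n\in\mathbb N$ and $M>0$ with $|\{g: d(x,gx)\le\varepsilon,\ d(h^nx,gh^nx)\le\varepsilon\}|\le M$. Put: * $r_{\rm inj}(Q,X)=\inf\{[g]^\infty : g\in Q \text{ loxodromic}\}$ for $Q\subseteq G$; * $e(G,X)$ = the least common multiple of the numbers $|F\rtimes \mathrm{Aut}(F)|$, with $F$ running over the maximal normal finite subgroups of the maximal loxodromic subgroups of $G$; * $\nu(G,X)$ = the least integer $m\ge1$ such that for all $g,h\in G$ with $h$ loxodromic, if $g,h^{-1}gh,\dots,h^{-m}gh^m$ generate an elementary non-loxodromic subgroup, then $\langle g,h\rangle$ is elementary; * for $X$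 a tree (so that the hyperbolicity constant is $\delta=0$) and $\nu=\nu(G,X)<\infty$: $A(G,X)$ = the supremum of $\mathrm{diam}(A_{g_0}\cap\dots\cap A_{g_\nu})$, where $A_g=\{x\in X: d(x,gx)=[g]\}$, over all $(g_0,\dots,g_\nu)\in G^{\nu+1}$ which generate a non-elementary subgroup and satisfy $[g_j]=0$ for all $j$. Fix a natural number $n_1$ (a lower threshold for $p$). A group $G$ acting on a simplicial tree $X$ (with its path metric, edges having length $1$) is *in $\mathcal{ST}'(p)$* if, with $Q=Tr(G)$ and $N=\langle Q\rangle$: $G$ is almost sharply 2-transitive of characteristic $p$; (1') the action is non-elementary and acylindrical, and thus WPD; (2') $e(N,X)=1$, $r_{\rm inj}(Q,X)\ge 1$, $\nu(N,X)\le 5$, $A(N,X)=0$, and $p\ge n_1$; (3') every translation of infinite order is loxodromic; (4') every finite subgroup of $G$ normalized by a loxodromic element has order at most $2$. **Proposition.** Let $n_1$ be a natural number, let $p\ge n_1$ be an odd prime and let $G$ be a group in $\mathcal{ST}(p)$. 1. Suppose $p\ne 3$. Let $(r,s)\in I(G)^{(2)}$ be of $p$-affine type and $(r',s')\in I(G)^{(2)}$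 of $p$-minimal type. Then $r\mapsto r'$, $s\mapsto s'$ defines an isomorphism $D_{r,s}\to D_{r',s'}$, and for the HNN extension $G^*=\langle G,t\mid trt^{-1}=r',\ tst^{-1}=s'\rangle$ with its Bass–Serre tree $X$, the pair $(G^*,X)$ is in $\mathcal{ST}'(p)$. 2. Let $H$ be a non-trivial group without elements of order $2$. Then for $G^*=G*H$ with its Bass–Serre tree $X$, the pair $(G^*,X)$ is in $\mathcal{ST}'(p)$. -/

import Mathlib

open Filter Topology
open scoped ENNReal Monoid.Coprod

noncomputable section

/-! ### Involutions, translations, and the class `ST(p)` -/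

section Groups

variable {G : Type*} [Group G]

/-- `(r, s)` is an (ordered) pair of distinct involutions of `G`. -/
def IsInvolutionPair (r s : G) : Prop :=
  orderOf r = 2 ∧ orderOf s = 2 ∧ r ≠ s

/-- The set of translations: products of two distinct involutions. -/
def translations (G : Type*) [Group G] : Set G :=
  {g | ∃ r s : G, IsInvolutionPair r s ∧ g = r * s}

/-- The (normal) subgroup generated by the translations. -/
def translationSubgroup (G : Type*) [Group G] : Subgroup G :=
  Subgroup.closure (translations G)

/-- The subgroup generated by `r` and `s`. -/
def dihedralSubgroup (r s : G) : Subgroup G :=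
  Subgroup.closure {r, s}

theorem left_mem_dihedralSubgroup (r s : G) : r ∈ dihedralSubgroup r s :=
  Subgroup.subset_closure (by simp)

theorem right_mem_dihedralSubgroup (r s : G) : s ∈ dihedralSubgroup r s :=
  Subgroup.subset_closure (by simp)

/-- The pair `(r, s)` is of `p`-minimal type. -/
def IsMinimalPair (p : ℕ) (r s : G) : Prop :=
  IsInvolutionPair r s ∧ orderOf (r * s) = p ∧
    Subgroup.normalizer (Subgroup.zpowers (r * s) : Set G) = dihedralSubgroup r s

/-- The pair `(r, s)` is of `p`-affine type: `⟨r, s⟩` lies in a subgroup isomorphic to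
`AGL(1, 𝔽_p)`, the group of affine bijections of the line over `𝔽_p`. -/
def IsAffinePair (p : ℕ) (r s : G) : Prop :=
  IsInvolutionPair r s ∧
    ∃ H : Subgroup G, dihedralSubgroup r s ≤ H ∧ Nonempty (H ≃* (ZMod p ≃ᵃ[ZMod p] ZMod p))

/-- Almost sharply 2-transitive groups of characteristic `p`
(`orderOf g = 0` means that `g` has infinite order). -/
structure IsAlmostSharplyTwoTransitive (p : ℕ) (G : Type*) [Group G] : Prop where
  order_translation : ∀ g ∈ translations G, orderOf g = p ∨ orderOf g = 0
  minimal_or_affine : ∀ r s : G, IsInvolutionPair r s → orderOf (r * s) = p →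
    IsMinimalPair p r s ∨ IsAffinePair p r s
  no_involution : ∀ g ∈ translationSubgroup G, orderOf g ≠ 2
  exists_affine : ∃ r s : G, IsAffinePair p r s
  transitive_affine : ∀ r s r' s' : G, IsAffinePair p r s → IsAffinePair p r' s' →
    ∃ g : G, g⁻¹ * r * g = r' ∧ g⁻¹ * s * g = s'
  centralizer_cyclic : ∀ r s : G, IsInvolutionPair r s →
    ∃ h ∈ translations G, Subgroup.centralizer {r * s} = Subgroup.zpowers h

/-- The class `ST(p)`. -/
structure IsST (p : ℕ) (G : Type*) [Group G] : Prop where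
  almost : IsAlmostSharplyTwoTransitive p G
  order_translation : ∀ g ∈ translations G, orderOf g = p

end Groups

/-! ### Gromov boundary -/

section Boundary

variable {X : Type*} [MetricSpace X]

/-- The Gromov product of `x` and `y` with respect to `z`. -/
def gromovProduct (x y z : X) : ℝ := (dist x z + dist y z - dist x y) / 2

/-- The sequence `u` converges to infinity. -/
def ConvergesToInfinity (u : ℕ → X) : Prop :=
  ∀ z : X, Tendsto (fun i : ℕ × ℕ => gromovProduct (u i.1) (u i.2) z) atTop atTop

/-- The boundary at infinity: sequences converging to infinity, where `u` and `v` are identified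
when `⟨u n, v n⟩_z → ∞`. On a hyperbolic space this relation is an equivalence relation and the
choice of `z` is irrelevant. -/
def GromovBoundary (X : Type*) [MetricSpace X] : Type _ :=
  Quot (fun u v : {u : ℕ → X // ConvergesToInfinity u} =>
    ∀ z : X, Tendsto (fun n : ℕ => gromovProduct (u.1 n) (v.1 n) z) atTop atTop)

end Boundary

/-! ### Groups acting by isometries on a hyperbolic space -/

section Actions

variable {G : Type*} [Group G] (X : Type*) [MetricSpace X] [MulAction G X]

/-- The limit set `∂H`: the points of the boundary which are limits of sequences contained in an
orbit of `H`. -/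
def limitSet (H : Subgroup G) : Set (GromovBoundary X) :=
  {ξ | ∃ (x : X) (u : {u : ℕ → X // ConvergesToInfinity u}),
    (∀ n, ∃ h ∈ H, u.1 n = h • x) ∧ Quot.mk _ u = ξ}

/-- `H` is elementary. -/
def IsElementary (H : Subgroup G) : Prop := (limitSet X H).encard ≤ 2

/-- The subgroup `H` is loxodromic. -/
def IsLoxodromicSubgroup (H : Subgroup G) : Prop := (limitSet X H).encard = 2

/-- The element `g` is loxodromic. -/
def IsLoxodromic (g : G) : Prop := IsLoxodromicSubgroup X (Subgroup.zpowers g)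

/-- The translation length `[g]`. -/
def translationLength (g : G) : ℝ := ⨅ x : X, dist x (g • x)

/-- The asymptotic translation length `[g]^∞`, the limit of `d(x, gⁿ x) / n`. For an isometric
action this limit exists and does not depend on the point `x`. -/
def asymptoticTranslationLength [Nonempty X] (g : G) : ℝ :=
  limUnder atTop fun n : ℕ =>
    dist (Classical.arbitrary X) (g ^ n • Classical.arbitrary X) / (n : ℝ)

/-- The action of `G` on `X` is acylindrical. -/
def IsAcylindrical (G X : Type*) [Group G] [MetricSpace X] [MulAction G X] : Prop :=
  ∀ ε : ℝ, 0 ≤ ε → ∃ (M : ℕ) (L : ℝ), 0 < M ∧ 0 < L ∧ ∀ x y : X, L ≤ dist x y →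
    {g : G | dist x (g • x) ≤ ε ∧ dist y (g • y) ≤ ε}.encard ≤ M

/-- The action of `G` on `X` is weakly properly discontinuous. -/
def IsWPD (G X : Type*) [Group G] [MetricSpace X] [MulAction G X] : Prop :=
  ∀ h : G, IsLoxodromic X h → ∀ (x : X) (ε : ℝ), 0 ≤ ε → ∃ n M : ℕ, 0 < M ∧
    {g : G | dist x (g • x) ≤ ε ∧ dist (h ^ n • x) (g • h ^ n • x) ≤ ε}.encard ≤ M

/-- The injectivity radius `r_inj(Q, X)`; it is `∞` if `Q` has no loxodromic element. -/
def injectivityRadius [Nonempty X] (Q : Set G) : ℝ≥0∞ :=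
  ⨅ g ∈ {g ∈ Q | IsLoxodromic X g}, ENNReal.ofReal (asymptoticTranslationLength X g)

/-- The numbers `|F ⋊ Aut(F)|`, where `F` runs over the maximal normal finite subgroups of the
maximal loxodromic subgroups of `G`. -/
def holomorphOrders (G X : Type*) [Group G] [MetricSpace X] [MulAction G X] : Set ℕ :=
  {n | ∃ M : Subgroup G, Maximal (fun M' => IsLoxodromicSubgroup X M') M ∧
    ∃ F : Subgroup M, Maximal (fun F' : Subgroup M => F'.Normal ∧ Finite F') F ∧
      n = Nat.card (F ⋊[MonoidHom.id (MulAut F)] MulAut F)}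

/-- The invariant `e(G, X)`, the least common multiple of the previous numbers (`0` if they have
no positive common multiple). -/
def invariantE (G X : Type*) [Group G] [MetricSpace X] [MulAction G X] : ℕ :=
  sInf {m : ℕ | 0 < m ∧ ∀ n ∈ holomorphOrders G X, n ∣ m}

/-- The property of the positive integer `m` which defines the invariant `ν(G, X)`. -/
def NuProperty (G X : Type*) [Group G] [MetricSpace X] [MulAction G X] (m : ℕ) : Prop :=
  ∀ g h : G, IsLoxodromic X h →
    IsElementary X (Subgroup.closure {k : G | ∃ i ≤ m, k = (h ^ i)⁻¹ * g * h ^ i}) →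
    ¬ IsLoxodromicSubgroup X (Subgroup.closure {k : G | ∃ i ≤ m, k = (h ^ i)⁻¹ * g * h ^ i}) →
    IsElementary X (Subgroup.closure {g, h})

/-- The invariant `ν(G, X)`, equal to `∞` if no positive integer has the required property. -/
def invariantNu (G X : Type*) [Group G] [MetricSpace X] [MulAction G X] : ℕ∞ :=
  ⨅ m ∈ {m : ℕ | 0 < m ∧ NuProperty G X m}, (m : ℕ∞)

/-- The axis of `g`, for the hyperbolicity constant `δ = 0`: the points moved by exactly `[g]`. -/
def axis (g : G) : Set X := {x | dist x (g • x) = translationLength X g}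

/-- The invariant `A(G, X)`, for the hyperbolicity constant `δ = 0` (it is only meant for actions
with finite `ν`): the supremum of the diameters of `A_{g₀} ∩ ⋯ ∩ A_{g_ν}`, over all the
`(ν+1)`-tuples of elements of translation length `0` generating a non-elementary subgroup. The
closed `13δ`-neighbourhoods of the axes are the (closed) axes themselves, and the bound
`[g_j] ≤ L_S δ` becomes `[g_j] ≤ 0`. -/
def invariantA (G X : Type*) [Group G] [MetricSpace X] [MulAction G X] : ℝ≥0∞ :=
  ⨆ g ∈ {g : Fin ((invariantNu G X).toNat + 1) → G |
      ¬ IsElementary X (Subgroup.closure (Set.range g)) ∧ ∀ j, translationLength X (g j) ≤ 0},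
    Metric.ediam (⋂ j, axis X (g j))

end Actions

/-! ### Simplicial trees as metric spaces -/

/-- `G` acts on the graph `T` by graph automorphisms. -/
class GraphAction (G : Type*) [Group G] {V : Type*} [MulAction G V] (T : SimpleGraph V) :
    Prop where
  smul_adj : ∀ (g : G) (a b : V), T.Adj a b → T.Adj (g • a) (g • b)

theorem GraphAction.dist_smul_le {G : Type*} [Group G] {V : Type*} [MulAction G V]
    (T : SimpleGraph V) [GraphAction G T] (hT : T.IsTree) (g : G) (a b : V) :
    T.dist (g • a) (g • b) ≤ T.dist a b := by
  obtain ⟨w, hw⟩ := hT.1.exists_walk_length_eq_dist a b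
  let f : T →g T := ⟨fun v => g • v, fun {a b} h => GraphAction.smul_adj g a b h⟩
  have := SimpleGraph.dist_le (w.map f)
  rw [SimpleGraph.Walk.length_map, hw] at this
  exact this

theorem GraphAction.dist_smul {G : Type*} [Group G] {V : Type*} [MulAction G V]
    (T : SimpleGraph V) [GraphAction G T] (hT : T.IsTree) (g : G) (a b : V) :
    T.dist (g • a) (g • b) = T.dist a b := by
  refine le_antisymm (GraphAction.dist_smul_le T hT g a b) ?_
  simpa using GraphAction.dist_smul_le T hT g⁻¹ (g • a) (g • b)

/-- A point of the geometric realization of the tree `T` (all edges having length `1`). It is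
recorded by its distances to all the vertices: the point of the edge `[a, b]` at distance `t` from
`a` is at distance `(1 - t) d(a, v) + t d(b, v)` from the vertex `v`, because `d(a, v)` and
`d(b, v)` differ by one. The case `a = b` gives the vertices. -/
@[ext]
structure TreePoint {V : Type*} (T : SimpleGraph V) (hT : T.IsTree) where
  distTo : V → ℝ
  exists_edge : ∃ (a b : V) (t : ℝ), (a = b ∨ T.Adj a b) ∧ 0 ≤ t ∧ t ≤ 1 ∧
    ∀ v, distTo v = (1 - t) * (T.dist a v : ℝ) + t * (T.dist b v : ℝ)

namespace TreePoint

variable {V : Type*} {T : SimpleGraph V} {hT : T.IsTree}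

/-- A vertex, as a point of the geometric realization. -/
def ofVertex (hT : T.IsTree) (a : V) : TreePoint T hT :=
  ⟨fun v => (T.dist a v : ℝ), a, a, 0, Or.inl rfl, le_rfl, zero_le_one, fun v => by simp⟩

instance : Nonempty (TreePoint T hT) := hT.1.nonempty.map (ofVertex hT)

theorem abs_dist_sub_le (hT : T.IsTree) (a b v : V) :
    |(T.dist a v : ℝ) - T.dist b v| ≤ T.dist a b := by
  have h1 : (T.dist a v : ℝ) ≤ T.dist a b + T.dist b v := by
    exact_mod_cast hT.1.dist_triangle
  have h2 : (T.dist b v : ℝ) ≤ T.dist b a + T.dist a v := by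
    exact_mod_cast hT.1.dist_triangle
  rw [SimpleGraph.dist_comm (u := b) (v := a)] at h2
  rw [abs_le]
  constructor <;> linarith

theorem exists_near_vertex (x : TreePoint T hT) :
    ∃ (a : V) (C : ℝ), ∀ v, |x.distTo v - T.dist a v| ≤ C := by
  obtain ⟨a, b, t, -, h0, h1, h⟩ := x.exists_edge
  refine ⟨a, T.dist a b, fun v => ?_⟩
  have e : x.distTo v - T.dist a v = t * ((T.dist b v : ℝ) - T.dist a v) := by rw [h]; ring
  rw [e, abs_mul, abs_of_nonneg h0, abs_sub_comm]
  calc t * |(T.dist a v : ℝ) - T.dist b v| ≤ 1 * |(T.dist a v : ℝ) - T.dist b v| :=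
        mul_le_mul_of_nonneg_right h1 (abs_nonneg _)
    _ ≤ T.dist a b := by rw [one_mul]; exact abs_dist_sub_le hT a b v

theorem bddAbove (x y : TreePoint T hT) :
    BddAbove (Set.range fun v => |x.distTo v - y.distTo v|) := by
  obtain ⟨a, C, hC⟩ := x.exists_near_vertex
  obtain ⟨b, D, hD⟩ := y.exists_near_vertex
  refine ⟨C + T.dist a b + D, ?_⟩
  rintro _ ⟨v, rfl⟩
  have h1 := abs_le.1 (hC v)
  have h2 := abs_le.1 (hD v)
  have h3 := abs_le.1 (abs_dist_sub_le hT a b v)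
  show |x.distTo v - y.distTo v| ≤ _
  rw [abs_le]
  constructor <;> linarith [h1.1, h1.2, h2.1, h2.2, h3.1, h3.2]

/-- The path metric of the tree: `d(x, y)` is the largest value of `|d(x, v) - d(y, v)|` over all
the vertices `v`; it is attained at an end of the edge containing `x`, on the side of `x` away from
`y`. -/
instance : MetricSpace (TreePoint T hT) where
  dist x y := ⨆ v, |x.distTo v - y.distTo v|
  dist_self x := by simp
  dist_comm x y := by simp only [abs_sub_comm]
  dist_triangle x y z := by
    have := hT.1.nonempty
    refine ciSup_le fun v => ?_
    calc |x.distTo v - z.distTo v|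
        ≤ |x.distTo v - y.distTo v| + |y.distTo v - z.distTo v| := abs_sub_le _ _ _
      _ ≤ _ := add_le_add (le_ciSup (bddAbove x y) v) (le_ciSup (bddAbove y z) v)
  eq_of_dist_eq_zero {x y} h := by
    ext v
    have h1 : |x.distTo v - y.distTo v| ≤ 0 := h ▸ le_ciSup (bddAbove x y) v
    exact sub_eq_zero.1 (abs_nonpos_iff.1 h1)

variable {G : Type*} [Group G] [MulAction G V] [GraphAction G T]

/-- The action on the geometric realization induced by an action on the tree. -/
instance : MulAction G (TreePoint T hT) where
  smul g x :=
    ⟨fun v => x.distTo (g⁻¹ • v), by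
      obtain ⟨a, b, t, hab, h0, h1, h⟩ := x.exists_edge
      refine ⟨g • a, g • b, t, ?_, h0, h1, fun v => ?_⟩
      · rcases hab with rfl | hab
        · exact Or.inl rfl
        · exact Or.inr (GraphAction.smul_adj g a b hab)
      · rw [h, ← GraphAction.dist_smul T hT g a, ← GraphAction.dist_smul T hT g b,
          smul_inv_smul]⟩
  one_smul x := by
    ext v
    show x.distTo ((1 : G)⁻¹ • v) = x.distTo v
    simp
  mul_smul g h x := by
    ext v
    show x.distTo ((g * h)⁻¹ • v) = x.distTo (h⁻¹ • g⁻¹ • v)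
    rw [mul_inv_rev, mul_smul]

instance : IsIsometricSMul G (TreePoint T hT) where
  isometry_smul g := by
    refine Isometry.of_dist_eq fun x y => ?_
    show (⨆ v, |x.distTo (g⁻¹ • v) - y.distTo (g⁻¹ • v)|) = ⨆ v, |x.distTo v - y.distTo v|
    exact (MulAction.toPerm (g⁻¹ : G)).iSup_comp (g := fun v => |x.distTo v - y.distTo v|)

end TreePoint

/-! ### The class `ST'(p)` -/

/-- The pair formed by the group `G` and the tree `T` belongs to the class `ST'(p)`. The number
`n₁` is the threshold which `p` is required to reach. The metric space on which `G` acts is the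
geometric realization of `T`, which is `0`-hyperbolic. -/
structure IsSTPrime (n₁ p : ℕ) (G : Type*) [Group G] {V : Type*} [MulAction G V]
    (T : SimpleGraph V) [GraphAction G T] : Prop where
  isTree : T.IsTree
  almost : IsAlmostSharplyTwoTransitive p G
  nonElementary : ¬ IsElementary (TreePoint T isTree) (⊤ : Subgroup G)
  acylindrical : IsAcylindrical G (TreePoint T isTree)
  wpd : IsWPD G (TreePoint T isTree)
  e_eq_one : invariantE (translationSubgroup G) (TreePoint T isTree) = 1
  one_le_injectivityRadius : 1 ≤ injectivityRadius (TreePoint T isTree) (translations G)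
  nu_le_five : invariantNu (translationSubgroup G) (TreePoint T isTree) ≤ 5
  A_eq_zero : invariantA (translationSubgroup G) (TreePoint T isTree) = 0
  threshold_le : n₁ ≤ p
  loxodromic_of_infinite_order : ∀ g ∈ translations G, orderOf g = 0 →
    IsLoxodromic (TreePoint T isTree) g
  card_le_two : ∀ F : Subgroup G, Finite F → ∀ g : G, IsLoxodromic (TreePoint T isTree) g →
    g ∈ Subgroup.normalizer (F : Set G) → Nat.card F ≤ 2

/-! ### Bass–Serre trees -/

section BassSerre

/-- The Bass–Serre tree of the HNN extension `G* = ⟨G, t | t a t⁻¹ = φ a (a ∈ A)⟩`: the vertices are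
the cosets `gG`, and each coset `gA` gives an edge joining `gG` to `g t⁻¹ G`. -/
def hnnTree {G : Type*} [Group G] {A B : Subgroup G} (φ : A ≃* B) :
    SimpleGraph (HNNExtension G A B φ ⧸ (HNNExtension.of (φ := φ)).range) :=
  SimpleGraph.fromRel fun x y => ∃ g : HNNExtension G A B φ,
    x = QuotientGroup.mk g ∧ y = QuotientGroup.mk (g * HNNExtension.t⁻¹)

instance {G : Type*} [Group G] {A B : Subgroup G} (φ : A ≃* B) :
    GraphAction (HNNExtension G A B φ) (hnnTree φ) where
  smul_adj k a b := by
    rintro ⟨hne, h⟩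
    refine ⟨fun h' => hne (MulAction.injective k h'), ?_⟩
    rcases h with ⟨g, rfl, rfl⟩ | ⟨g, rfl, rfl⟩
    · exact Or.inl ⟨k * g, rfl, by rw [mul_assoc]; rfl⟩
    · exact Or.inr ⟨k * g, rfl, by rw [mul_assoc]; rfl⟩

/-- The Bass–Serre tree of the free product `G* = G ∗ H`: the vertices are the cosets `gG` and
`gH`, and each element `g` gives an edge joining `gG` to `gH`. -/
def freeProductTree (G H : Type*) [Group G] [Group H] :
    SimpleGraph (((G ∗ H) ⧸ (Monoid.Coprod.inl : G →* G ∗ H).range) ⊕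
      ((G ∗ H) ⧸ (Monoid.Coprod.inr : H →* G ∗ H).range)) :=
  SimpleGraph.fromRel fun x y => ∃ g : G ∗ H,
    x = Sum.inl (QuotientGroup.mk g) ∧ y = Sum.inr (QuotientGroup.mk g)

instance (G H : Type*) [Group G] [Group H] : GraphAction (G ∗ H) (freeProductTree G H) where
  smul_adj k a b := by
    rintro ⟨hne, h⟩
    refine ⟨fun h' => hne (MulAction.injective k h'), ?_⟩
    rcases h with ⟨g, rfl, rfl⟩ | ⟨g, rfl, rfl⟩
    · exact Or.inl ⟨k * g, rfl, rfl⟩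
    · exact Or.inr ⟨k * g, rfl, rfl⟩

end BassSerre

end

/-! Write Γ for G* and T for its Bass–Serre tree. An element of finite order fixes a vertex, so
every involution of Γ is conjugate into G (in the free product because H contains no involution).
All involutions of G have the same class modulo ⟨Tr(G)⟩, so the quotient map of G extends to π : Γ →
G/⟨Tr(G)⟩ with the stable letter, or H, going to 1. Then π kills every translation of Γ but no
involution, which gives condition (2).

The heart of the matter is that an element of ker π fixing two vertices at distance at least 3 is
trivial. In the free product, edge stabilizers are already trivial. In the HNN extension the part of
an edge stabilizer inside ker π consists of conjugates of powers of r's', or equally of rs. An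
affine rotation is conjugate to its square by an element normalizing its cyclic group, while the
normalizer of a minimal rotation only centralizes or inverts it; for p ≠ 3 conjugates of ⟨rs⟩ and
⟨r's'⟩ therefore meet trivially (`IsMinimalPair.eq_one_of_mem_zpowers_affine`). Also ⟨r's'⟩ meets
its conjugate by any element outside D_{r',s'} trivially (`IsMinimalPair.mem_of_conj_mem`).

A translation of Γ is elliptic or hyperbolic. If it is elliptic, the normalizer of the cyclic group
it generates fixes a vertex and, up to conjugacy, lies in G; order, type, conjugacy and centralizers
are then inherited from G. If it is hyperbolic it has infinite order. Its centralizer acts on its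
axis through integer shifts, faithfully because a kernel element would produce a translation of
order 2; so the centralizer is cyclic, and its generator is inverted by r, hence is a translation
(`IsSTSplitting.exists_centralizer_eq_of_axial`).

The geometric conditions use the same smallness. Serre's lemma on products of elliptic elements
(`GraphAction.exists_common_fixed`) gives ν ≤ 3. A finite subgroup normalized by a large
displacement fixes two distant vertices, whence e = 1 and the bound 2 of (4'). Uniformly bounded
edge stabilizers give acylindricity, displacements of hyperbolic elements are positive integers, and
A = 0 because the axis of an element attaining translation length 0 is its fixed set. The common
input of both constructions is `IsSTSplitting`; the trees are recognized by normal forms. -/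

noncomputable section

/-! ### Distances and medians in a tree -/

namespace SimpleGraph.IsTree

variable {V : Type*} {T : SimpleGraph V} (hT : T.IsTree)
include hT

theorem dist_tri (a b c : V) : T.dist a c ≤ T.dist a b + T.dist b c := hT.1.dist_triangle

theorem dist_adj {a u : V} (h : T.Adj a u) (b : V) :
    T.dist u b + 1 = T.dist a b ∨ T.dist u b = T.dist a b + 1 := by
  have := hT.dist_eq_dist_add_one_of_adj b h
  rw [T.dist_comm (u := u), T.dist_comm (u := a)]
  omega

theorem exists_adj_closer {a b : V} (h : a ≠ b) :
    ∃ u, T.Adj a u ∧ T.dist u b + 1 = T.dist a b := by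
  obtain ⟨w, hw⟩ := hT.1.exists_walk_length_eq_dist a b
  cases w with
  | nil => exact absurd rfl h
  | cons h' w =>
    rename_i u
    refine ⟨u, h', ?_⟩
    have h1 := SimpleGraph.dist_le w
    have h2 := hT.dist_adj h' b
    simp at hw
    omega

/-- Two different first steps towards `w` would extend to two different geodesics, hence two paths
from `v` to `w`. -/
theorem closer_unique {v u u' w : V} (h : T.Adj v u) (h' : T.Adj v u')
    (hd : T.dist u w + 1 = T.dist v w) (hd' : T.dist u' w + 1 = T.dist v w) : u = u' := by
  obtain ⟨p, hp⟩ := hT.1.exists_walk_length_eq_dist u w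
  obtain ⟨p', hp'⟩ := hT.1.exists_walk_length_eq_dist u' w
  have h1 : (SimpleGraph.Walk.cons h p).IsPath :=
    SimpleGraph.Walk.isPath_of_length_eq_dist _ (by simp [hp, hd])
  have h2 : (SimpleGraph.Walk.cons h' p').IsPath :=
    SimpleGraph.Walk.isPath_of_length_eq_dist _ (by simp [hp', hd'])
  have := (hT.existsUnique_path v w).unique h1 h2
  have := congrArg SimpleGraph.Walk.snd this
  simpa using this

/-- Induction along the geodesic from `a` to `b`: the median for the next vertex `a'` still works
when `a'` is nearer to `w` than `a`. Otherwise the geodesic from `a'` to `w` starts with `a`, and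
`a` itself is the median. -/
theorem exists_median (w a b : V) : ∃ m, T.dist w m + T.dist m a = T.dist w a ∧
    T.dist w m + T.dist m b = T.dist w b ∧ T.dist a m + T.dist m b = T.dist a b := by
  induction hn : T.dist a b generalizing a with
  | zero =>
    obtain rfl : a = b := (hT.1.dist_eq_zero_iff).1 hn
    exact ⟨a, by simp⟩
  | succ n ih =>
    have hab : a ≠ b := by rintro rfl; simp at hn
    obtain ⟨a', h, ha'⟩ := hT.exists_adj_closer hab
    obtain ⟨m, h1, h2, h3⟩ := ih a' (by omega)
    have haa' : T.dist a a' = 1 := by rwa [SimpleGraph.dist_eq_one_iff_adj]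
    have c1 := T.dist_comm (u := w) (v := a)
    have c2 := T.dist_comm (u := w) (v := a')
    have c3 := T.dist_comm (u := a') (v := m)
    have c4 := T.dist_comm (u := a) (v := m)
    have t1 := hT.dist_tri w m a
    have t2 := hT.dist_tri a m b
    have t3 := hT.dist_tri a a' m
    rcases hT.dist_adj h w with h4 | h4
    · exact ⟨m, by omega, by omega, by omega⟩
    · by_cases hm : a' = m
      · subst hm
        have t4 := hT.dist_tri w a b
        have t5 := hT.dist_tri a a' b
        refine ⟨a, by simp, ?_, by simp [hn]⟩
        omega
      -- The step from `a'` to `m` approaches both `w` and `b`. The step towards `w` is `a`, which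
      -- recedes from `b`: contradiction.
      · obtain ⟨u, hu, hum⟩ := hT.exists_adj_closer hm
        have s1 := hT.dist_tri u m w
        have s2 := hT.dist_tri u m b
        have s3 := hT.dist_adj hu w
        have s4 := hT.dist_adj hu b
        have c5 := T.dist_comm (u := w) (v := m)
        have e : u = a := hT.closer_unique (w := w) hu h.symm (by omega) (by omega)
        subst e
        omega

theorem exists_between {a b : V} {k : ℕ} (hk : k ≤ T.dist a b) :
    ∃ x, T.dist a x = k ∧ T.dist x b + k = T.dist a b := by
  induction k with
  | zero => exact ⟨a, by simp⟩
  | succ k ih =>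
    obtain ⟨x, h1, h2⟩ := ih (by omega)
    have hxb : x ≠ b := by rintro rfl; simp at h2; omega
    obtain ⟨u, hu, hub⟩ := hT.exists_adj_closer hxb
    refine ⟨u, ?_, by omega⟩
    have := hT.dist_tri a u b
    have := hT.dist_adj hu a
    have := T.dist_comm (u := u) (v := a)
    have := T.dist_comm (u := x) (v := a)
    omega

theorem eq_of_between {a b x y : V} (hx : T.dist a x + T.dist x b = T.dist a b)
    (hy : T.dist a y + T.dist y b = T.dist a b) (h : T.dist a x = T.dist a y) : x = y := by
  induction hn : T.dist a x generalizing x y with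
  | zero =>
    exact ((hT.1.dist_eq_zero_iff).1 hn).symm.trans ((hT.1.dist_eq_zero_iff).1 (h ▸ hn))
  | succ n ih =>
    have hxa : x ≠ a := by rintro rfl; simp at hn
    have hya : y ≠ a := by rintro rfl; rw [hn, SimpleGraph.dist_self] at h; omega
    obtain ⟨x', h1, h2⟩ := hT.exists_adj_closer hxa
    obtain ⟨y', h3, h4⟩ := hT.exists_adj_closer hya
    have := hT.dist_tri a x' b
    have := hT.dist_tri a y' b
    have := hT.dist_adj h1 b
    have := hT.dist_adj h3 b
    have := T.dist_comm (u := x) (v := a)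
    have := T.dist_comm (u := y) (v := a)
    have := T.dist_comm (u := x') (v := a)
    have := T.dist_comm (u := y') (v := a)
    have e : x' = y' := ih (by omega) (by omega) (by omega) (by omega)
    subst e
    exact hT.closer_unique (w := b) h1.symm h3.symm (by omega) (by omega)

theorem between_of_le {w b m n : V} (hm : T.dist w m + T.dist m b = T.dist w b)
    (hn : T.dist w n + T.dist n b = T.dist w b) (h : T.dist w m ≤ T.dist w n) :
    T.dist w m + T.dist m n = T.dist w n := by
  obtain ⟨x, h1, h2⟩ := hT.exists_between h
  have := hT.dist_tri w x b
  have := hT.dist_tri x n b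
  have e : m = x := hT.eq_of_between (a := w) (b := b) hm (by omega) (by omega)
  subst e
  omega

/-- The projections `m` and `n` of `a` and `b` to the geodesic from `e` to `c` are ordered along it,
and each order gives one of the alternatives. -/
theorem four_point (a b c e : V) :
    T.dist a b + T.dist c e ≤ T.dist a c + T.dist b e ∨
      T.dist a b + T.dist c e ≤ T.dist a e + T.dist b c := by
  obtain ⟨m, h1, h2, h3⟩ := hT.exists_median e a c
  obtain ⟨n, h4, h5, h6⟩ := hT.exists_median e b c
  have c1 := T.dist_comm (u := m) (v := n)
  have c2 := T.dist_comm (u := a) (v := m)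
  have c3 := T.dist_comm (u := b) (v := n)
  have c4 := T.dist_comm (u := c) (v := e)
  have c5 := T.dist_comm (u := a) (v := e)
  have c6 := T.dist_comm (u := b) (v := e)
  have t1 := hT.dist_tri a m b
  have t2 := hT.dist_tri m n b
  rcases le_total (T.dist e m) (T.dist e n) with h | h
  · have := hT.between_of_le h2 h5 h
    omega
  · have := hT.between_of_le h5 h2 h
    omega

/-- Moving an end by less than its distance to `x` leaves it in the same branch at `x`; this is the
four-point inequality applied once for each end. -/
theorem between_of_close {a b a' b' x : V} (hx : T.dist a x + T.dist x b = T.dist a b)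
    (ha : T.dist a a' < T.dist a x) (hb : T.dist b b' < T.dist x b) :
    T.dist a' x + T.dist x b' = T.dist a' b' := by
  have c1 := T.dist_comm (u := x) (v := b)
  have c2 := T.dist_comm (u := x) (v := b')
  have c3 := T.dist_comm (u := b) (v := a')
  have c4 := T.dist_comm (u := b) (v := a)
  have c5 := T.dist_comm (u := x) (v := a')
  have c6 := T.dist_comm (u := a) (v := x)
  have t1 := hT.dist_tri a' x b
  have t2 := hT.dist_tri a' x b'
  have t3 := hT.dist_tri a a' x
  have t4 := hT.dist_tri b b' x
  have h1 := hT.four_point a b x a'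
  have h2 := hT.four_point a' b x b'
  omega

/-- Local geodesics are geodesics: two geodesics that overlap in a nontrivial segment can be glued
along it. -/
theorem dist_chain {a b c e : V} (h1 : T.dist a c = T.dist a b + T.dist b c)
    (h2 : T.dist b e = T.dist b c + T.dist c e) (h : b ≠ c) :
    T.dist a e = T.dist a b + T.dist b c + T.dist c e := by
  have := hT.1.pos_dist_of_ne h
  have := hT.four_point a c b e
  have := hT.dist_tri a b e
  have := T.dist_comm (u := b) (v := c)
  omega

/-- If the median of `y`, `x`, `z` were not `y`, the first step towards it would be the first step
towards both `x` and `z`. -/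
theorem dist_of_ne_adj {x y z u u' : V} (hu : T.Adj y u) (hu' : T.Adj y u')
    (h : T.dist u x + 1 = T.dist y x) (h' : T.dist u' z + 1 = T.dist y z) (hne : u ≠ u') :
    T.dist x z = T.dist x y + T.dist y z := by
  obtain ⟨m, h1, h2, h3⟩ := hT.exists_median y x z
  by_cases hm : y = m
  · subst hm; omega
  · obtain ⟨k, hk, hkm⟩ := hT.exists_adj_closer hm
    have := hT.dist_tri k m x
    have := hT.dist_tri k m z
    have := hT.dist_adj hk x
    have := hT.dist_adj hk z
    exact absurd ((hT.closer_unique (w := x) hu hk (by omega) (by omega)).trans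
      (hT.closer_unique (w := z) hk hu' (by omega) (by omega))) hne

theorem dist_eq_two {x y z : V} (h : T.Adj x y) (h' : T.Adj y z) (hne : x ≠ z) :
    T.dist x z = 2 := by
  have h1 : T.dist x y = 1 := SimpleGraph.dist_eq_one_iff_adj.2 h
  have h2 : T.dist y z = 1 := SimpleGraph.dist_eq_one_iff_adj.2 h'
  have := hT.dist_of_ne_adj (x := x) (z := z) h.symm h'
    (by simp [T.dist_comm (u := y) (v := x), h1]) (by simp [h2]) hne
  omega

/-- Two vertices at distance at least two have a vertex in between which is closer to every
vertex than the farther one of the two. -/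
theorem exists_closer_of_two_le {u w : V} (h : 2 ≤ T.dist u w) :
    ∃ m, ∀ z, T.dist m z < max (T.dist u z) (T.dist w z) := by
  obtain ⟨m, h1, h2⟩ := hT.exists_between (a := u) (b := w) (k := 1) (by omega)
  refine ⟨m, fun z => ?_⟩
  have := hT.four_point m z u w
  have := T.dist_comm (u := m) (v := w)
  have := T.dist_comm (u := m) (v := u)
  have := T.dist_comm (u := z) (v := u)
  have := T.dist_comm (u := z) (v := w)
  omega

end SimpleGraph.IsTree

/-! ### Fixed vertices, axes and Serre's lemma -/

section TreeActions

variable {V : Type*} {T : SimpleGraph V} {Γ : Type*} [Group Γ] [MulAction Γ V]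

/-- No element of `Γ` exchanges the ends of an edge of `T`. -/
def ActsWithoutInversion (Γ : Type*) [Group Γ] {V : Type*} [MulAction Γ V]
    (T : SimpleGraph V) : Prop :=
  ∀ (g : Γ) (a b : V), T.Adj a b → g • a = b → g • b = a → False

/-- The vertex `v` lies on the axis of the hyperbolic automorphism `g`. -/
def IsAxial (T : SimpleGraph V) (g : Γ) (v : V) : Prop :=
  v ≠ g • v ∧ T.dist v (g • g • v) = 2 * T.dist v (g • v)

variable [GraphAction Γ T] (hT : T.IsTree)

namespace GraphAction

include hT in
theorem smul_eq_of_between {g : Γ} {a b x : V} (ha : g • a = a) (hb : g • b = b)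
    (hx : T.dist a x + T.dist x b = T.dist a b) : g • x = x := by
  have h1 := GraphAction.dist_smul T hT g a x
  have h2 := GraphAction.dist_smul T hT g x b
  rw [ha] at h1
  rw [hb] at h2
  exact hT.eq_of_between (a := a) (b := b) (by omega) hx h1

include hT in
-- A centre argument: the vertices minimizing the largest distance to the orbit of `v` are permuted
-- by `S` and are pairwise at distance at most 1, so they span at most an edge, whose ends cannot be
-- exchanged.
theorem exists_fixed_of_bounded (hinv : ActsWithoutInversion Γ T) (S : Subgroup Γ) (v : V) (B : ℕ)
    (hB : ∀ g ∈ S, T.dist v (g • v) ≤ B) : ∃ x : V, ∀ g ∈ S, g • x = x := by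
  classical
  have hex : ∃ n : ℕ, ∃ u, ∀ g ∈ S, T.dist u (g • v) ≤ n := ⟨B, v, hB⟩
  obtain ⟨u, hu⟩ := Nat.find_spec hex
  set n := Nat.find hex
  have hmin : ∀ a b : V, (∀ g ∈ S, T.dist a (g • v) ≤ n) → (∀ g ∈ S, T.dist b (g • v) ≤ n) →
      T.dist a b ≤ 1 := by
    intro a b ha hb
    by_contra! hab
    obtain ⟨m, hm⟩ := hT.exists_closer_of_two_le (u := a) (w := b) (by omega)
    have h1 : ∀ g ∈ S, T.dist m (g • v) + 1 ≤ n := fun g hg => by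
      have := hm (g • v)
      have := ha g hg
      have := hb g hg
      omega
    have := h1 1 S.one_mem
    exact Nat.find_min hex (m := n - 1) (by omega) ⟨m, fun g hg => by have := h1 g hg; omega⟩
  have hsm : ∀ a : V, (∀ g ∈ S, T.dist a (g • v) ≤ n) → ∀ h ∈ S, ∀ g ∈ S,
      T.dist (h • a) (g • v) ≤ n := by
    intro a ha h hh g hg
    have := ha (h⁻¹ * g) (S.mul_mem (S.inv_mem hh) hg)
    rwa [← GraphAction.dist_smul T hT h, smul_smul, mul_inv_cancel_left] at this
  by_cases hfix : ∀ g ∈ S, g • u = u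
  · exact ⟨u, hfix⟩
  push Not at hfix
  obtain ⟨g, hg, hgu⟩ := hfix
  exfalso
  have hadj : T.Adj u (g • u) := by
    rw [← SimpleGraph.dist_eq_one_iff_adj]
    have := hmin u (g • u) hu (hsm u hu g hg)
    have := hT.1.pos_dist_of_ne hgu.symm
    omega
  have h2 := hsm _ (hsm u hu g hg) g hg
  have h3 := hmin u _ hu h2
  by_cases h4 : u = g • g • u
  · exact hinv g u (g • u) hadj rfl h4.symm
  -- Otherwise `u`, `g • u` and `g • g • u` would form a triangle, whereas distances to adjacent
  -- vertices differ by exactly one.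
  · have h5 := hT.dist_adj hadj (g • g • u)
    have h6 := GraphAction.dist_smul T hT g u (g • u)
    have h7 : T.dist u (g • u) = 1 := SimpleGraph.dist_eq_one_iff_adj.2 hadj
    have h8 := hT.1.pos_dist_of_ne h4
    omega

include hT in
theorem exists_fixed_of_finite (hinv : ActsWithoutInversion Γ T) (S : Subgroup Γ) (hS : Finite S) :
    ∃ x : V, ∀ g ∈ S, g • x = x := by
  obtain ⟨v⟩ := hT.1.nonempty
  have := Fintype.ofFinite S
  refine exists_fixed_of_bounded hT hinv S v (∑ g : S, T.dist v ((g : Γ) • v)) fun g hg => ?_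
  exact Finset.single_le_sum (f := fun g : S => T.dist v ((g : Γ) • v))
    (fun _ _ => Nat.zero_le _) (Finset.mem_univ (⟨g, hg⟩ : S))

end GraphAction

namespace IsAxial

variable {g : Γ} {v : V}

include hT in
-- Consecutive segments from `g ^ n • v` to `g ^ (n + 2) • v` are geodesic and overlap, so they
-- glue.
theorem dist_pow (h : IsAxial T g v) (n : ℕ) : T.dist v (g ^ n • v) = n * T.dist v (g • v) := by
  have hs : ∀ n : ℕ, T.dist v (g ^ (n + 1) • v) = T.dist v (g ^ n • v) + T.dist v (g • v) := by
    intro n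
    have d1 : ∀ n : ℕ, T.dist (g ^ n • v) (g ^ (n + 1) • v) = T.dist v (g • v) := fun n => by
      rw [pow_succ, mul_smul, GraphAction.dist_smul T hT]
    induction n with
    | zero => simp
    | succ n ih =>
      have d2 : T.dist (g ^ n • v) (g ^ (n + 1 + 1) • v) = 2 * T.dist v (g • v) := by
        rw [pow_succ, pow_succ, mul_smul, mul_smul, GraphAction.dist_smul T hT, h.2]
      have := hT.dist_chain (a := v) (b := g ^ n • v) (c := g ^ (n + 1) • v)
        (e := g ^ (n + 1 + 1) • v) (by rw [ih, d1]) (by rw [d1, d1, d2]; ring)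
        (by rw [pow_succ, mul_smul]; exact fun e => h.1 (MulAction.injective _ e))
      rw [this, d1, d1, ih]
  induction n with
  | zero => simp
  | succ n ih => rw [hs, ih]; ring

include hT in
theorem dist_zpow (h : IsAxial T g v) (i : ℤ) (n : ℕ) :
    T.dist (g ^ i • v) (g ^ (i + n) • v) = n * T.dist v (g • v) := by
  rw [zpow_add, mul_smul, GraphAction.dist_smul T hT, zpow_natCast, h.dist_pow hT]

include hT in
theorem mul_le_dist (h : IsAxial T g v) (x : V) (n : ℕ) :
    n * T.dist v (g • v) ≤ T.dist x (g ^ n • x) := by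
  have h1 : ∀ m : ℕ, T.dist x (g ^ (m * n) • x) ≤ m * T.dist x (g ^ n • x) := by
    intro m
    induction m with
    | zero => simp
    | succ m ih =>
      have := hT.dist_tri x (g ^ (m * n) • x) (g ^ ((m + 1) * n) • x)
      rw [add_mul m 1 n, one_mul, pow_add, mul_smul, GraphAction.dist_smul T hT] at this
      rw [add_mul m 1 n, one_mul, pow_add, mul_smul]
      linarith
  have h2 : ∀ m : ℕ, m * (n * T.dist v (g • v)) ≤ 2 * T.dist v x + m * T.dist x (g ^ n • x) := by
    intro m
    have e1 := h.dist_pow hT (m * n)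
    have t1 := hT.dist_tri v x (g ^ (m * n) • v)
    have t2 := hT.dist_tri x (g ^ (m * n) • x) (g ^ (m * n) • v)
    rw [GraphAction.dist_smul T hT, T.dist_comm (u := x) (v := v)] at t2
    have := h1 m
    rw [← mul_assoc]
    omega
  by_contra! hlt
  -- A deficit of at least 1 for each of the `m` blocks exceeds the fixed error `2 * T.dist v x` as
  -- soon as `m` does.
  have := h2 (2 * T.dist v x + 1)
  nlinarith

include hT in
theorem le_dist_pow (h : IsAxial T g v) (x : V) (n : ℕ) : n ≤ T.dist x (g ^ n • x) := by
  have := h.mul_le_dist hT x n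
  have := hT.1.pos_dist_of_ne h.1
  nlinarith

include hT in
theorem smul_ne (h : IsAxial T g v) (x : V) : g • x ≠ x := by
  intro e
  have := h.le_dist_pow hT x 1
  simp [e] at this

include hT in
theorem orderOf_eq_zero (h : IsAxial T g v) : orderOf g = 0 := by
  rw [orderOf_eq_zero_iff']
  intro n hn e
  have := h.le_dist_pow hT v n
  simp [e] at this
  omega

include hT in
/-- If a translate of a point by a large power of `g` is close to the point, then the axis of `g`
passes between them. -/
theorem between (h : IsAxial T g v) {x : V} {n : ℕ} (hn : T.dist v x < n) :
    T.dist (g ^ (-(n : ℤ)) • x) v + T.dist v (g ^ (n : ℤ) • x) =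
      T.dist (g ^ (-(n : ℤ)) • x) (g ^ (n : ℤ) • x) := by
  have p := hT.1.pos_dist_of_ne h.1
  have e1 := h.dist_zpow hT (-n) n
  have e2 := h.dist_zpow hT 0 n
  have e3 := h.dist_zpow hT (-n) (2 * n)
  have e4 : -(n : ℤ) + ((2 * n : ℕ) : ℤ) = n := by push_cast; ring
  rw [e4] at e3
  simp only [neg_add_cancel, zpow_zero, one_smul, zero_add] at e1 e2
  refine hT.between_of_close (a := g ^ (-(n : ℤ)) • v) (b := g ^ (n : ℤ) • v) ?_ ?_ ?_
  · rw [e1, e2, e3]; ring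
  · rw [GraphAction.dist_smul T hT, e1]; nlinarith
  · rw [GraphAction.dist_smul T hT, e2]; nlinarith

include hT in
-- The element `c` fixes the whole `g`-orbit of `x`, and `v` lies between two far translates of `x`.
theorem smul_eq_of_comm (h : IsAxial T g v) {c : Γ} (hc : c * g = g * c) {x : V}
    (hx : c • x = x) : c • v = v := by
  have hcz : ∀ n : ℤ, c • g ^ n • x = g ^ n • x := fun n => by
    have : Commute c (g ^ n) := Commute.zpow_right hc n
    rw [smul_smul, this.eq, mul_smul, hx]
  exact GraphAction.smul_eq_of_between hT (hcz _) (hcz _) (h.between hT (Nat.lt_succ_self _))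

include hT in
/-- The position of `c • v` on the axis of `g`. -/
theorem exists_position (h : IsAxial T g v) {c : Γ} (hc : c * g = g * c) :
    ∃ (k : ℤ) (N : ℕ), ∀ n ≥ N,
      (T.dist (g ^ (-(n : ℤ)) • v) (c • v) : ℤ) = n * T.dist v (g • v) + k ∧
      (T.dist (c • v) (g ^ (n : ℤ) • v) : ℤ) = n * T.dist v (g • v) - k := by
  set ℓ := T.dist v (g • v) with hℓ
  have hax : IsAxial T g (c • v) := by
    have e : ∀ y : V, g • c • y = c • g • y := fun y => by rw [smul_smul, ← hc, mul_smul]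
    refine ⟨?_, ?_⟩
    · rw [e]; exact fun h' => h.1 (MulAction.injective c h')
    · rw [e, e, GraphAction.dist_smul T hT, GraphAction.dist_smul T hT]; exact h.2
  set N := T.dist (c • v) v + 1 with hN
  have hs : ∀ n ≥ N, T.dist (g ^ (-(n : ℤ)) • v) (c • v) + T.dist (c • v) (g ^ (n : ℤ) • v) =
      2 * (n * ℓ) := by
    intro n hn
    rw [hax.between hT (by omega)]
    have e3 := h.dist_zpow hT (-n) (2 * n)
    have e4 : -(n : ℤ) + ((2 * n : ℕ) : ℤ) = n := by push_cast; ring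
    rw [e4] at e3
    rw [e3]; ring
  refine ⟨(T.dist (g ^ (-(N : ℤ)) • v) (c • v) : ℤ) - N * ℓ, N, fun n hn => ?_⟩
  -- From `n` to `n + 1` each of the two distances grows by at most `ℓ` and their sum by `2ℓ`, so
  -- each grows by exactly `ℓ`.
  have hA : (T.dist (g ^ (-(n : ℤ)) • v) (c • v) : ℤ) =
      n * ℓ + ((T.dist (g ^ (-(N : ℤ)) • v) (c • v) : ℤ) - N * ℓ) := by
    induction n, hn using Nat.le_induction with
    | base => ring
    | succ n hn ih =>
      have h1 := hs n hn
      have h2 := hs (n + 1) (by omega)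
      have t1 := hT.dist_tri (g ^ (-((n + 1 : ℕ) : ℤ)) • v) (g ^ (-(n : ℤ)) • v) (c • v)
      have t2 := hT.dist_tri (c • v) (g ^ (n : ℤ) • v) (g ^ ((n + 1 : ℕ) : ℤ) • v)
      have e1 := h.dist_zpow hT (-((n + 1 : ℕ) : ℤ)) 1
      have e2 := h.dist_zpow hT n 1
      rw [show -((n + 1 : ℕ) : ℤ) + ((1 : ℕ) : ℤ) = -(n : ℤ) by push_cast; ring] at e1
      rw [show (n : ℤ) + ((1 : ℕ) : ℤ) = ((n + 1 : ℕ) : ℤ) by push_cast; ring] at e2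
      rw [e1] at t1
      rw [e2] at t2
      push_cast at h2 ⊢
      zify at h1 h2 t1 t2
      linarith
  refine ⟨hA, ?_⟩
  have := hs n hn
  zify at this
  linarith

include hT in
-- The shift along the axis is a homomorphism to the integers. An element with shift zero fixes `v`,
-- so freeness makes the homomorphism injective.
theorem isCyclic_of_free (h : IsAxial T g v) (C : Subgroup Γ) (hC : ∀ c ∈ C, c * g = g * c)
    (hfree : ∀ c ∈ C, c • v = v → c = 1) : IsCyclic C := by
  set ℓ := T.dist v (g • v) with hℓ
  choose τ N hτ using fun c : C => h.exists_position hT (hC c c.2)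
  have hmul : ∀ c c' : C, τ (c * c') = τ c + τ c' := by
    intro c c'
    set m := N c' with hm
    -- Large enough for `c * c'`, and still for `c` after `m` is subtracted. Through `g ^ (∓m) • c •
    -- v` the triangle inequality bounds the shift of the product from both sides.
    set n := N (c * c') + N c + m with hn
    obtain ⟨a1, a2⟩ := hτ (c * c') n (by omega)
    obtain ⟨b1, b2⟩ := hτ c (n - m) (by omega)
    obtain ⟨d1, d2⟩ := hτ c' m le_rfl
    have hcm : ∀ i : ℤ, (c : Γ) • g ^ i • v = g ^ i • (c : Γ) • v := fun i => by
      have : Commute (c : Γ) (g ^ i) := Commute.zpow_right (hC c c.2) i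
      rw [smul_smul, this.eq, mul_smul]
    rw [← GraphAction.dist_smul T hT (c : Γ), hcm, smul_smul (c : Γ) (c' : Γ)] at d1
    rw [← GraphAction.dist_smul T hT (c : Γ), hcm, smul_smul (c : Γ) (c' : Γ)] at d2
    rw [← GraphAction.dist_smul T hT (g ^ (-(m : ℤ))), smul_smul, ← zpow_add] at b1
    rw [← GraphAction.dist_smul T hT (g ^ (m : ℤ)), smul_smul _ (g ^ ((n - m : ℕ) : ℤ)), ← zpow_add] at b2
    rw [show -(m : ℤ) + -((n - m : ℕ) : ℤ) = -(n : ℤ) by omega] at b1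
    rw [show (m : ℤ) + ((n - m : ℕ) : ℤ) = n by omega] at b2
    have t1 := hT.dist_tri (g ^ (-(n : ℤ)) • v) (g ^ (-(m : ℤ)) • (c : Γ) • v)
      (((c : Γ) * c') • v)
    have t2 := hT.dist_tri (((c : Γ) * c') • v) (g ^ (m : ℤ) • (c : Γ) • v) (g ^ (n : ℤ) • v)
    have e : ((n - m : ℕ) : ℤ) = n - m := by omega
    rw [e] at b1 b2
    zify at t1 t2
    rw [b1, d1] at t1
    rw [b2, d2] at t2
    rw [Subgroup.coe_mul] at a1 a2
    rw [a1] at t1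
    rw [a2] at t2
    linarith
  let f : C →* Multiplicative ℤ :=
    { toFun := fun c => Multiplicative.ofAdd (τ c)
      map_one' := by
        have := hmul 1 1
        rw [mul_one] at this
        have : τ 1 = 0 := by omega
        rw [this]; rfl
      map_mul' := fun c c' => by rw [hmul]; rfl }
  refine isCyclic_of_injective f ?_
  rw [injective_iff_map_eq_one]
  intro c hc
  have h0 : τ c = 0 := hc
  obtain ⟨a1, a2⟩ := hτ c (N c) le_rfl
  have e1 := h.dist_zpow hT (-(N c : ℤ)) (N c)
  have e2 := h.dist_zpow hT 0 (N c)
  have e3 := h.dist_zpow hT (-(N c : ℤ)) (2 * N c)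
  rw [show -(N c : ℤ) + ((2 * N c : ℕ) : ℤ) = N c by push_cast; ring] at e3
  simp only [neg_add_cancel, zpow_zero, one_smul, zero_add] at e1 e2
  rw [h0, add_zero, ← hℓ] at a1
  rw [h0, sub_zero, ← hℓ] at a2
  have b1 : T.dist (g ^ (-(N c : ℤ)) • v) ((c : Γ) • v) = N c * ℓ := by exact_mod_cast a1
  have b2 : T.dist ((c : Γ) • v) (g ^ (N c : ℤ) • v) = N c * ℓ := by exact_mod_cast a2
  refine Subtype.ext (hfree c c.2 ?_)
  refine hT.eq_of_between (a := g ^ (-(N c : ℤ)) • v) (b := g ^ (N c : ℤ) • v) ?_ ?_ ?_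
  · rw [b1, b2, e3]; ring
  · rw [e1, e2, e3]; ring
  · rw [b1, e1]

end IsAxial

namespace GraphAction

include hT in
-- Take a vertex of least displacement. If the geodesics from `v` to `g • v` and on to `g • g • v`
-- backtracked at `g • v`, the neighbour `u` of `v` would be displaced less, or `g` would invert an
-- edge.
theorem fixed_or_axial (hinv : ActsWithoutInversion Γ T) (g : Γ) :
    (∃ v : V, g • v = v) ∨ ∃ v : V, IsAxial T g v := by
  classical
  have hex : ∃ n : ℕ, ∃ v : V, T.dist v (g • v) = n :=
    let ⟨v⟩ := hT.1.nonempty; ⟨_, v, rfl⟩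
  obtain ⟨v, hv⟩ := Nat.find_spec hex
  set n := Nat.find hex
  have hmin : ∀ u : V, n ≤ T.dist u (g • u) := fun u => Nat.find_min' hex ⟨u, rfl⟩
  by_cases hvg : v = g • v
  · exact Or.inl ⟨v, hvg.symm⟩
  refine Or.inr ⟨v, hvg, ?_⟩
  obtain ⟨u, hu, hu'⟩ := hT.exists_adj_closer hvg
  obtain ⟨m, hm, hm'⟩ := hT.exists_adj_closer (Ne.symm hvg)
  have h1 := smul_adj (T := T) g _ _ hu
  have h2 := GraphAction.dist_smul T hT g u (g • v)
  have h3 := GraphAction.dist_smul T hT g v (g • v)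
  by_cases hne : m = g • u
  · exfalso
    subst hne
    have h4 := hmin u
    have c1 := T.dist_comm (u := u) (v := g • u)
    have c2 := T.dist_comm (u := u) (v := v)
    have c3 := T.dist_comm (u := v) (v := g • u)
    have c4 := T.dist_comm (u := v) (v := g • v)
    have d1 : T.dist v u = 1 := SimpleGraph.dist_eq_one_iff_adj.2 hu
    by_cases hn : n = 1
    · have e1 : u = g • v := (hT.1.dist_eq_zero_iff).1 (by omega)
      have e2 : g • u = v := (hT.1.dist_eq_zero_iff).1 (by omega)
      exact hinv g v u hu e1.symm e2
    · have e3 : T.dist v (g • u) + 1 = T.dist v (g • v) := by omega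
      have hvu : v ≠ g • u := by
        rintro e
        rw [← e] at e3
        simp at e3
        omega
      obtain ⟨y, hy, hy'⟩ := hT.exists_adj_closer hvu
      have t1 := hT.dist_tri y (g • u) (g • v)
      have d2 : T.dist (g • u) (g • v) = 1 := by
        rw [GraphAction.dist_smul T hT, T.dist_comm]; exact d1
      have t2 := hT.dist_adj hy (g • v)
      have : y = u := hT.closer_unique (w := g • v) hy hu (by omega) hu'
      subst this
      omega
  · have := hT.dist_of_ne_adj (x := v) (y := g • v) (z := g • g • v) hm h1 hm' (by omega) hne
    omega

include hT in
-- Serre's lemma. If the fixed sets of `a` and `b` were disjoint, the shortest segment from `x` to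
-- `y` between them would have length `n > 0`, and `a * b` would translate `y` along an axis by
-- `2n`, so it could not fix `z`.
theorem exists_common_fixed {a b : Γ} {x y z : V} (ha : a • x = x) (hb : b • y = y)
    (hab : (a * b) • z = z) : ∃ w : V, a • w = w ∧ b • w = w := by
  classical
  have hex : ∃ n : ℕ, ∃ x y : V, a • x = x ∧ b • y = y ∧ T.dist x y = n := ⟨_, x, y, ha, hb, rfl⟩
  clear ha hb
  obtain ⟨x, y, ha, hb, hxy⟩ := Nat.find_spec hex
  set n := Nat.find hex
  have hmin : ∀ x y : V, a • x = x → b • y = y → n ≤ T.dist x y :=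
    fun x y h h' => Nat.find_min' hex ⟨x, y, h, h', rfl⟩
  by_cases hne : x = y
  · exact ⟨x, ha, hne ▸ hb⟩
  exfalso
  -- Since `p` is a fixed vertex of `c` closest to `q`, the first edge from `p` towards `q` is
  -- moved, and the path from `q` through `p` to `c • q` does not backtrack.
  have hyx : ∀ {p q : V} (c : Γ), p ≠ q → c • p = p →
      (∀ u, c • u = u → T.dist p q ≤ T.dist u q) → T.dist q (c • q) = 2 * T.dist p q := by
    intro p q c hpq hc hcmin
    obtain ⟨u, hu, hu'⟩ := hT.exists_adj_closer hpq
    have h1 := smul_adj (T := T) c _ _ hu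
    rw [hc] at h1
    have h2 := GraphAction.dist_smul T hT c u q
    have h3 := GraphAction.dist_smul T hT c p q
    rw [hc] at h3
    have := hT.dist_of_ne_adj (x := q) (z := c • q) hu h1 hu' (by omega)
      (fun e => by have := hcmin u e.symm; omega)
    rw [T.dist_comm (u := q) (v := p)] at this
    omega
  have k1 : T.dist y (a • y) = 2 * n := by
    rw [hyx a hne ha fun u hu => hxy.trans_le (hmin u y hu hb), hxy]
  have k2 : T.dist x (b • x) = 2 * n := by
    rw [hyx b (Ne.symm hne) hb fun u hu => by
      rw [T.dist_comm (u := u), T.dist_comm, hxy]; exact hmin x u ha hu, T.dist_comm, hxy]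
  have hpos := hT.1.pos_dist_of_ne hne
  have c1 := T.dist_comm (u := y) (v := x)
  have d1 : T.dist x (a • y) = n := by
    have := GraphAction.dist_smul T hT a x y; rw [ha] at this; omega
  have d2 : T.dist y (b • x) = n := by
    have := GraphAction.dist_smul T hT b y x; rw [hb] at this; omega
  have e1 : T.dist y (a • b • x) = T.dist y x + T.dist x (a • y) + T.dist (a • y) (a • b • x) := by
    refine hT.dist_chain (by omega) ?_ (fun e => ?_)
    · have := GraphAction.dist_smul T hT a x (b • x); rw [ha] at this
      have := GraphAction.dist_smul T hT a y (b • x)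
      omega
    · rw [← e] at d1; simp at d1; omega
  have e2 := GraphAction.dist_smul T hT a y (b • x)
  have hax : IsAxial T (a * b) y := by
    have e3 : (a * b) • y = a • y := by rw [mul_smul, hb]
    refine ⟨fun e => ?_, ?_⟩
    · rw [e3] at e; rw [← e] at k1; simp at k1; omega
    · rw [e3, k1]
      have e4 : T.dist y ((a * b) • a • y) =
          T.dist y (a • y) + T.dist (a • y) (a • b • x) + T.dist (a • b • x) ((a * b) • a • y) := by
        have f1 : T.dist (a • y) ((a * b) • a • y) = 2 * n := by
          rw [← e3, GraphAction.dist_smul T hT, e3, k1]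
        have f2 : T.dist (a • b • x) ((a * b) • a • y) = n := by
          rw [mul_smul, GraphAction.dist_smul T hT, GraphAction.dist_smul T hT, d1]
        refine hT.dist_chain (by omega) (by omega) (fun e => ?_)
        rw [e] at e2; simp at e2; omega
      rw [e4]
      have f2 : T.dist (a • b • x) ((a * b) • a • y) = n := by
        rw [mul_smul, GraphAction.dist_smul T hT, GraphAction.dist_smul T hT, d1]
      omega
  exact hax.smul_ne hT z hab

end GraphAction

end TreeActions

/-! ### Gromov products and the boundary -/

section GromovHyperbolic

variable {Y : Type*} [MetricSpace Y]

/-- Gromov's inequality, for some constant. -/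
def IsGromovHyperbolic (Y : Type*) [MetricSpace Y] : Prop :=
  ∃ δ : ℝ, ∀ x y z w : Y,
    min (gromovProduct x y w) (gromovProduct y z w) - δ ≤ gromovProduct x z w

theorem gromovProduct_comm (x y z : Y) : gromovProduct x y z = gromovProduct y x z := by
  simp only [gromovProduct, dist_comm x y]; ring

theorem gromovProduct_self (x z : Y) : gromovProduct x x z = dist x z := by
  simp [gromovProduct]

theorem gromovProduct_le_add (x y z x' y' z' : Y) :
    gromovProduct x y z ≤ gromovProduct x' y' z' + (dist x x' + dist y y' + dist z z') := by
  have h1 := dist_triangle4 x x' z' z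
  have h2 := dist_triangle4 y y' z' z
  have h3 := dist_triangle4 x' x y y'
  rw [dist_comm z' z] at h1 h2
  rw [dist_comm x' x] at h3
  simp only [gromovProduct]
  linarith

theorem tendsto_gromovProduct_of_base {ι : Type*} {l : Filter ι} {u v : ι → Y} (z : Y)
    (h : Tendsto (fun i => gromovProduct (u i) (v i) z) l atTop) (z' : Y) :
    Tendsto (fun i => gromovProduct (u i) (v i) z') l atTop := by
  refine tendsto_atTop_mono (fun i => ?_) (tendsto_atTop_add_const_right l (-dist z z') h)
  have := gromovProduct_le_add (u i) (v i) z (u i) (v i) z'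
  simp only [dist_self] at this
  linarith

theorem ConvergesToInfinity.tendsto_dist {u : ℕ → Y} (hu : ConvergesToInfinity u) (z : Y) :
    Tendsto (fun n => dist (u n) z) atTop atTop := by
  have h : Tendsto (fun n : ℕ => (n, n)) atTop atTop :=
    tendsto_atTop_atTop.2 fun b => ⟨max b.1 b.2, fun n hn =>
      ⟨(le_max_left _ _).trans hn, (le_max_right _ _).trans hn⟩⟩
  refine ((hu z).comp h).congr fun n => ?_
  exact gromovProduct_self _ _

namespace GromovBoundary

/-- A quotient by a relation identifies points by the equivalence it generates; here Gromov's
inequality makes the relation transitive already. -/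
theorem mk_eq_mk_iff (hY : IsGromovHyperbolic Y) {u v : {u : ℕ → Y // ConvergesToInfinity u}} :
    (Quot.mk _ u : GromovBoundary Y) = Quot.mk _ v ↔
      ∀ z : Y, Tendsto (fun n : ℕ => gromovProduct (u.1 n) (v.1 n) z) atTop atTop := by
  refine ⟨fun h => ?_, fun h => Quot.sound h⟩
  replace h := Quot.eqvGen_exact h
  obtain ⟨δ, hδ⟩ := hY
  induction h with
  | rel _ _ h => exact h
  | refl u =>
    intro z
    simp only [gromovProduct_self]
    exact u.2.tendsto_dist z
  | symm _ _ _ ih =>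
    intro z
    simp only [gromovProduct_comm]
    simpa only [gromovProduct_comm] using ih z
  | trans u v w _ _ ih1 ih2 =>
    intro z
    rw [tendsto_atTop]
    intro b
    filter_upwards [tendsto_atTop.1 (ih1 z) (b + δ), tendsto_atTop.1 (ih2 z) (b + δ)] with n h1 h2
    have := hδ (u.1 n) (v.1 n) (w.1 n) z
    have := le_min h1 h2
    linarith

end GromovBoundary

end GromovHyperbolic

/-! ### Limit sets of bounded and of loxodromic subgroups -/

section LimitSets

variable {Y : Type*} [MetricSpace Y] {Γ : Type*} [Group Γ] [MulAction Γ Y]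

theorem limitSet_mono {H K : Subgroup Γ} (h : H ≤ K) : limitSet Y H ⊆ limitSet Y K := by
  rintro ξ ⟨x, u, hu, rfl⟩
  exact ⟨x, u, fun n => let ⟨k, hk, e⟩ := hu n; ⟨k, h hk, e⟩, rfl⟩

variable [IsIsometricSMul Γ Y]

theorem limitSet_eq_empty {H : Subgroup Γ} (y : Y) (B : ℝ) (hB : ∀ h ∈ H, dist y (h • y) ≤ B) :
    limitSet Y H = ∅ := by
  rw [Set.eq_empty_iff_forall_notMem]
  rintro ξ ⟨x, u, hu, -⟩
  have h1 := u.2.tendsto_dist x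
  obtain ⟨n, hn⟩ := (tendsto_atTop.1 h1 (2 * dist x y + B + 1)).exists
  obtain ⟨h, hh, e⟩ := hu n
  have h2 := dist_triangle4 (h • x) (h • y) y x
  rw [_root_.dist_smul, dist_comm (h • y) y, dist_comm y x, ← e] at h2
  have := hB h hh
  linarith

theorem isElementary_of_fixed {H : Subgroup Γ} (y : Y) (hy : ∀ h ∈ H, h • y = y) :
    IsElementary Y H := by
  have := limitSet_eq_empty (H := H) y 0 fun h hh => by rw [hy h hh, dist_self]
  simp [IsElementary, this]

section Translation

variable {g : Γ} {y : Y} {ℓ : ℝ}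

theorem dist_pow_pow (hd : ∀ n : ℕ, dist y (g ^ n • y) = n * ℓ) (i j : ℕ) :
    dist (g ^ i • y) (g ^ j • y) = |(i : ℝ) - j| * ℓ := by
  rcases le_total i j with h | h <;> obtain ⟨k, rfl⟩ := Nat.exists_eq_add_of_le h
  · rw [pow_add, mul_smul, _root_.dist_smul, hd]
    simp
  · rw [pow_add, mul_smul, _root_.dist_smul, dist_comm, hd]
    simp

theorem gromovProduct_pow_pow (hd : ∀ n : ℕ, dist y (g ^ n • y) = n * ℓ) (i j : ℕ) :
    gromovProduct (g ^ i • y) (g ^ j • y) y = min (i : ℝ) j * ℓ := by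
  rw [gromovProduct, dist_pow_pow hd, dist_comm _ y, dist_comm _ y, hd, hd]
  rcases le_total (i : ℝ) j with h | h
  · rw [min_eq_left h, abs_of_nonpos (by linarith)]; ring
  · rw [min_eq_right h, abs_of_nonneg (by linarith)]; ring

theorem convergesToInfinity_pow (hℓ : 0 < ℓ) (hd : ∀ n : ℕ, dist y (g ^ n • y) = n * ℓ) :
    ConvergesToInfinity fun n : ℕ => g ^ n • y := by
  refine tendsto_gromovProduct_of_base y ?_
  simp only [gromovProduct_pow_pow hd]
  refine Tendsto.atTop_mul_const hℓ (tendsto_atTop.2 fun b => ?_)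
  obtain ⟨n, hn⟩ := exists_nat_ge b
  filter_upwards [eventually_ge_atTop ((n, n) : ℕ × ℕ)] with i hi
  exact le_min (hn.trans (by exact_mod_cast hi.1)) (hn.trans (by exact_mod_cast hi.2))

/-- The attracting end of an element which acts as a translation on an orbit. -/
def attractingEnd (hℓ : 0 < ℓ) (hd : ∀ n : ℕ, dist y (g ^ n • y) = n * ℓ) : GromovBoundary Y :=
  Quot.mk _ ⟨_, convergesToInfinity_pow hℓ hd⟩

theorem attractingEnd_mem (hℓ : 0 < ℓ) (hd : ∀ n : ℕ, dist y (g ^ n • y) = n * ℓ)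
    {H : Subgroup Γ} (hg : g ∈ H) : attractingEnd hℓ hd ∈ limitSet Y H :=
  ⟨y, _, fun n => ⟨g ^ n, H.pow_mem hg n, rfl⟩, rfl⟩

theorem attractingEnd_ne (hY : IsGromovHyperbolic Y) (hℓ : 0 < ℓ)
    (hd : ∀ n : ℕ, dist y (g ^ n • y) = n * ℓ) {h : Γ} {m : ℝ} (hm : 0 < m)
    (hd' : ∀ n : ℕ, dist y (h ^ n • y) = n * m)
    (hgh : ∀ n : ℕ, dist (g ^ n • y) (h ^ n • y) = dist y (g ^ n • y) + dist y (h ^ n • y)) :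
    attractingEnd hℓ hd ≠ attractingEnd hm hd' := by
  intro e
  have h1 := (GromovBoundary.mk_eq_mk_iff hY).1 e y
  have h2 : ∀ n : ℕ, gromovProduct (g ^ n • y) (h ^ n • y) y = 0 := fun n => by
    rw [gromovProduct, hgh, dist_comm _ y, dist_comm _ y]; ring
  simp only [h2] at h1
  obtain ⟨n, hn⟩ := (tendsto_atTop.1 h1 1).exists
  linarith

theorem dist_inv_pow (hd : ∀ n : ℕ, dist y (g ^ n • y) = n * ℓ) (n : ℕ) :
    dist y (g⁻¹ ^ n • y) = n * ℓ := by
  rw [← _root_.dist_smul (g ^ n), smul_smul, inv_pow, mul_inv_cancel, one_smul, dist_comm, hd]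

theorem dist_pow_inv_pow (hd : ∀ n : ℕ, dist y (g ^ n • y) = n * ℓ) (n m : ℕ) :
    dist (g ^ n • y) (g⁻¹ ^ m • y) = n * ℓ + m * ℓ := by
  rw [← _root_.dist_smul (g ^ m), smul_smul, smul_smul, inv_pow, mul_inv_cancel, one_smul,
    ← pow_add, dist_comm, hd]
  push_cast
  ring

/-- The exponents `k n` tend to infinity because `u` leaves every ball, and the Gromov product with
`g ^ n • y` is at least `min (k n) n * ℓ - dist x y`. -/
theorem mk_eq_attractingEnd (hℓ : 0 < ℓ)
    (hd : ∀ n : ℕ, dist y (g ^ n • y) = n * ℓ) (x : Y)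
    (u : {u : ℕ → Y // ConvergesToInfinity u}) (k : ℕ → ℕ)
    (hu : ∀ᶠ n in atTop, u.1 n = g ^ k n • x) :
    (Quot.mk _ u : GromovBoundary Y) = attractingEnd hℓ hd := by
  refine Quot.sound (tendsto_gromovProduct_of_base y ?_)
  have hk : Tendsto (fun n => (k n : ℝ)) atTop atTop := by
    rw [tendsto_atTop]
    intro b
    filter_upwards [hu, tendsto_atTop.1 (u.2.tendsto_dist y) (b * ℓ + dist x y)] with n h1 h2
    have h3 := dist_triangle (g ^ k n • x) (g ^ k n • y) y
    rw [_root_.dist_smul, dist_comm (g ^ k n • y) y, hd] at h3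
    rw [h1] at h2
    exact le_of_mul_le_mul_right (by linarith) hℓ
  have hmin : Tendsto (fun n : ℕ => min (k n : ℝ) n * ℓ + -dist x y) atTop atTop := by
    refine tendsto_atTop_add_const_right _ _ (Tendsto.atTop_mul_const hℓ ?_)
    rw [tendsto_atTop]
    intro b
    filter_upwards [tendsto_atTop.1 hk b,
      tendsto_atTop.1 (tendsto_natCast_atTop_atTop (R := ℝ)) b] with n h1 h2
    exact le_min h1 h2
  refine tendsto_atTop_mono' _ ?_ hmin
  filter_upwards [hu] with n hn
  have := gromovProduct_le_add (g ^ k n • y) (g ^ n • y) y (g ^ k n • x) (g ^ n • y) y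
  rw [gromovProduct_pow_pow hd, _root_.dist_smul, dist_self, dist_self, dist_comm y x] at this
  rw [hn]
  linarith

/-- Positive and negative powers have bounded Gromov products, so the exponents of a sequence
converging to infinity eventually keep one sign and the limit is one of the two ends. -/
theorem limitSet_zpowers (hY : IsGromovHyperbolic Y) (hℓ : 0 < ℓ)
    (hd : ∀ n : ℕ, dist y (g ^ n • y) = n * ℓ) : (limitSet Y (Subgroup.zpowers g)).encard = 2 := by
  have hne := attractingEnd_ne hY hℓ hd hℓ (dist_inv_pow hd) fun n => by
    rw [dist_pow_inv_pow hd, hd, dist_inv_pow hd]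
  suffices h : limitSet Y (Subgroup.zpowers g) =
      {attractingEnd hℓ hd, attractingEnd hℓ (dist_inv_pow hd)} by
    rw [h, Set.encard_pair hne]
  refine Set.Subset.antisymm ?_ ?_
  · rintro ξ ⟨x, u, hu, rfl⟩
    choose h hh hux using hu
    choose k hk using fun n => Subgroup.mem_zpowers_iff.1 (hh n)
    have huk : ∀ n, u.1 n = g ^ k n • x := fun n => by rw [hux, hk]
    -- The product vanishes at `y`; replacing `y` by `x` in its three entries costs `dist x y` each.
    have key : ∀ a b : ℕ, gromovProduct (g ^ a • x) (g⁻¹ ^ b • x) x ≤ 3 * dist x y := by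
      intro a b
      have := gromovProduct_le_add (g ^ a • x) (g⁻¹ ^ b • x) x (g ^ a • y) (g⁻¹ ^ b • y) y
      have h0 : gromovProduct (g ^ a • y) (g⁻¹ ^ b • y) y = 0 := by
        rw [gromovProduct, dist_pow_inv_pow hd, dist_comm _ y, dist_comm _ y, hd, dist_inv_pow hd]
        ring
      rw [_root_.dist_smul, _root_.dist_smul, h0] at this
      linarith
    have hpos : ∀ i : ℤ, 0 ≤ i → g ^ i = g ^ i.toNat := fun i hi => by
      rw [← zpow_natCast, Int.toNat_of_nonneg hi]
    have hneg : ∀ i : ℤ, i ≤ 0 → g ^ i = g⁻¹ ^ (-i).toNat := fun i hi => by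
      rw [← zpow_natCast, Int.toNat_of_nonneg (by omega), inv_zpow', neg_neg]
    obtain ⟨N, hN⟩ := eventually_atTop.1 (tendsto_atTop.1 (u.2 x) (3 * dist x y + 1))
    have hsame : ∀ i j, i ≥ N.1 → j ≥ N.2 → ¬ (0 ≤ k i ∧ k j ≤ 0) := by
      rintro i j hi hj ⟨h1, h2⟩
      have := hN (i, j) ⟨hi, hj⟩
      have h3 := key (k i).toNat (-k j).toNat
      rw [← hpos _ h1, ← hneg _ h2, ← huk, ← huk] at h3
      dsimp only at this
      linarith
    set M := max N.1 N.2
    rcases le_total 0 (k M) with h0 | h0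
    · left
      refine mk_eq_attractingEnd hℓ hd x u (fun n => (k n).toNat) ?_
      filter_upwards [eventually_ge_atTop M] with n hn
      have := hsame M n (le_max_left _ _) ((le_max_right _ _).trans hn)
      rw [huk, hpos _ (by omega)]
    · right
      refine mk_eq_attractingEnd hℓ (dist_inv_pow hd) x u (fun n => (-k n).toNat) ?_
      filter_upwards [eventually_ge_atTop M] with n hn
      have := hsame n M ((le_max_left _ _).trans hn) (le_max_right _ _)
      rw [huk, hneg _ (by omega)]
  · rintro ξ (rfl | rfl)
    · exact attractingEnd_mem _ _ (Subgroup.mem_zpowers g)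
    · exact attractingEnd_mem _ _ (Subgroup.inv_mem _ (Subgroup.mem_zpowers g))

end Translation

end LimitSets

/-! ### Hyperbolicity of the geometric realization -/

namespace TreePoint

variable {V : Type*} {T : SimpleGraph V} {hT : T.IsTree}

theorem dist_ofVertex (a b : V) : dist (ofVertex hT a) (ofVertex hT b) = T.dist a b := by
  have := hT.1.nonempty
  refine le_antisymm (ciSup_le fun v => abs_dist_sub_le hT a b v) ?_
  have := le_ciSup (bddAbove (ofVertex hT a) (ofVertex hT b)) b
  refine le_trans ?_ this
  simp [ofVertex]

theorem exists_ofVertex_dist_le (x : TreePoint T hT) : ∃ a : V, dist x (ofVertex hT a) ≤ 1 := by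
  obtain ⟨a, b, t, hab, h0, h1, h⟩ := x.exists_edge
  have := hT.1.nonempty
  refine ⟨a, ciSup_le fun v => ?_⟩
  have hd : (T.dist a b : ℝ) ≤ 1 := by
    rcases hab with rfl | hab
    · simp
    · rw [SimpleGraph.dist_eq_one_iff_adj.2 hab]; simp
  have e : x.distTo v - (ofVertex hT a).distTo v = t * ((T.dist b v : ℝ) - T.dist a v) := by
    rw [h]; simp only [ofVertex]; ring
  rw [e, abs_mul, abs_of_nonneg h0, abs_sub_comm]
  have := abs_dist_sub_le hT a b v
  nlinarith [abs_nonneg ((T.dist a v : ℝ) - T.dist b v)]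

theorem isGromovHyperbolic : IsGromovHyperbolic (TreePoint T hT) := by
  -- Vertices satisfy the inequality with constant 0, and rounding the points to vertices changes
  -- each product by at most 3; any constant from 6 on would do.
  refine ⟨8, fun x y z w => ?_⟩
  obtain ⟨a, ha⟩ := x.exists_ofVertex_dist_le
  obtain ⟨b, hb⟩ := y.exists_ofVertex_dist_le
  obtain ⟨c, hc⟩ := z.exists_ofVertex_dist_le
  obtain ⟨e, he⟩ := w.exists_ofVertex_dist_le
  have h1 := gromovProduct_le_add x y w (ofVertex hT a) (ofVertex hT b) (ofVertex hT e)
  have h2 := gromovProduct_le_add y z w (ofVertex hT b) (ofVertex hT c) (ofVertex hT e)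
  have h3 := gromovProduct_le_add (ofVertex hT a) (ofVertex hT c) (ofVertex hT e) x z w
  rw [dist_comm _ x, dist_comm _ z, dist_comm _ w] at h3
  have h4 : min (gromovProduct (ofVertex hT a) (ofVertex hT b) (ofVertex hT e))
      (gromovProduct (ofVertex hT b) (ofVertex hT c) (ofVertex hT e)) ≤
      gromovProduct (ofVertex hT a) (ofVertex hT c) (ofVertex hT e) := by
    simp only [gromovProduct, dist_ofVertex, min_le_iff]
    have h5 := hT.four_point a c e b
    rw [T.dist_comm (u := e) (v := b), T.dist_comm (u := c) (v := b)] at h5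
    rcases h5 with h5 | h5
    · right
      have : (T.dist a c : ℝ) + T.dist b e ≤ T.dist a e + T.dist b c := by exact_mod_cast h5
      linarith
    · left
      have : (T.dist a c : ℝ) + T.dist b e ≤ T.dist a b + T.dist c e := by exact_mod_cast h5
      linarith
  have h6 : min (gromovProduct x y w) (gromovProduct y z w) - 3 ≤
      min (gromovProduct (ofVertex hT a) (ofVertex hT b) (ofVertex hT e))
        (gromovProduct (ofVertex hT b) (ofVertex hT c) (ofVertex hT e)) := le_min
    (by have := min_le_left (gromovProduct x y w) (gromovProduct y z w); linarith)
    (by have := min_le_right (gromovProduct x y w) (gromovProduct y z w); linarith)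
  linarith

variable {G : Type*} [Group G] [MulAction G V] [GraphAction G T]

theorem smul_ofVertex (g : G) (a : V) : g • ofVertex hT a = ofVertex hT (g • a) := by
  ext v
  show (T.dist a (g⁻¹ • v) : ℝ) = T.dist (g • a) v
  rw [← GraphAction.dist_smul T hT g a, smul_inv_smul]

end TreePoint

/-! ### Elements of order p in AGL(1, p) -/

section AffineLine

variable {p : ℕ} [Fact p.Prime]

theorem AffineEquiv.apply_eq_mul_add (f : ZMod p ≃ᵃ[ZMod p] ZMod p) (x : ZMod p) :
    f x = x * f.linear 1 + f 0 := by
  have h1 := f.map_vadd 0 x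
  have h2 : f.linear x = x * f.linear 1 := by
    conv_lhs => rw [show x = x • (1 : ZMod p) by simp, map_smul, smul_eq_mul]
  simpa [h2] using h1

/-- The slope satisfies `a ^ p = 1` because `f ^ p = 1`, and `a ^ p = a` by Fermat. -/
theorem AffineEquiv.linear_one_eq_one {f : ZMod p ≃ᵃ[ZMod p] ZMod p} (hf : orderOf f = p) :
    f.linear 1 = 1 := by
  have h1 : ∀ n : ℕ, (f ^ n).linear 1 = (f.linear 1) ^ n := by
    intro n
    induction n with
    | zero => simp [AffineEquiv.one_def]
    | succ n ih =>
      have : (f ^ (n + 1)).linear 1 = (f ^ n).linear (f.linear 1) := by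
        rw [pow_succ]; rfl
      have h2 : ∀ c : ZMod p, (f ^ n).linear c = c * (f ^ n).linear 1 := fun c => by
        conv_lhs => rw [show c = c • (1 : ZMod p) by simp, map_smul, smul_eq_mul]
      rw [this, h2, ih, pow_succ, mul_comm]
  have h2 := h1 p
  have h3 : f ^ p = 1 := orderOf_dvd_iff_pow_eq_one.1 hf.dvd
  rw [ZMod.pow_card, h3] at h2
  rw [← h2]
  simp [AffineEquiv.one_def]

theorem AffineEquiv.apply_eq_add {f : ZMod p ≃ᵃ[ZMod p] ZMod p} (hf : orderOf f = p)
    (x : ZMod p) : f x = x + f 0 := by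
  rw [f.apply_eq_mul_add, AffineEquiv.linear_one_eq_one hf, mul_one]

/-- Here `f` is a translation, and conjugation by `k` multiplies its vector by the slope of `k`. -/
theorem AffineEquiv.conj_eq_pow {f : ZMod p ≃ᵃ[ZMod p] ZMod p} (hf : orderOf f = p)
    (k : ZMod p ≃ᵃ[ZMod p] ZMod p) : k * f * k⁻¹ = f ^ (k.linear 1).val := by
  have h1 : ∀ (n : ℕ) (x : ZMod p), (f ^ n) x = x + n * f 0 := by
    intro n
    induction n with
    | zero => intro x; simp
    | succ n ih =>
      intro x
      rw [pow_succ, AffineEquiv.mul_def, AffineEquiv.trans_apply, ih,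
        AffineEquiv.apply_eq_add hf x]
      push_cast
      ring
  ext x
  rw [h1]
  have h2 : (k * f * k⁻¹) x = k (f (k⁻¹ x)) := rfl
  have h3 : k (k⁻¹ x) = x := k.apply_symm_apply x
  rw [h2, AffineEquiv.apply_eq_add hf, k.apply_eq_mul_add, add_mul, add_right_comm,
    ← k.apply_eq_mul_add, h3, ZMod.natCast_val, ZMod.cast_id', id, mul_comm]

theorem AffineEquiv.exists_conj_eq_sq {f : ZMod p ≃ᵃ[ZMod p] ZMod p} (hf : orderOf f = p)
    (hp : p ≠ 2) : ∃ k : ZMod p ≃ᵃ[ZMod p] ZMod p, k * f * k⁻¹ = f ^ 2 := by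
  have hp' := (Fact.out : p.Prime).two_le
  have h2 : (2 : ZMod p) ≠ 0 := by
    intro h
    have : ((2 : ℕ) : ZMod p) = 0 := by exact_mod_cast h
    rw [ZMod.natCast_eq_zero_iff] at this
    have := Nat.le_of_dvd (by norm_num) this
    omega
  refine ⟨(LinearEquiv.smulOfNeZero (ZMod p) (ZMod p) 2 h2).toAffineEquiv, ?_⟩
  rw [AffineEquiv.conj_eq_pow hf]
  have e : ((LinearEquiv.smulOfNeZero (ZMod p) (ZMod p) 2 h2).toAffineEquiv.linear 1) = 2 := by
    show (2 : ZMod p) • (1 : ZMod p) = 2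
    simp
  rw [e, show (2 : ZMod p) = ((2 : ℕ) : ZMod p) by norm_num, ZMod.val_natCast,
    Nat.mod_eq_of_lt (by omega)]

end AffineLine

/-! ### Pairs of involutions, dihedral groups, minimal and affine types -/

section Pairs

variable {G : Type*} [Group G] {K : Type*} [Group K] {p : ℕ}

theorem mul_self_of_orderOf_eq_two {r : G} (hr : orderOf r = 2) : r * r = 1 := by
  rw [← pow_two, ← hr, pow_orderOf_eq_one]

theorem inv_of_orderOf_eq_two {r : G} (hr : orderOf r = 2) : r⁻¹ = r :=
  inv_eq_of_mul_eq_one_right (mul_self_of_orderOf_eq_two hr)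

theorem orderOf_eq_two_of_mul_self {r : G} (hr : r * r = 1) (h1 : r ≠ 1) : orderOf r = 2 :=
  orderOf_eq_prime (by rw [pow_two, hr]) h1

theorem mem_normalizer_zpowers {z n : G} :
    n ∈ Subgroup.normalizer (Subgroup.zpowers z : Set G) ↔
      n * z * n⁻¹ ∈ Subgroup.zpowers z ∧ n⁻¹ * z * n ∈ Subgroup.zpowers z := by
  have key : ∀ {m : G}, m * z * m⁻¹ ∈ Subgroup.zpowers z →
      ∀ x ∈ Subgroup.zpowers z, m * x * m⁻¹ ∈ Subgroup.zpowers z := by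
    rintro m hm _ ⟨k, rfl⟩
    have := (Subgroup.zpowers z).zpow_mem hm k
    rwa [conj_zpow] at this
  rw [Subgroup.mem_normalizer_iff]
  refine ⟨fun h => ⟨(h z).1 (Subgroup.mem_zpowers z), ?_⟩, fun h x => ⟨key h.1 x, fun hx => ?_⟩⟩
  · refine (h _).2 ?_
    simp [mul_assoc]
  · have h2 := key (m := n⁻¹) (by simpa using h.2) _ hx
    simpa [mul_assoc] using h2

theorem mem_normalizer_zpowers_of_comm {z n : G} (h : n * z = z * n) :
    n ∈ Subgroup.normalizer (Subgroup.zpowers z : Set G) := by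
  rw [mem_normalizer_zpowers]
  have h1 : n * z * n⁻¹ = z := by rw [h, mul_inv_cancel_right]
  have h2 : n⁻¹ * z * n = z := by rw [mul_assoc, ← h, inv_mul_cancel_left]
  rw [h1, h2]
  exact ⟨Subgroup.mem_zpowers z, Subgroup.mem_zpowers z⟩

theorem IsInvolutionPair.conj_left {r s : G} (h : IsInvolutionPair r s) :
    r * (r * s) * r⁻¹ = (r * s)⁻¹ := by
  rw [mul_inv_rev, inv_of_orderOf_eq_two h.1, inv_of_orderOf_eq_two h.2.1, ← mul_assoc,
    mul_self_of_orderOf_eq_two h.1, one_mul]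

theorem IsInvolutionPair.mul_ne_one {r s : G} (h : IsInvolutionPair r s) : r * s ≠ 1 := fun e =>
  h.2.2 (by rw [eq_inv_of_mul_eq_one_left e, inv_of_orderOf_eq_two h.2.1])

theorem IsInvolutionPair.mem_normalizer {r s : G} (h : IsInvolutionPair r s) :
    r ∈ Subgroup.normalizer (Subgroup.zpowers (r * s) : Set G) ∧
      s ∈ Subgroup.normalizer (Subgroup.zpowers (r * s) : Set G) := by
  have hr : r ∈ Subgroup.normalizer (Subgroup.zpowers (r * s) : Set G) := by
    rw [mem_normalizer_zpowers]
    have h2 : r⁻¹ * (r * s) * r = r * (r * s) * r⁻¹ := by rw [inv_of_orderOf_eq_two h.1]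
    rw [h2, h.conj_left]
    have := (Subgroup.zpowers (r * s)).inv_mem (Subgroup.mem_zpowers _)
    exact ⟨this, this⟩
  refine ⟨hr, ?_⟩
  have := Subgroup.mul_mem _ (Subgroup.inv_mem _ hr)
    (Subgroup.le_normalizer (Subgroup.mem_zpowers (r * s)))
  rwa [inv_mul_cancel_left] at this

theorem IsInvolutionPair.map {f : G →* K} (hf : Function.Injective f) {r s : G}
    (h : IsInvolutionPair r s) : IsInvolutionPair (f r) (f s) :=
  ⟨by rw [orderOf_injective f hf, h.1], by rw [orderOf_injective f hf, h.2.1],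
    fun e => h.2.2 (hf e)⟩

theorem IsInvolutionPair.of_map {f : G →* K} (hf : Function.Injective f) {r s : G}
    (h : IsInvolutionPair (f r) (f s)) : IsInvolutionPair r s :=
  ⟨by rw [← orderOf_injective f hf, h.1], by rw [← orderOf_injective f hf, h.2.1],
    fun e => h.2.2 (congrArg f e)⟩

theorem map_dihedralSubgroup (f : G →* K) (r s : G) :
    (dihedralSubgroup r s).map f = dihedralSubgroup (f r) (f s) := by
  rw [dihedralSubgroup, MonoidHom.map_closure, Set.image_pair]; rfl

theorem IsAffinePair.map {f : G →* K} (hf : Function.Injective f) {r s : G}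
    (h : IsAffinePair p r s) : IsAffinePair p (f r) (f s) := by
  obtain ⟨h1, H, hH, ⟨e⟩⟩ := h
  refine ⟨h1.map hf, H.map f, ?_, ⟨(H.equivMapOfInjective f hf).symm.trans e⟩⟩
  rw [← map_dihedralSubgroup]
  exact Subgroup.map_mono hH

/-- Being of minimal type depends on a normalizer, so it passes to a larger group only if the
normalizer does not grow. -/
theorem map_normalizer_zpowers_of_le {f : G →* K} (hf : Function.Injective f) {z : G}
    (h : Subgroup.normalizer (Subgroup.zpowers (f z) : Set K) ≤ f.range) :
    Subgroup.normalizer (Subgroup.zpowers (f z) : Set K) =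
      (Subgroup.normalizer (Subgroup.zpowers z : Set G)).map f := by
  have key : ∀ n : G, f n ∈ Subgroup.normalizer (Subgroup.zpowers (f z) : Set K) ↔
      n ∈ Subgroup.normalizer (Subgroup.zpowers z : Set G) := fun n => by
    have hm : ∀ x : G, f x ∈ Subgroup.zpowers (f z) ↔ x ∈ Subgroup.zpowers z := fun x => by
      rw [← MonoidHom.map_zpowers, Subgroup.mem_map_iff_mem hf]
    simp only [mem_normalizer_zpowers, ← map_inv, ← map_mul, hm]
  ext x
  constructor
  · intro hx
    obtain ⟨n, rfl⟩ := h hx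
    exact Subgroup.mem_map_of_mem f ((key n).1 hx)
  · rintro ⟨n, hn, rfl⟩
    exact (key n).2 hn

theorem IsMinimalPair.map {f : G →* K} (hf : Function.Injective f) {r s : G}
    (h : IsMinimalPair p r s)
    (hn : Subgroup.normalizer (Subgroup.zpowers (f (r * s)) : Set K) ≤ f.range) :
    IsMinimalPair p (f r) (f s) := by
  refine ⟨h.1.map hf, ?_, ?_⟩
  · rw [← map_mul, orderOf_injective f hf, h.2.1]
  · rw [← map_mul, map_normalizer_zpowers_of_le hf hn, h.2.2, map_dihedralSubgroup]

theorem IsAffinePair.exists_conj [Fact p.Prime] {r s : G} (h : IsAffinePair p r s)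
    (ho : orderOf (r * s) = p) : ∃ H : Subgroup G, dihedralSubgroup r s ≤ H ∧
      Nonempty (H ≃* (ZMod p ≃ᵃ[ZMod p] ZMod p)) ∧
      H ≤ Subgroup.normalizer (Subgroup.zpowers (r * s) : Set G) ∧
      (p ≠ 2 → ∃ k ∈ H, k * (r * s) * k⁻¹ = (r * s) ^ 2) := by
  obtain ⟨-, H, hH, ⟨e⟩⟩ := h
  refine ⟨H, hH, ⟨e⟩, ?_⟩
  have hz : r * s ∈ H := H.mul_mem (hH (left_mem_dihedralSubgroup r s))
    (hH (right_mem_dihedralSubgroup r s))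
  have hf : orderOf (e ⟨r * s, hz⟩) = p := by
    rw [MulEquiv.orderOf_eq, Subgroup.orderOf_mk, ho]
  have key : ∀ k ∈ H, k * (r * s) * k⁻¹ ∈ Subgroup.zpowers (r * s) := by
    intro k hk
    have h1 := AffineEquiv.conj_eq_pow hf (e ⟨k, hk⟩)
    rw [← map_inv, ← map_mul, ← map_mul, ← map_pow] at h1
    have h2 := congrArg Subtype.val (e.injective h1)
    exact ⟨_, (zpow_natCast _ _).trans h2.symm⟩
  refine ⟨fun k hk => mem_normalizer_zpowers.2 ⟨key k hk, ?_⟩, fun hp => ?_⟩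
  · simpa using key k⁻¹ (H.inv_mem hk)
  · obtain ⟨k, hk⟩ := AffineEquiv.exists_conj_eq_sq hf hp
    obtain ⟨k, rfl⟩ := e.surjective k
    rw [← map_inv, ← map_mul, ← map_mul, ← map_pow] at hk
    exact ⟨k, k.2, congrArg Subtype.val (e.injective hk)⟩

/-- The affine subgroup normalizes the cyclic group of the translation, so it is contained in the
range of `f` and can be pulled back. -/
theorem IsAffinePair.of_map [Fact p.Prime] {f : G →* K} (hf : Function.Injective f) {r s : G}
    (h : IsAffinePair p (f r) (f s)) (ho : orderOf (r * s) = p)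
    (hn : Subgroup.normalizer (Subgroup.zpowers (f (r * s)) : Set K) ≤ f.range) :
    IsAffinePair p r s := by
  obtain ⟨H, hH, ⟨e⟩, hHn, -⟩ := h.exists_conj (by rw [← map_mul, orderOf_injective f hf, ho])
  rw [← map_mul] at hHn
  have hmap : (H.comap f).map f = H := Subgroup.map_comap_eq_self (hHn.trans hn)
  refine ⟨h.1.of_map hf, H.comap f, ?_,
    ⟨((H.comap f).equivMapOfInjective f hf).trans ((MulEquiv.subgroupCongr hmap).trans e)⟩⟩
  rw [← Subgroup.map_le_iff_le_comap, map_dihedralSubgroup]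
  exact hH

theorem IsInvolutionPair.mem_dihedralSubgroup {r s g : G} (h : IsInvolutionPair r s)
    (hg : g ∈ dihedralSubgroup r s) : ∃ n : ℤ, g = (r * s) ^ n ∨ g = r * (r * s) ^ n := by
  have hr := mul_self_of_orderOf_eq_two h.1
  have hs := mul_self_of_orderOf_eq_two h.2.1
  have hmr : ∀ g : G, (∃ n : ℤ, g = (r * s) ^ n ∨ g = r * (r * s) ^ n) →
      ∃ n : ℤ, r * g = (r * s) ^ n ∨ r * g = r * (r * s) ^ n := by
    rintro _ ⟨n, rfl | rfl⟩
    · exact ⟨n, Or.inr rfl⟩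
    · exact ⟨n, Or.inl (by rw [← mul_assoc, hr, one_mul])⟩
  have hms : ∀ g : G, (∃ n : ℤ, g = (r * s) ^ n ∨ g = r * (r * s) ^ n) →
      ∃ n : ℤ, s * g = (r * s) ^ n ∨ s * g = r * (r * s) ^ n := by
    have e : s = r * (r * s) := by rw [← mul_assoc, hr, one_mul]
    have e' : s * r = (r * s)⁻¹ := by
      rw [mul_inv_rev, inv_of_orderOf_eq_two h.1, inv_of_orderOf_eq_two h.2.1]
    rintro _ ⟨n, rfl | rfl⟩
    · refine ⟨n + 1, Or.inr ?_⟩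
      rw [add_comm, zpow_add, zpow_one, ← mul_assoc r, ← e]
    · refine ⟨-1 + n, Or.inl ?_⟩
      rw [← mul_assoc, e', zpow_add, zpow_neg_one]
  induction hg using Subgroup.closure_induction_left with
  | one => exact ⟨0, Or.inl (by simp)⟩
  | mul_left x hx y hy ih =>
    rcases hx with rfl | rfl
    exacts [hmr _ ih, hms _ ih]
  | inv_mul_cancel x hx y hy ih =>
    rcases hx with rfl | rfl
    · rw [inv_of_orderOf_eq_two h.1]; exact hmr _ ih
    · rw [inv_of_orderOf_eq_two h.2.1]; exact hms _ ih

theorem IsInvolutionPair.encard_dihedralSubgroup_le {r s : G} (h : IsInvolutionPair r s)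
    (ho : orderOf (r * s) ≠ 0) :
    (dihedralSubgroup r s : Set G).encard ≤ 2 * orderOf (r * s) := by
  have hz : (Subgroup.zpowers (r * s) : Set G).encard = orderOf (r * s) := by
    have : Finite (Subgroup.zpowers (r * s)) :=
      finite_zpowers.2 (orderOf_ne_zero_iff.1 ho)
    rw [← Nat.card_zpowers]
    exact (Set.Finite.cast_ncard_eq (Set.toFinite _)).symm
  have hsub : (dihedralSubgroup r s : Set G) ⊆
      (Subgroup.zpowers (r * s) : Set G) ∪ (fun x => r * x) '' Subgroup.zpowers (r * s) := by
    intro g hg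
    obtain ⟨n, rfl | rfl⟩ := h.mem_dihedralSubgroup hg
    · exact Or.inl ⟨n, rfl⟩
    · exact Or.inr ⟨_, ⟨n, rfl⟩, rfl⟩
  refine (Set.encard_le_encard hsub).trans ((Set.encard_union_le _ _).trans ?_)
  rw [hz, two_mul]
  exact add_le_add le_rfl ((Set.encard_image_le _ _).trans hz.le)

theorem IsInvolutionPair.left_notMem_zpowers {r s : G} (h : IsInvolutionPair r s)
    (ho : Odd (orderOf (r * s))) : r ∉ Subgroup.zpowers (r * s) := by
  intro hr
  have := orderOf_dvd_of_mem_zpowers hr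
  rw [h.1] at this
  exact (Nat.not_even_iff_odd.2 ho) (even_iff_two_dvd.2 this)

/-- The graph of the isomorphism is the dihedral group `S` generated by `(r, r')` and `(s, s')` in
the product. Both projections are injective on it: rotations have equal orders on the two sides, and
a reflection is nontrivial on each side because these orders are odd. -/
theorem exists_dihedral_mulEquiv {r s : G} {r' s' : K} (h : IsInvolutionPair r s)
    (h' : IsInvolutionPair r' s') (ho : Odd (orderOf (r * s)))
    (ho' : orderOf (r' * s') = orderOf (r * s)) :
    ∃ φ : dihedralSubgroup r s ≃* dihedralSubgroup r' s',
      (φ ⟨r, left_mem_dihedralSubgroup r s⟩ : K) = r' ∧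
      (φ ⟨s, right_mem_dihedralSubgroup r s⟩ : K) = s' := by
  have hR : ∀ {x : G} {y : K}, orderOf x = 2 → orderOf y = 2 → orderOf (x, y) = 2 := by
    intro x y hx hy
    refine orderOf_eq_two_of_mul_self ?_ (fun e => ?_)
    · rw [Prod.mk_mul_mk, mul_self_of_orderOf_eq_two hx, mul_self_of_orderOf_eq_two hy]; rfl
    · rw [show x = 1 from (Prod.ext_iff.1 e).1] at hx; simp at hx
  have hP : IsInvolutionPair (r, r') (s, s') :=
    ⟨hR h.1 h'.1, hR h.2.1 h'.2.1, fun e => h.2.2 (Prod.ext_iff.1 e).1⟩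
  set S := dihedralSubgroup (r, r') (s, s') with hS
  have m1 : S.map (MonoidHom.fst G K) = dihedralSubgroup r s := map_dihedralSubgroup _ _ _
  have m2 : S.map (MonoidHom.snd G K) = dihedralSubgroup r' s' := map_dihedralSubgroup _ _ _
  have hz : ∀ n : ℤ, ((r, r') * (s, s')) ^ n = ((r * s) ^ n, (r' * s') ^ n) := fun n => rfl
  have i1 : Function.Injective ((MonoidHom.fst G K).subgroupMap S) := by
    rw [injective_iff_map_eq_one]
    rintro ⟨x, hx⟩ he
    have he : x.1 = 1 := congrArg Subtype.val he
    obtain ⟨n, e | e⟩ := hP.mem_dihedralSubgroup hx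
    · subst e
      rw [hz] at he
      have h1 := orderOf_dvd_iff_zpow_eq_one.2 he
      rw [← ho'] at h1
      have h2 := orderOf_dvd_iff_zpow_eq_one.1 h1
      exact Subtype.ext (Prod.ext he h2)
    · subst e
      refine absurd ?_ (h.left_notMem_zpowers ho)
      exact ⟨-n, by show _ ^ (-n) = _; rw [zpow_neg]; exact (eq_inv_of_mul_eq_one_left he).symm⟩
  have i2 : Function.Injective ((MonoidHom.snd G K).subgroupMap S) := by
    rw [injective_iff_map_eq_one]
    rintro ⟨x, hx⟩ he
    have he : x.2 = 1 := congrArg Subtype.val he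
    obtain ⟨n, e | e⟩ := hP.mem_dihedralSubgroup hx
    · subst e
      rw [hz] at he
      have h1 := orderOf_dvd_iff_zpow_eq_one.2 he
      rw [ho'] at h1
      have h2 := orderOf_dvd_iff_zpow_eq_one.1 h1
      exact Subtype.ext (Prod.ext h2 he)
    · subst e
      refine absurd ?_ (h'.left_notMem_zpowers (ho' ▸ ho))
      exact ⟨-n, by show _ ^ (-n) = _; rw [zpow_neg]; exact (eq_inv_of_mul_eq_one_left he).symm⟩
  let e1 := MulEquiv.ofBijective _ ⟨i1, (MonoidHom.fst G K).subgroupMap_surjective S⟩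
  let e2 := MulEquiv.ofBijective _ ⟨i2, (MonoidHom.snd G K).subgroupMap_surjective S⟩
  let φ := ((MulEquiv.subgroupCongr m1).symm.trans e1.symm).trans
    (e2.trans (MulEquiv.subgroupCongr m2))
  have hφ : ∀ (x : G × K) (hx : x ∈ S) (hx' : x.1 ∈ dihedralSubgroup r s),
      (φ ⟨x.1, hx'⟩ : K) = x.2 := by
    intro x hx hx'
    have : e1.symm ((MulEquiv.subgroupCongr m1).symm ⟨x.1, hx'⟩) = ⟨x, hx⟩ := by
      rw [MulEquiv.symm_apply_eq]; rfl
    show ((e2 (e1.symm ((MulEquiv.subgroupCongr m1).symm ⟨x.1, hx'⟩)) : _) : K) = x.2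
    rw [this]
    rfl
  exact ⟨φ, hφ (r, r') (left_mem_dihedralSubgroup _ _) _,
    hφ (s, s') (right_mem_dihedralSubgroup _ _) _⟩

theorem zpowers_eq_of_prime {a z : G} (hp : p.Prime) (ha : orderOf a = p)
    (hz : z ∈ Subgroup.zpowers a) (h1 : z ≠ 1) : Subgroup.zpowers z = Subgroup.zpowers a := by
  have : Finite (Subgroup.zpowers a) :=
    finite_zpowers.2 (orderOf_ne_zero_iff.1 (ha ▸ hp.ne_zero))
  refine Subgroup.eq_of_le_of_card_ge (by simpa using hz) ?_
  rw [Nat.card_zpowers, Nat.card_zpowers, ha]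
  have := orderOf_dvd_of_mem_zpowers hz
  rw [ha] at this
  rcases (Nat.dvd_prime hp).1 this with h | h
  · exact absurd (orderOf_eq_one_iff.1 h) h1
  · exact h.ge

/-- The cyclic groups generated by a translation of affine type and by a translation of minimal
type do not meet. -/
theorem IsMinimalPair.eq_one_of_mem_zpowers_affine [Fact p.Prime] (hp2 : p ≠ 2) (hp3 : p ≠ 3)
    {r s r' s' : G} (h : IsAffinePair p r s) (ho : orderOf (r * s) = p)
    (h' : IsMinimalPair p r' s') {z : G} (hz : z ∈ Subgroup.zpowers (r * s))
    (hz' : z ∈ Subgroup.zpowers (r' * s')) : z = 1 := by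
  by_contra hz1
  have hp : p.Prime := Fact.out
  have e := (zpowers_eq_of_prime hp ho hz hz1).symm.trans (zpowers_eq_of_prime hp h'.2.1 hz' hz1)
  obtain ⟨H, -, -, hH, hk⟩ := h.exists_conj ho
  -- If the groups meet they coincide, so `k`, which squares `r * s` by conjugation, lies in the
  -- dihedral group of `r'` and `s'`. Its elements centralize or invert `r * s`, so `p` divides 1 or
  -- 3.
  obtain ⟨k, hk, hk2⟩ := hk hp2
  have hkD := hH hk
  rw [e, h'.2.2] at hkD
  have hw : r * s ∈ Subgroup.zpowers (r' * s') := e ▸ Subgroup.mem_zpowers _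
  obtain ⟨m, hm⟩ := hw
  have hm : (r' * s') ^ m = r * s := hm
  have hcom : ∀ n : ℤ, (r' * s') ^ n * (r * s) * ((r' * s') ^ n)⁻¹ = r * s := fun n => by
    rw [← hm, ((Commute.refl (r' * s')).zpow_zpow n m).eq, mul_inv_cancel_right]
  have hord : ∀ n : ℕ, (r * s) ^ n = 1 → p ∣ n := fun n hn => ho ▸ orderOf_dvd_of_pow_eq_one hn
  obtain ⟨n, rfl | rfl⟩ := h'.1.mem_dihedralSubgroup hkD
  · rw [hcom, pow_two] at hk2
    have := hord 1 (by simpa using hk2.symm)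
    exact hp.one_lt.ne' (Nat.dvd_one.1 this)
  · have e1 : r' * (r' * s') ^ n * (r * s) * (r' * (r' * s') ^ n)⁻¹ = (r * s)⁻¹ := by
      calc r' * (r' * s') ^ n * (r * s) * (r' * (r' * s') ^ n)⁻¹
          = r' * ((r' * s') ^ n * (r * s) * ((r' * s') ^ n)⁻¹) * r'⁻¹ := by group
        _ = (r * s)⁻¹ := by
            rw [hcom, ← hm, ← conj_zpow, h'.1.conj_left, inv_zpow]
    rw [e1] at hk2
    have := hord 3 (by rw [pow_succ, ← hk2, inv_mul_cancel])
    exact hp3 ((Nat.prime_dvd_prime_iff_eq hp Nat.prime_three).1 this)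

theorem map_mem_translations {f : G →* K} (hf : Function.Injective f) {g : G}
    (hg : g ∈ translations G) : f g ∈ translations K := by
  obtain ⟨r, s, h, rfl⟩ := hg
  exact ⟨f r, f s, h.map hf, map_mul f r s⟩

instance translationSubgroup_normal : (translationSubgroup G).Normal := by
  refine ⟨fun n hn g => ?_⟩
  have h : (translationSubgroup G).map (MulAut.conj g).toMonoidHom ≤ translationSubgroup G := by
    rw [translationSubgroup, MonoidHom.map_closure]
    refine Subgroup.closure_mono ?_
    rintro _ ⟨x, hx, rfl⟩
    exact map_mem_translations (MulAut.conj g).injective hx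
  exact h ⟨n, hn, rfl⟩

end Pairs

/-! ### Passing to subgroups; the invariant A; asymptotic lengths -/

section SubgroupActions

variable {Y : Type*} [MetricSpace Y] {Γ : Type*} [Group Γ] [MulAction Γ Y] {N : Subgroup Γ}

theorem limitSet_map_subtype (H : Subgroup N) : limitSet Y (H.map N.subtype) = limitSet Y H := by
  ext ξ
  constructor
  · rintro ⟨x, u, hu, rfl⟩
    refine ⟨x, u, fun n => ?_, rfl⟩
    obtain ⟨_, ⟨h, hh, rfl⟩, e⟩ := hu n
    exact ⟨h, hh, e⟩
  · rintro ⟨x, u, hu, rfl⟩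
    refine ⟨x, u, fun n => ?_, rfl⟩
    obtain ⟨h, hh, e⟩ := hu n
    exact ⟨h, ⟨h, hh, rfl⟩, e⟩

theorem isLoxodromic_coe (g : N) : IsLoxodromic Y (g : Γ) ↔ IsLoxodromic Y g := by
  rw [IsLoxodromic, IsLoxodromic, IsLoxodromicSubgroup, IsLoxodromicSubgroup,
    ← limitSet_map_subtype, MonoidHom.map_zpowers]
  rfl

/-- On its axis an element of translation length 0 fixes every point, so a common point of the axes
is fixed by the generated subgroup, which is then elementary. The intersections in question are all
empty. -/
theorem invariantA_eq_zero [IsIsometricSMul Γ Y] : invariantA Γ Y = 0 := by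
  simp only [invariantA, ENNReal.iSup_eq_zero]
  rintro g ⟨hg, hj⟩
  have h : (⋂ j, axis Y (g j)) = ∅ := by
    rw [Set.eq_empty_iff_forall_notMem]
    intro x hx
    rw [Set.mem_iInter] at hx
    refine hg (isElementary_of_fixed x ?_)
    have hle : Subgroup.closure (Set.range g) ≤ MulAction.stabilizer Γ x := by
      rw [Subgroup.closure_le]
      rintro _ ⟨j, rfl⟩
      have h1 : dist x (g j • x) = translationLength Y (g j) := hx j
      have h2 : dist x (g j • x) = 0 := le_antisymm (h1.trans_le (hj j)) dist_nonneg
      exact (dist_eq_zero.1 h2).symm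
    exact fun k hk => hle hk
  rw [h, Metric.ediam_empty]

theorem tendsto_dist_pow_div [IsIsometricSMul Γ Y] {g : Γ} {y : Y} {ℓ : ℝ}
    (hd : ∀ n : ℕ, dist y (g ^ n • y) = n * ℓ) (x : Y) :
    Tendsto (fun n : ℕ => dist x (g ^ n • x) / (n : ℝ)) atTop (𝓝 ℓ) := by
  have h0 : Tendsto (fun n : ℕ => 2 * dist x y / (n : ℝ)) atTop (𝓝 0) :=
    tendsto_const_div_atTop_nhds_zero_nat _
  have h1 := (tendsto_const_nhds (x := ℓ) (f := atTop)).sub h0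
  have h2 := (tendsto_const_nhds (x := ℓ) (f := atTop)).add h0
  rw [sub_zero] at h1
  rw [add_zero] at h2
  have hb : ∀ n : ℕ, n * ℓ - 2 * dist x y ≤ dist x (g ^ n • x) ∧
      dist x (g ^ n • x) ≤ n * ℓ + 2 * dist x y := by
    intro n
    have t1 := dist_triangle4 y x (g ^ n • x) (g ^ n • y)
    have t2 := dist_triangle4 x y (g ^ n • y) (g ^ n • x)
    rw [_root_.dist_smul, hd, dist_comm y x] at t1
    rw [_root_.dist_smul, hd, dist_comm y x] at t2
    constructor <;> linarith
  refine tendsto_of_tendsto_of_tendsto_of_le_of_le' h1 h2 ?_ ?_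
  · filter_upwards [eventually_gt_atTop 0] with n hn
    have hn' : (0 : ℝ) < n := by exact_mod_cast hn
    rw [le_div_iff₀ hn', sub_mul, div_mul_cancel₀ _ hn'.ne']
    linarith [(hb n).1]
  · filter_upwards [eventually_gt_atTop 0] with n hn
    have hn' : (0 : ℝ) < n := by exact_mod_cast hn
    rw [div_le_iff₀ hn', add_mul, div_mul_cancel₀ _ hn'.ne']
    linarith [(hb n).2]

end SubgroupActions

/-! ### Acylindricity, injectivity radius and non-elementarity for trees -/

section TreeActions

variable {V : Type*} {T : SimpleGraph V} {Γ : Type*} [Group Γ] [MulAction Γ V] [GraphAction Γ T]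
  {hT : T.IsTree}

namespace IsAxial

variable {g : Γ} {v : V}

omit [GraphAction Γ T] in
theorem length_pos (hT : T.IsTree) (h : IsAxial T g v) : (0 : ℝ) < T.dist v (g • v) := by
  exact_mod_cast hT.1.pos_dist_of_ne h.1

theorem dist_ofVertex_pow (hT : T.IsTree) (h : IsAxial T g v) (n : ℕ) :
    dist (TreePoint.ofVertex hT v) (g ^ n • TreePoint.ofVertex hT v) =
      n * (T.dist v (g • v) : ℝ) := by
  rw [TreePoint.smul_ofVertex, TreePoint.dist_ofVertex, h.dist_pow hT]
  push_cast
  rfl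

theorem encard_limitSet (h : IsAxial T g v) :
    (limitSet (TreePoint T hT) (Subgroup.zpowers g)).encard = 2 :=
  limitSet_zpowers TreePoint.isGromovHyperbolic (h.length_pos hT) (h.dist_ofVertex_pow hT)

end IsAxial

theorem exists_lt_dist_of_nonempty_limitSet {H : Subgroup Γ}
    (hH : (limitSet (TreePoint T hT) H).Nonempty) (v : V) (B : ℕ) :
    ∃ h ∈ H, B < T.dist v (h • v) := by
  by_contra! hB
  rw [limitSet_eq_empty (TreePoint.ofVertex hT v) B fun h hh => ?_] at hH
  · exact Set.not_nonempty_empty hH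
  · rw [TreePoint.smul_ofVertex, TreePoint.dist_ofVertex]
    exact_mod_cast hB h hh

theorem IsLoxodromicSubgroup.exists_lt_dist {H : Subgroup Γ}
    (hH : IsLoxodromicSubgroup (TreePoint T hT) H) (v : V) (B : ℕ) :
    ∃ h ∈ H, B < T.dist v (h • v) := by
  refine exists_lt_dist_of_nonempty_limitSet (hT := hT) (Set.nonempty_iff_ne_empty.2 fun e => ?_) v B
  rw [IsLoxodromicSubgroup, e] at hH
  simp at hH

theorem IsLoxodromic.exists_isAxial (hinv : ActsWithoutInversion Γ T) {g : Γ}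
    (hg : IsLoxodromic (TreePoint T hT) g) : ∃ v : V, IsAxial T g v := by
  rcases GraphAction.fixed_or_axial hT hinv g with ⟨v, hv⟩ | h
  · obtain ⟨k, hk, hlt⟩ := IsLoxodromicSubgroup.exists_lt_dist hg v 0
    have : Subgroup.zpowers g ≤ MulAction.stabilizer Γ v := by
      rw [Subgroup.zpowers_le]; exact hv
    have e : k • v = v := this hk
    simp [e] at hlt
  · exact h

theorem Set.encard_biUnion_finset_le {ι α : Type*} (s : Finset ι) (f : ι → Set α) (C : ℕ∞)
    (h : ∀ i ∈ s, (f i).encard ≤ C) : (⋃ i ∈ s, f i).encard ≤ s.card * C := by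
  classical
  induction s using Finset.induction_on with
  | empty => simp
  | insert a s ha ih =>
    rw [Finset.set_biUnion_insert, Finset.card_insert_of_notMem ha]
    refine (Set.encard_union_le _ _).trans ?_
    push_cast
    rw [add_mul, one_mul, add_comm]
    exact add_le_add (ih fun i hi => h i (Finset.mem_insert_of_mem hi))
      (h a (Finset.mem_insert_self a s))

/-- An element displacing two distant points a little maps an edge in the middle into the geodesic
between them. The image vertices are determined by their distances to one end, and the elements with
prescribed images lie in a coset of an edge stabilizer. -/
theorem isAcylindrical_of_edge_bound {C : ℕ}
    (hC : ∀ a b : V, T.Adj a b → {γ : Γ | γ • a = a ∧ γ • b = b}.encard ≤ C) :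
    IsAcylindrical Γ (TreePoint T hT) := by
  intro ε hε
  set E : ℕ := ⌈ε⌉₊ + 2 with hE
  have hεE : ε + 2 ≤ E := by
    have := Nat.le_ceil ε
    rw [hE]; push_cast; linarith
  -- There are at most `2E + 3` values for each of the two image distances; the final 1 only ensures
  -- positivity. In the length, 2 pays for rounding `x` and `y` to vertices.
  refine ⟨(2 * E + 3) * (2 * E + 3) * C + 1, 2 * E + 6, Nat.succ_pos _, by positivity, ?_⟩
  intro x y hxy
  obtain ⟨a, ha⟩ := x.exists_ofVertex_dist_le
  obtain ⟨b, hb⟩ := y.exists_ofVertex_dist_le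
  have hab : 2 * E + 4 ≤ T.dist a b := by
    have := dist_triangle4 x (TreePoint.ofVertex hT a) (TreePoint.ofVertex hT b) y
    rw [TreePoint.dist_ofVertex, dist_comm (TreePoint.ofVertex hT b) y] at this
    have : ((2 * E + 4 : ℕ) : ℝ) ≤ T.dist a b := by push_cast; linarith
    exact_mod_cast this
  have hmove : ∀ (z : TreePoint T hT) (c : V) (g : Γ), dist z (TreePoint.ofVertex hT c) ≤ 1 →
      dist z (g • z) ≤ ε → T.dist c (g • c) ≤ E := by
    intro z c g hz hg
    have := dist_triangle4 (TreePoint.ofVertex hT c) z (g • z) (g • TreePoint.ofVertex hT c)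
    rw [_root_.dist_smul, dist_comm _ z, TreePoint.smul_ofVertex, TreePoint.dist_ofVertex] at this
    have : (T.dist c (g • c) : ℝ) ≤ E := by linarith
    exact_mod_cast this
  -- Both `u` and its successor `w` are farther than `E` from `a` and `b`, as `between_of_close`
  -- requires.
  obtain ⟨u, hu1, hu2⟩ := hT.exists_between (a := a) (b := b) (k := E + 1) (by omega)
  obtain ⟨w, huw, hw⟩ := hT.exists_adj_closer (a := u) (b := b)
    (by rintro rfl; simp at hu2; omega)
  have hw1 : T.dist a w = E + 2 := by
    have := hT.dist_tri a w b
    have := hT.dist_adj huw a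
    rw [T.dist_comm (u := w), T.dist_comm (u := u)] at this
    omega
  have hbetween : ∀ g : Γ, T.dist a (g • a) ≤ E → T.dist b (g • b) ≤ E → ∀ q : V,
      T.dist a q + T.dist q b = T.dist a b → E < T.dist a q → E < T.dist q b →
      T.dist a (g • q) + T.dist (g • q) b = T.dist a b ∧ T.dist a (g • q) ≤ E + T.dist a q := by
    intro g h1 h2 q hq h3 h4
    refine ⟨hT.between_of_close (a := g • a) (b := g • b) ?_ ?_ ?_, ?_⟩
    · rw [GraphAction.dist_smul T hT, GraphAction.dist_smul T hT, GraphAction.dist_smul T hT, hq]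
    · rw [GraphAction.dist_smul T hT, T.dist_comm]; omega
    · rw [GraphAction.dist_smul T hT, T.dist_comm]; omega
    · have := hT.dist_tri a (g • a) (g • q)
      rw [GraphAction.dist_smul T hT] at this
      omega
  set S : Set Γ := {g : Γ | dist x (g • x) ≤ ε ∧ dist y (g • y) ≤ ε} with hS
  let F : ℕ × ℕ → Set Γ := fun i => {g ∈ S | T.dist a (g • u) = i.1 ∧ T.dist a (g • w) = i.2}
  have hprop : ∀ g ∈ S, (T.dist a (g • u) + T.dist (g • u) b = T.dist a b ∧
      T.dist a (g • u) ≤ E + T.dist a u) ∧ (T.dist a (g • w) + T.dist (g • w) b = T.dist a b ∧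
      T.dist a (g • w) ≤ E + T.dist a w) := fun g hg =>
    ⟨hbetween g (hmove x a g ha hg.1) (hmove y b g hb hg.2) u (by omega) (by omega) (by omega),
      hbetween g (hmove x a g ha hg.1) (hmove y b g hb hg.2) w (by omega) (by omega) (by omega)⟩
  have hcover : S ⊆ ⋃ i ∈ Finset.range (2 * E + 3) ×ˢ Finset.range (2 * E + 3), F i := by
    intro g hg
    obtain ⟨⟨-, h1⟩, -, h2⟩ := hprop g hg
    refine Set.mem_iUnion₂.2 ⟨(T.dist a (g • u), T.dist a (g • w)), ?_, hg, rfl, rfl⟩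
    rw [Finset.mem_product, Finset.mem_range, Finset.mem_range]
    dsimp only
    omega
  have hfiber : ∀ i ∈ Finset.range (2 * E + 3) ×ˢ Finset.range (2 * E + 3),
      (F i).encard ≤ C := by
    rintro ⟨i, j⟩ -
    rcases (F (i, j)).eq_empty_or_nonempty with h | ⟨g, hg, hgi, hgj⟩
    · rw [h]; simp
    · refine le_trans (Set.encard_le_encard (t := (fun k => g * k) ''
        {γ : Γ | γ • u = u ∧ γ • w = w}) ?_) ((Set.encard_image_le _ _).trans (hC u w huw))
      rintro k ⟨hk, hki, hkj⟩
      have e1 : g • u = k • u := hT.eq_of_between (hprop g hg).1.1 (hprop k hk).1.1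
        (hgi.trans hki.symm)
      have e2 : g • w = k • w := hT.eq_of_between (hprop g hg).2.1 (hprop k hk).2.1
        (hgj.trans hkj.symm)
      refine ⟨g⁻¹ * k, ⟨?_, ?_⟩, mul_inv_cancel_left g k⟩
      · rw [mul_smul, ← e1, inv_smul_smul]
      · rw [mul_smul, ← e2, inv_smul_smul]
  refine (Set.encard_le_encard hcover).trans
    ((Set.encard_biUnion_finset_le _ F C hfiber).trans ?_)
  rw [Finset.card_product, Finset.card_range]
  exact_mod_cast Nat.le_succ _

/-- A sufficiently large power of a loxodromic element moves `x` beyond the acylindricity length;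
the extra 2 in the exponent pays for rounding `x` to a vertex. -/
theorem IsAcylindrical.isWPD (hinv : ActsWithoutInversion Γ T)
    (hA : IsAcylindrical Γ (TreePoint T hT)) : IsWPD Γ (TreePoint T hT) := by
  intro h hh x ε hε
  obtain ⟨M, L, hM, -, hML⟩ := hA ε hε
  obtain ⟨v, hv⟩ := IsLoxodromic.exists_isAxial hinv hh
  obtain ⟨a, ha⟩ := x.exists_ofVertex_dist_le
  refine ⟨⌈L⌉₊ + 2, M, hM, hML x _ ?_⟩
  have h1 := hv.le_dist_pow hT a (⌈L⌉₊ + 2)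
  have h2 := dist_triangle4 (TreePoint.ofVertex hT a) x (h ^ (⌈L⌉₊ + 2) • x)
    (h ^ (⌈L⌉₊ + 2) • TreePoint.ofVertex hT a)
  rw [_root_.dist_smul, dist_comm _ x, TreePoint.smul_ofVertex, TreePoint.dist_ofVertex] at h2
  have h3 : ((⌈L⌉₊ + 2 : ℕ) : ℝ) ≤ T.dist a (h ^ (⌈L⌉₊ + 2) • a) := by exact_mod_cast h1
  push_cast at h3
  have := Nat.le_ceil L
  linarith

theorem one_le_injectivityRadius (hinv : ActsWithoutInversion Γ T) (Q : Set Γ) :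
    1 ≤ injectivityRadius (TreePoint T hT) Q := by
  refine le_iInf₂ fun g hg => ?_
  obtain ⟨v, hv⟩ := IsLoxodromic.exists_isAxial hinv hg.2
  have h1 := (tendsto_dist_pow_div (hv.dist_ofVertex_pow hT)
    (Classical.arbitrary (TreePoint T hT))).limUnder_eq
  rw [asymptoticTranslationLength, h1, ENNReal.one_le_ofReal]
  exact_mod_cast hT.1.pos_dist_of_ne hv.1

theorem dist_pow_pow_of_axial (hT : T.IsTree) {g h : Γ} {v : V} (hg : IsAxial T g v)
    (hh : IsAxial T h v)
    (hgh : T.dist (g • v) (h • v) = T.dist v (g • v) + T.dist v (h • v)) (n m : ℕ) :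
    T.dist (g ^ n • v) (h ^ m • v) = T.dist v (g ^ n • v) + T.dist v (h ^ m • v) := by
  rcases n with _ | n
  · simp
  rcases m with _ | m
  · simp [T.dist_comm]
  have e1 : T.dist (g ^ (n + 1) • v) (g • v) = n * T.dist v (g • v) := by
    rw [pow_succ', mul_smul, GraphAction.dist_smul T hT, T.dist_comm, hg.dist_pow hT]
  have e2 : T.dist (h • v) (h ^ (m + 1) • v) = m * T.dist v (h • v) := by
    rw [pow_succ', mul_smul, GraphAction.dist_smul T hT, hh.dist_pow hT]
  have e3 := hg.dist_pow hT (n + 1)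
  have e4 := hh.dist_pow hT (m + 1)
  rw [add_mul, one_mul] at e3 e4
  have c1 := T.dist_comm (u := v) (v := g • v)
  have c2 := T.dist_comm (u := v) (v := g ^ (n + 1) • v)
  have h1 := hT.dist_chain (a := g ^ (n + 1) • v) (b := g • v) (c := v) (e := h • v)
    (by omega) (by omega) hg.1.symm
  have h2 := hT.dist_chain (a := g ^ (n + 1) • v) (b := v) (c := h • v) (e := h ^ (m + 1) • v)
    (by omega) (by omega) hh.1
  omega

/-- The three forward rays leave `v` without overlap, so their ends are distinct. -/
theorem not_isElementary_top (hT : T.IsTree) {v : V} {h : Fin 3 → Γ} (ha : ∀ i, IsAxial T (h i) v)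
    (hd : ∀ i j, i ≠ j →
      T.dist (h i • v) (h j • v) = T.dist v (h i • v) + T.dist v (h j • v)) :
    ¬ IsElementary (TreePoint T hT) (⊤ : Subgroup Γ) := by
  intro hel
  let ξ : Fin 3 → GromovBoundary (TreePoint T hT) := fun i =>
    attractingEnd ((ha i).length_pos hT) ((ha i).dist_ofVertex_pow hT)
  have hξ : Function.Injective ξ := by
    intro i j hij
    by_contra hne
    refine attractingEnd_ne TreePoint.isGromovHyperbolic _ _ _ _ (fun n => ?_) hij
    simp only [TreePoint.smul_ofVertex, TreePoint.dist_ofVertex]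
    exact_mod_cast dist_pow_pow_of_axial hT (ha i) (ha j) (hd i j hne) n n
  have hsub : Set.range ξ ⊆ limitSet (TreePoint T hT) (⊤ : Subgroup Γ) := by
    rintro _ ⟨i, rfl⟩
    exact attractingEnd_mem _ _ (Subgroup.mem_top _)
  have h1 := (Set.encard_le_encard hsub).trans hel
  rw [← Set.image_univ, hξ.encard_image, Set.encard_univ] at h1
  simp only [ENat.card_eq_coe_fintype_card, Fintype.card_fin] at h1
  exact absurd (Nat.cast_le.1 h1) (by norm_num)

end TreeActions

/-! ### The abstract splitting and its consequences -/

section Splittings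

variable {G : Type*} [Group G] {Γ : Type*} [Group Γ] {V : Type*} [MulAction Γ V]

theorem mk_eq_mk_of_involutions {x y : G} (hx : orderOf x = 2) (hy : orderOf y = 2) :
    (QuotientGroup.mk x : G ⧸ translationSubgroup G) = QuotientGroup.mk y := by
  rw [QuotientGroup.eq, inv_of_orderOf_eq_two hx]
  by_cases hxy : x = y
  · rw [hxy, mul_self_of_orderOf_eq_two hy]; exact Subgroup.one_mem _
  · exact Subgroup.subset_closure ⟨x, y, ⟨hx, hy, hxy⟩, rfl⟩

/-- The group `G` is embedded in `Γ` by `ι`, it meets all the conjugacy classes of involutions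
of `Γ`, and the quotient of `G` by its translations extends to `Γ`. -/
structure IsInvolutionRetraction (ι : G →* Γ) (π : Γ →* G ⧸ translationSubgroup G) : Prop where
  injective : Function.Injective ι
  apply_eq : ∀ g, π (ι g) = QuotientGroup.mk g
  involution_conj : ∀ γ : Γ, orderOf γ = 2 → ∃ (g : Γ) (x : G), g * γ * g⁻¹ = ι x

/-- The group `Γ` acts on the tree `T` with `G` as a vertex stabilizer, in such a way that the
translations of `Γ` which fix a vertex are controlled by `G`. The retraction `π` onto the quotient
of `G` by its translations separates the involutions from the products of translations. -/
structure IsSTSplitting (ι : G →* Γ) (π : Γ →* G ⧸ translationSubgroup G) (T : SimpleGraph V) :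
    Prop extends IsInvolutionRetraction ι π where
  isTree : T.IsTree
  withoutInversion : ActsWithoutInversion Γ T
  edge_bound : ∃ C : ℕ, ∀ a b : V, T.Adj a b → {γ : Γ | γ • a = a ∧ γ • b = b}.encard ≤ C
  edge_mul : ∀ (a b : V) (γ γ' : Γ), T.Adj a b → γ • a = a → γ • b = b → γ' • a = a →
    γ' • b = b → π γ ≠ 1 → π γ' ≠ 1 → π (γ * γ') = 1
  far_fixed : ∀ (γ : Γ) (a b : V), π γ = 1 → γ • a = a → γ • b = b → 3 ≤ T.dist a b → γ = 1
  normalizer_le : ∀ r s : Γ, IsInvolutionPair r s → ∀ x : V, (r * s) • x = x →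
    ∃ g : Γ, Subgroup.normalizer (Subgroup.zpowers (g * (r * s) * g⁻¹) : Set Γ) ≤ ι.range
  ends : ∃ (v : V) (h : Fin 3 → Γ), (∀ i, IsAxial T (h i) v) ∧ ∀ i j, i ≠ j →
    T.dist (h i • v) (h j • v) = T.dist v (h i • v) + T.dist v (h j • v)

namespace IsInvolutionRetraction

variable {ι : G →* Γ} {π : Γ →* G ⧸ translationSubgroup G} (h : IsInvolutionRetraction ι π)
include h

theorem exists_involution {γ : Γ} (hγ : orderOf γ = 2) :
    ∃ x : G, orderOf x = 2 ∧ π γ = QuotientGroup.mk x := by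
  obtain ⟨g, x, hx⟩ := h.involution_conj γ hγ
  obtain ⟨a, ha⟩ := QuotientGroup.mk_surjective (π g)
  have hox : orderOf x = 2 := by
    rw [← orderOf_injective ι h.injective, ← hx, ← hγ]
    exact orderOf_injective (MulAut.conj g).toMonoidHom (MulAut.conj g).injective γ
  refine ⟨a⁻¹ * x * a, ?_, ?_⟩
  · rw [← hox]
    have := orderOf_injective (MulAut.conj a⁻¹).toMonoidHom (MulAut.conj a⁻¹).injective x
    simpa using this
  · have e : γ = g⁻¹ * ι x * g := by rw [← hx]; group
    rw [e, map_mul, map_mul, map_inv, ← ha, h.apply_eq]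
    rfl

/-- All involutions of the larger group have the same image, the class of any involution of `G`. -/
theorem map_translation {g : Γ} (hg : g ∈ translations Γ) : π g = 1 := by
  obtain ⟨r, s, hrs, rfl⟩ := hg
  obtain ⟨x, hx, e⟩ := h.exists_involution hrs.1
  obtain ⟨y, hy, e'⟩ := h.exists_involution hrs.2.1
  rw [map_mul, e, e', mk_eq_mk_of_involutions hx hy, ← QuotientGroup.mk_mul,
    mul_self_of_orderOf_eq_two hy, QuotientGroup.mk_one]

theorem map_translationSubgroup {g : Γ} (hg : g ∈ translationSubgroup Γ) : π g = 1 := by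
  have : translationSubgroup Γ ≤ π.ker := by
    rw [translationSubgroup, Subgroup.closure_le]
    exact fun g hg => h.map_translation hg
  exact this hg

end IsInvolutionRetraction

namespace IsSTSplitting

variable {ι : G →* Γ} {π : Γ →* G ⧸ translationSubgroup G} {T : SimpleGraph V}
  (h : IsSTSplitting ι π T)
include h

/-- Both `r` and `s` normalize the group generated by `r * s`, so the element conjugating its
normalizer into `G` carries the pair along. -/
theorem exists_pair {r s : Γ} (hrs : IsInvolutionPair r s) {x : V} (hx : (r * s) • x = x) :
    ∃ (g : Γ) (r₀ s₀ : G), IsInvolutionPair r₀ s₀ ∧ MulAut.conj g r = ι r₀ ∧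
      MulAut.conj g s = ι s₀ ∧
      Subgroup.normalizer (Subgroup.zpowers (ι (r₀ * s₀)) : Set Γ) ≤ ι.range := by
  obtain ⟨g, hg⟩ := h.normalizer_le r s hrs x hx
  have hc : IsInvolutionPair (MulAut.conj g r) (MulAut.conj g s) :=
    hrs.map (f := (MulAut.conj g).toMonoidHom) (MulAut.conj g).injective
  have e : MulAut.conj g r * MulAut.conj g s = g * (r * s) * g⁻¹ := by
    rw [← map_mul, MulAut.conj_apply]
  rw [← e] at hg
  obtain ⟨r₀, hr⟩ := hg hc.mem_normalizer.1
  obtain ⟨s₀, hs⟩ := hg hc.mem_normalizer.2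
  rw [← hr, ← hs] at hc hg
  refine ⟨g, r₀, s₀, hc.of_map h.injective, hr.symm, hs.symm, ?_⟩
  rw [map_mul]
  exact hg

variable [GraphAction Γ T]

theorem exists_fixed_of_isElementary {K : Subgroup Γ} (hK : IsElementary (TreePoint T h.isTree) K)
    (hK' : ¬ IsLoxodromicSubgroup (TreePoint T h.isTree) K) {k : Γ} (hk : k ∈ K) :
    ∃ v : V, k • v = v := by
  refine (GraphAction.fixed_or_axial h.isTree h.withoutInversion k).resolve_right ?_
  rintro ⟨v, hv⟩
  have h1 := hv.encard_limitSet (hT := h.isTree)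
  have h2 := Set.encard_le_encard (limitSet_mono (Y := TreePoint T h.isTree)
    (Subgroup.zpowers_le.2 hk))
  exact hK' (le_antisymm hK (h1 ▸ h2))

/-- The elements `g`, `k⁻³ g k³` and their product are elliptic, so by Serre's lemma `g` fixes some
`w` and `k³ w`. These are at distance at least 3, hence `g = 1`. -/
theorem nuProperty : NuProperty (translationSubgroup Γ) (TreePoint T h.isTree) 3 := by
  intro g k hk hel hlox
  set S : Set (translationSubgroup Γ) := {x | ∃ i ≤ 3, x = (k ^ i)⁻¹ * g * k ^ i}
  have hel' : IsElementary (TreePoint T h.isTree)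
      ((Subgroup.closure S).map (translationSubgroup Γ).subtype) := by
    rw [IsElementary, limitSet_map_subtype]; exact hel
  have hlox' : ¬ IsLoxodromicSubgroup (TreePoint T h.isTree)
      ((Subgroup.closure S).map (translationSubgroup Γ).subtype) := by
    rw [IsLoxodromicSubgroup, limitSet_map_subtype]; exact hlox
  have m0 : g ∈ Subgroup.closure S := Subgroup.subset_closure ⟨0, by norm_num, by simp⟩
  have m3 : (k ^ 3)⁻¹ * g * k ^ 3 ∈ Subgroup.closure S :=
    Subgroup.subset_closure ⟨3, le_rfl, rfl⟩
  have fixed : ∀ x ∈ Subgroup.closure S, ∃ v : V, (x : Γ) • v = v := fun x hx =>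
    h.exists_fixed_of_isElementary hel' hlox' ⟨x, hx, rfl⟩
  obtain ⟨x, hx⟩ := fixed _ m0
  obtain ⟨y, hy⟩ := fixed _ m3
  obtain ⟨z, hz⟩ := fixed _ (Subgroup.mul_mem _ m0 m3)
  rw [Subgroup.coe_mul] at hz
  obtain ⟨w, hw, hw'⟩ := GraphAction.exists_common_fixed h.isTree hx hy hz
  push_cast at hw'
  rw [mul_smul, mul_smul, inv_smul_eq_iff] at hw'
  obtain ⟨v, hv⟩ := IsLoxodromic.exists_isAxial h.withoutInversion ((isLoxodromic_coe k).2 hk)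
  have hg1 : g = 1 := Subtype.ext (h.far_fixed g w _ (h.map_translationSubgroup g.2) hw hw'
    (hv.le_dist_pow h.isTree w 3))
  have hcl : Subgroup.closure {g, k} ≤ Subgroup.zpowers k := by
    rw [Subgroup.closure_le]
    rintro _ (rfl | rfl)
    · rw [hg1]; exact Subgroup.one_mem _
    · exact Subgroup.mem_zpowers _
  exact (Set.encard_le_encard (limitSet_mono hcl)).trans (le_of_eq hk)

/-- A finite normal subgroup of a loxodromic subgroup fixes a vertex `x`, and by normality also a
translate of `x` at distance at least 3; inside ker π this makes it trivial. -/
theorem invariantE_eq_one :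
    invariantE (translationSubgroup Γ) (TreePoint T h.isTree) = 1 := by
  have hT := h.isTree
  have hone : ∀ n ∈ holomorphOrders (translationSubgroup Γ) (TreePoint T h.isTree), n = 1 := by
    rintro n ⟨M, hM, F, hF, rfl⟩
    obtain ⟨hFn, hFf⟩ := hF.1
    have hM' : IsLoxodromicSubgroup (TreePoint T h.isTree)
        (M.map (translationSubgroup Γ).subtype) := by
      rw [IsLoxodromicSubgroup, limitSet_map_subtype]; exact hM.1
    let F' : Subgroup Γ := (F.map M.subtype).map (translationSubgroup Γ).subtype
    have hF' : Finite F' := by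
      have : (F' : Set Γ).Finite := by
        rw [Subgroup.coe_map, Subgroup.coe_map]
        exact ((Set.toFinite (F : Set M)).image _).image _
      exact this
    obtain ⟨x, hx⟩ := GraphAction.exists_fixed_of_finite hT h.withoutInversion F' hF'
    have hx : ∀ f ∈ F, ((f : translationSubgroup Γ) : Γ) • x = x := fun f hf =>
      hx _ ⟨_, ⟨f, hf, rfl⟩, rfl⟩
    obtain ⟨_, ⟨m, hm, rfl⟩, hlt⟩ := hM'.exists_lt_dist x 2
    have htriv : ∀ f ∈ F, f = 1 := by
      intro f hf
      have h2 := hx _ (hFn.conj_mem f hf (⟨m, hm⟩ : M)⁻¹)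
      push_cast at h2
      rw [inv_inv, mul_smul, mul_smul, inv_smul_eq_iff] at h2
      exact Subtype.ext (Subtype.ext (h.far_fixed _ x _
        (h.map_translationSubgroup (f : translationSubgroup Γ).2) (hx f hf) h2 hlt))
    have : Subsingleton F := ⟨fun a b => Subtype.ext (by rw [htriv a a.2, htriv b b.2])⟩
    have : Subsingleton (F ⋊[MonoidHom.id (MulAut F)] MulAut F) :=
      ⟨fun a b => SemidirectProduct.ext (Subsingleton.elim _ _)
        (MulEquiv.ext fun c => Subsingleton.elim _ _)⟩
    exact Nat.card_eq_one_iff_unique.2 ⟨this, inferInstance⟩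
  have hmem : 1 ∈ {m : ℕ | 0 < m ∧
      ∀ n ∈ holomorphOrders (translationSubgroup Γ) (TreePoint T h.isTree), n ∣ m} :=
    ⟨one_pos, fun n hn => (hone n hn).dvd⟩
  exact le_antisymm (Nat.sInf_le hmem) (Nat.sInf_mem ⟨1, hmem⟩).1

/-- The subgroup fixes `x` and `g³ x`, so its nontrivial elements have nontrivial image under `π`.
By `edge_mul` the product of two of them dies under `π`, hence is 1: any two nontrivial elements are
inverse to each other. -/
theorem card_le_two (F : Subgroup Γ) (hF : Finite F) (g : Γ)
    (hg : IsLoxodromic (TreePoint T h.isTree) g)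
    (hgF : g ∈ Subgroup.normalizer (F : Set Γ)) : Nat.card F ≤ 2 := by
  have hT := h.isTree
  obtain ⟨x, hx⟩ := GraphAction.exists_fixed_of_finite hT h.withoutInversion F hF
  obtain ⟨v, hv⟩ := IsLoxodromic.exists_isAxial h.withoutInversion hg
  have hd := hv.le_dist_pow hT x 3
  have hx' : ∀ f ∈ F, f • g ^ 3 • x = g ^ 3 • x := by
    intro f hf
    have h1 := (Subgroup.mem_normalizer_iff.1
      (Subgroup.inv_mem _ (Subgroup.pow_mem _ hgF 3)) f).1 hf
    have h2 := hx _ h1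
    rwa [inv_inv, mul_smul, mul_smul, inv_smul_eq_iff] at h2
  have hne : x ≠ g ^ 3 • x := by intro e; rw [← e] at hd; simp at hd
  obtain ⟨u, hu, hu'⟩ := hT.exists_adj_closer hne
  have hfu : ∀ f ∈ F, f • u = u := fun f hf =>
    GraphAction.smul_eq_of_between hT (hx f hf) (hx' f hf) (by
      rw [SimpleGraph.dist_eq_one_iff_adj.2 hu]; omega)
  have hπ : ∀ f ∈ F, f ≠ 1 → π f ≠ 1 := fun f hf hf1 e =>
    hf1 (h.far_fixed f x _ e (hx f hf) (hx' f hf) hd)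
  have hinv : ∀ f ∈ F, ∀ f' ∈ F, f ≠ 1 → f' ≠ 1 → f' = f⁻¹ := by
    intro f hf f' hf' h1 h1'
    by_contra hne
    refine hπ (f * f') (F.mul_mem hf hf') (fun e => hne (eq_inv_of_mul_eq_one_right e)) ?_
    exact h.edge_mul x u f f' hu (hx f hf) (hfu f hf) (hx f' hf') (hfu f' hf') (hπ f hf h1)
      (hπ f' hf' h1')
  have hsub : ∃ f : Γ, (F : Set Γ) ⊆ {1, f} := by
    by_cases hF1 : ∃ f ∈ F, f ≠ 1
    · obtain ⟨f, hf, hf1⟩ := hF1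
      refine ⟨f⁻¹, fun f' hf' => ?_⟩
      by_cases h1 : f' = 1
      · exact Or.inl h1
      · exact Or.inr (hinv f hf f' hf' hf1 h1)
    · push Not at hF1
      exact ⟨1, fun f hf => Or.inl (hF1 f hf)⟩
  obtain ⟨f, hf⟩ := hsub
  have h1 := Set.ncard_le_ncard hf (Set.toFinite _)
  exact h1.trans (Set.ncard_insert_le _ _ |>.trans (by rw [Set.ncard_singleton]))

/-- The centralizer acts freely on the axis, hence is cyclic; since `r` normalizes it and inverts
`g`, it inverts a generator `c`, so `c = r * (r * c)` is a product of two involutions. -/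
theorem exists_centralizer_eq_of_axial {p : ℕ} (hp2 : p ≠ 2)
    (hord : ∀ g ∈ translations Γ, orderOf g = p ∨ orderOf g = 0)
    {r s : Γ} (hrs : IsInvolutionPair r s) {v : V}
    (hv : IsAxial T (r * s) v) :
    ∃ c ∈ translations Γ, Subgroup.centralizer {r * s} = Subgroup.zpowers c := by
  have hT := h.isTree
  set g := r * s with hg
  have hrr := mul_self_of_orderOf_eq_two hrs.1
  have hrg : r * g * r⁻¹ = g⁻¹ := hrs.conj_left
  have hgg : g ≠ g⁻¹ := by
    intro e
    have h1 := hv.orderOf_eq_zero hT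
    rw [orderOf_eq_zero_iff'] at h1
    refine h1 2 two_pos ?_
    rw [pow_two]
    nth_rw 2 [e]
    exact mul_inv_cancel g
  have hadj : v ≠ g • v := hv.1
  have hd := hv.le_dist_pow hT v 3
  obtain ⟨u, hu, hu'⟩ := hT.exists_adj_closer hadj
  have hcen : ∀ c : Γ, c * g = g * c → c • v = v →
      c • u = u ∧ c • g ^ 3 • v = g ^ 3 • v := by
    intro c hc hcv
    have h1 : c • g • v = g • v := by rw [smul_smul, hc, mul_smul, hcv]
    refine ⟨GraphAction.smul_eq_of_between hT hcv h1 ?_, ?_⟩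
    · rw [SimpleGraph.dist_eq_one_iff_adj.2 hu]; omega
    · have : Commute c (g ^ 3) := Commute.pow_right hc 3
      rw [smul_smul, this.eq, mul_smul, hcv]
  have hπ : ∀ c : Γ, c * g = g * c → c • v = v → π c = 1 → c = 1 := fun c hc hcv hπ =>
    h.far_fixed c v _ hπ hcv (hcen c hc hcv).2 hd
  have hmulC : ∀ c c' : Γ, c * g = g * c → c' * g = g * c' → c * c' * g = g * (c * c') :=
    fun c c' hc hc' => (Commute.mul_left hc hc' : _)
  have hinv : ∀ c c' : Γ, c * g = g * c → c' * g = g * c' → c • v = v → c' • v = v →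
      c ≠ 1 → c' ≠ 1 → c * c' = 1 := by
    intro c c' hc hc' hcv hcv' h1 h1'
    refine hπ _ (hmulC c c' hc hc') (by rw [mul_smul, hcv', hcv]) ?_
    exact h.edge_mul v u c c' hu hcv (hcen c hc hcv).1 hcv' (hcen c' hc' hcv').1
      (fun e => h1 (hπ c hc hcv e)) (fun e => h1' (hπ c' hc' hcv' e))
  have hconjC : ∀ c : Γ, c * g = g * c → r * c * r⁻¹ * g = g * (r * c * r⁻¹) := by
    intro c hc
    have e : g = r * g⁻¹ * r⁻¹ := by
      calc g = (r * g * r⁻¹)⁻¹ := by rw [hrg, inv_inv]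
        _ = r * g⁻¹ * r⁻¹ := by group
    have h1 : c * g⁻¹ = g⁻¹ * c := (Commute.inv_right hc : _)
    calc r * c * r⁻¹ * g = r * c * r⁻¹ * (r * g⁻¹ * r⁻¹) := by rw [← e]
      _ = r * (c * g⁻¹) * r⁻¹ := by group
      _ = r * g⁻¹ * r⁻¹ * (r * c * r⁻¹) := by rw [h1]; group
      _ = g * (r * c * r⁻¹) := by rw [← e]
  -- A nontrivial `c` here is an involution and the only nontrivial centralizing element fixing `v`.
  -- So it commutes with `r`, and `r * c` is a translation of order 2, which is excluded.
  have hfree : ∀ c ∈ Subgroup.centralizer {g}, c • v = v → c = 1 := by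
    intro c hc hcv
    rw [Subgroup.mem_centralizer_singleton_iff] at hc
    by_contra hc1
    have hcc : c * c = 1 := hinv c c hc hc hcv hcv hc1 hc1
    have hrc := hconjC c hc
    have hfix : (r * c * r⁻¹) • v = v := by
      -- The conjugate visibly fixes `r • v`; as it commutes with `g`, it fixes the axis vertex `v`
      -- too.
      refine hv.smul_eq_of_comm hT hrc (x := r • v) ?_
      rw [smul_smul, inv_mul_cancel_right, mul_smul, hcv]
    have h1 : r * c * r⁻¹ ≠ 1 := fun e => hc1 (by simpa using e)
    have h2 : r * c * r⁻¹ = c :=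
      (eq_inv_of_mul_eq_one_left (hinv _ c hrc hc hfix hcv h1 hc1)).trans
        (inv_eq_of_mul_eq_one_left hcc)
    have h3 : r * c = c * r := by rwa [mul_inv_eq_iff_eq_mul] at h2
    have hne : r ≠ c := by
      rintro e
      rw [← e] at hc
      rw [hc, mul_inv_cancel_right] at hrg
      exact hgg hrg
    have h4 : IsInvolutionPair r c := ⟨hrs.1, orderOf_eq_two_of_mul_self hcc hc1, hne⟩
    have h5 : orderOf (r * c) = 2 := by
      refine orderOf_eq_two_of_mul_self ?_ h4.mul_ne_one
      calc r * c * (r * c) = r * (c * r) * c := by group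
        _ = (r * r) * (c * c) := by rw [← h3]; group
        _ = 1 := by rw [hrr, hcc, one_mul]
    rcases hord _ ⟨r, c, h4, rfl⟩ with h6 | h6 <;> omega
  have hcyc := hv.isCyclic_of_free hT (Subgroup.centralizer {g})
    (fun c hc => Subgroup.mem_centralizer_singleton_iff.1 hc) hfree
  obtain ⟨c, hc⟩ := hcyc.exists_generator
  have hcC := Subgroup.mem_centralizer_singleton_iff.1 c.2
  have hz : Subgroup.centralizer {g} = Subgroup.zpowers (c : Γ) := by
    ext k
    constructor
    · intro hk
      obtain ⟨n, hn⟩ := hc ⟨k, hk⟩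
      exact ⟨n, congrArg Subtype.val hn⟩
    · rintro ⟨n, rfl⟩
      exact Subgroup.zpow_mem _ c.2 n
  refine ⟨c, ?_, hz⟩
  obtain ⟨k, hk⟩ : g ∈ Subgroup.zpowers (c : Γ) := by
    rw [← hz, Subgroup.mem_centralizer_singleton_iff]
  obtain ⟨m, hm⟩ : r * c * r⁻¹ ∈ Subgroup.zpowers (c : Γ) := by
    rw [← hz, Subgroup.mem_centralizer_singleton_iff]
    exact hconjC c hcC
  have hk : (c : Γ) ^ k = g := hk
  have hm : (c : Γ) ^ m = r * c * r⁻¹ := hm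
  have hc0 : ∀ n : ℤ, (c : Γ) ^ n = 1 → n = 0 := by
    intro n hn
    by_contra hn0
    have h1 : g ^ n = 1 := by rw [← hk, ← zpow_mul, mul_comm, zpow_mul, hn, one_zpow]
    have h2 := orderOf_dvd_iff_zpow_eq_one.2 h1
    rw [hv.orderOf_eq_zero hT] at h2
    exact hn0 (by simpa using h2)
  -- Compare exponents of `c` after conjugating `g = c ^ k` by `r`: `m * k = -k` with `k ≠ 0`.
  have hm1 : m = -1 := by
    have h1 : (c : Γ) ^ (m * k + k) = 1 := by
      rw [zpow_add, zpow_mul, hm, conj_zpow, hk, hrg, inv_mul_cancel]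
    have h2 := hc0 _ h1
    have hk0 : k ≠ 0 := by
      rintro rfl
      rw [zpow_zero] at hk
      exact hgg (by rw [← hk, inv_one])
    have h3 : (m + 1) * k = 0 := by rw [← h2]; ring
    rcases mul_eq_zero.1 h3 with h4 | h4
    · omega
    · exact absurd h4 hk0
  have hrc : r * c * r⁻¹ = (c : Γ)⁻¹ := by rw [← hm, hm1, zpow_neg_one]
  have hc1 : (c : Γ) ≠ 1 := fun e => by
    rw [e, one_zpow] at hk
    exact hgg (by rw [← hk, inv_one])
  have hrcne : r * c ≠ 1 := by
    intro e
    have e1 : (c : Γ) = r := (eq_inv_of_mul_eq_one_right e).trans (inv_of_orderOf_eq_two hrs.1)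
    have := hc0 2 (by rw [e1]; exact_mod_cast (pow_two r).trans hrr)
    omega
  have hrcrc : r * c * (r * c) = 1 := by
    rw [← mul_assoc]
    nth_rw 2 [← inv_of_orderOf_eq_two hrs.1]
    rw [hrc, inv_mul_cancel]
  refine ⟨r, r * c, ⟨hrs.1, orderOf_eq_two_of_mul_self hrcrc hrcne, fun e => hc1 ?_⟩, ?_⟩
  · exact mul_left_cancel (a := r) (by rw [← e, mul_one])
  · rw [← mul_assoc, hrr, one_mul]

variable {p : ℕ} (hG : IsST p G)
include hG

omit [GraphAction Γ T] in
theorem orderOf_eq_of_fixed {r s : Γ} (hrs : IsInvolutionPair r s) {x : V}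
    (hx : (r * s) • x = x) : orderOf (r * s) = p := by
  obtain ⟨g, r₀, s₀, h0, hr, hs, -⟩ := h.exists_pair hrs hx
  rw [← orderOf_injective (MulAut.conj g).toMonoidHom (MulAut.conj g).injective (r * s)]
  show orderOf (MulAut.conj g (r * s)) = p
  rw [map_mul, hr, hs, ← map_mul, orderOf_injective ι h.injective]
  exact hG.order_translation _ ⟨r₀, s₀, h0, rfl⟩

omit [GraphAction Γ T] in
-- The centralizer is contained in the normalizer, which is conjugate into `G`, so nothing new
-- centralizes the translation.
theorem exists_centralizer_eq_of_fixed {r s : Γ} (hrs : IsInvolutionPair r s) {x : V}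
    (hx : (r * s) • x = x) :
    ∃ c ∈ translations Γ, Subgroup.centralizer {r * s} = Subgroup.zpowers c := by
  obtain ⟨g, r₀, s₀, h0, hr, hs, hn⟩ := h.exists_pair hrs hx
  obtain ⟨c, hc, e⟩ := hG.almost.centralizer_cyclic r₀ s₀ h0
  have hz : MulAut.conj g (r * s) = ι (r₀ * s₀) := by rw [map_mul, hr, hs, map_mul]
  have hcΓ : (MulAut.conj g).symm (ι c) ∈ translations Γ :=
    map_mem_translations (f := (MulAut.conj g).symm.toMonoidHom) (MulAut.conj g).symm.injective
      (map_mem_translations h.injective hc)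
  refine ⟨_, hcΓ, ?_⟩
  ext k
  rw [Subgroup.mem_centralizer_singleton_iff]
  have key : ∀ y : G, y * (r₀ * s₀) = r₀ * s₀ * y ↔ y ∈ Subgroup.zpowers c := fun y => by
    rw [← e, Subgroup.mem_centralizer_singleton_iff]
  have hconj : k * (r * s) = r * s * k ↔
      MulAut.conj g k * ι (r₀ * s₀) = ι (r₀ * s₀) * MulAut.conj g k := by
    rw [← hz, ← map_mul, ← map_mul, (MulAut.conj g).injective.eq_iff]
  rw [hconj]
  constructor
  · intro hk
    obtain ⟨y, hy⟩ := hn (mem_normalizer_zpowers_of_comm hk)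
    rw [← hy, ← map_mul, ← map_mul, h.injective.eq_iff, key] at hk
    obtain ⟨n, rfl⟩ := hk
    refine ⟨n, ?_⟩
    show (MulAut.conj g).symm (ι c) ^ n = k
    rw [← map_zpow, ← map_zpow, MulEquiv.symm_apply_eq]
    exact hy
  · rintro ⟨n, rfl⟩
    have hk : MulAut.conj g ((MulAut.conj g).symm (ι c) ^ n) = ι (c ^ n) := by
      rw [map_zpow, MulEquiv.apply_symm_apply, map_zpow]
    show MulAut.conj g ((MulAut.conj g).symm (ι c) ^ n) * _ = _
    rw [hk, ← map_mul, ← map_mul, h.injective.eq_iff, key]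
    exact ⟨n, rfl⟩

theorem isAlmostSharplyTwoTransitive (hp : p.Prime) (hp2 : p ≠ 2) :
    IsAlmostSharplyTwoTransitive p Γ := by
  have hfact : Fact p.Prime := ⟨hp⟩
  have hT := h.isTree
  have dich := GraphAction.fixed_or_axial hT h.withoutInversion
  have hord : ∀ g ∈ translations Γ, orderOf g = p ∨ orderOf g = 0 := by
    rintro _ ⟨r, s, hrs, rfl⟩
    rcases dich (r * s) with ⟨x, hx⟩ | ⟨v, hv⟩
    · exact Or.inl (h.orderOf_eq_of_fixed hG hrs hx)
    · exact Or.inr (hv.orderOf_eq_zero hT)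
  have hpair : ∀ r s : Γ, IsInvolutionPair r s → orderOf (r * s) = p →
      ∃ (g : Γ) (r₀ s₀ : G), IsInvolutionPair r₀ s₀ ∧ MulAut.conj g r = ι r₀ ∧
      MulAut.conj g s = ι s₀ ∧
      Subgroup.normalizer (Subgroup.zpowers (ι (r₀ * s₀)) : Set Γ) ≤ ι.range := by
    intro r s hrs ho
    rcases dich (r * s) with ⟨x, hx⟩ | ⟨v, hv⟩
    · exact h.exists_pair hrs hx
    · rw [hv.orderOf_eq_zero hT] at ho
      exact absurd ho.symm hp.ne_zero
  have hback : ∀ (g : Γ) (x : Γ) (y : G), MulAut.conj g x = ι y →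
      x = (MulAut.conj g⁻¹).toMonoidHom (ι y) := by
    intro g x y hxy
    rw [← hxy]
    show x = MulAut.conj g⁻¹ (MulAut.conj g x)
    simp [mul_assoc]
  refine ⟨hord, ?_, ?_, ?_, ?_, ?_⟩
  · intro r s hrs ho
    obtain ⟨g, r₀, s₀, h0, hr, hs, hn⟩ := hpair r s hrs ho
    have hinj := (MulAut.conj g⁻¹).injective
    have ho0 := hG.order_translation _ ⟨r₀, s₀, h0, rfl⟩
    rw [hback g r r₀ hr, hback g s s₀ hs]
    rcases hG.almost.minimal_or_affine r₀ s₀ h0 ho0 with h1 | h1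
    · refine Or.inl ((h1.map h.injective hn).map hinj fun k _ => ?_)
      exact ⟨(MulAut.conj g⁻¹).symm k, (MulAut.conj g⁻¹).apply_symm_apply k⟩
    · exact Or.inr ((h1.map h.injective).map hinj)
  -- Products of translations lie in ker π, whereas an involution maps to the class of an involution
  -- of `G`, which is nontrivial.
  · intro g hg ho
    obtain ⟨x, hx, e⟩ := h.exists_involution ho
    rw [h.map_translationSubgroup hg, eq_comm, QuotientGroup.eq_one_iff] at e
    exact hG.almost.no_involution x e hx
  · obtain ⟨r, s, hrs⟩ := hG.almost.exists_affine
    exact ⟨ι r, ι s, hrs.map h.injective⟩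
  · have hred : ∀ r s : Γ, IsAffinePair p r s → ∃ (g : Γ) (r₀ s₀ : G),
        IsAffinePair p r₀ s₀ ∧ MulAut.conj g r = ι r₀ ∧ MulAut.conj g s = ι s₀ := by
      intro r s hrs
      have ho : orderOf (r * s) = p := by
        -- Infinite order is impossible inside the finite group AGL(1, p).
        refine (hord _ ⟨r, s, hrs.1, rfl⟩).resolve_right fun h0 => ?_
        obtain ⟨-, H, hH, ⟨e⟩⟩ := hrs
        have hm : r * s ∈ H := H.mul_mem (hH (left_mem_dihedralSubgroup r s))
          (hH (right_mem_dihedralSubgroup r s))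
        have : Finite (ZMod p ≃ᵃ[ZMod p] ZMod p) :=
          Finite.of_injective (fun f => (f : ZMod p → ZMod p)) DFunLike.coe_injective
        have : Finite H := Finite.of_equiv _ e.symm.toEquiv
        have h2 := orderOf_pos (⟨r * s, hm⟩ : H)
        rw [Subgroup.orderOf_mk, h0] at h2
        exact lt_irrefl _ h2
      obtain ⟨g, r₀, s₀, h0, hr, hs, hn⟩ := hpair r s hrs.1 ho
      refine ⟨g, r₀, s₀, ?_, hr, hs⟩
      refine IsAffinePair.of_map h.injective ?_ (hG.order_translation _ ⟨r₀, s₀, h0, rfl⟩) hn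
      rw [← hr, ← hs]
      exact hrs.map (f := (MulAut.conj g).toMonoidHom) (MulAut.conj g).injective
    intro r s r' s' hrs hrs'
    obtain ⟨g, r₀, s₀, h0, hr, hs⟩ := hred r s hrs
    obtain ⟨g', r₁, s₁, h1, hr', hs'⟩ := hred r' s' hrs'
    obtain ⟨k, hk, hk'⟩ := hG.almost.transitive_affine _ _ _ _ h0 h1
    have key : ∀ (x x' : Γ) (y y' : G), MulAut.conj g x = ι y → MulAut.conj g' x' = ι y' →
        k⁻¹ * y * k = y' → (g⁻¹ * ι k * g')⁻¹ * x * (g⁻¹ * ι k * g') = x' := by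
      intro x x' y y' hx hx' hy
      have hx : g * x * g⁻¹ = ι y := hx
      have hx' : g' * x' * g'⁻¹ = ι y' := hx'
      rw [← hy, map_mul, map_mul, map_inv, ← hx] at hx'
      have : x' = g'⁻¹ * (g' * x' * g'⁻¹) * g' := by group
      rw [this, hx']
      group
    exact ⟨_, key _ _ _ _ hr hr' hk, key _ _ _ _ hs hs' hk'⟩
  · intro r s hrs
    rcases dich (r * s) with ⟨x, hx⟩ | ⟨v, hv⟩
    · exact h.exists_centralizer_eq_of_fixed hG hrs hx
    · exact h.exists_centralizer_eq_of_axial hp2 hord hrs hv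

theorem isSTPrime {n₁ : ℕ} (hn : n₁ ≤ p) (hp : p.Prime) (hp2 : p ≠ 2) : IsSTPrime n₁ p Γ T where
  isTree := h.isTree
  almost := h.isAlmostSharplyTwoTransitive hG hp hp2
  nonElementary := by
    obtain ⟨v, k, ha, hd⟩ := h.ends
    exact not_isElementary_top h.isTree ha hd
  acylindrical := by
    obtain ⟨C, hC⟩ := h.edge_bound
    exact isAcylindrical_of_edge_bound hC
  wpd := by
    obtain ⟨C, hC⟩ := h.edge_bound
    exact (isAcylindrical_of_edge_bound hC).isWPD h.withoutInversion
  e_eq_one := h.invariantE_eq_one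
  one_le_injectivityRadius := one_le_injectivityRadius h.withoutInversion _
  nu_le_five := (iInf₂_le 3 ⟨by norm_num, h.nuProperty⟩).trans (by norm_num)
  A_eq_zero :=
    have : IsIsometricSMul (translationSubgroup Γ) (TreePoint T h.isTree) :=
      ⟨fun g => isometry_smul _ (g : Γ)⟩
    invariantA_eq_zero
  threshold_le := hn
  loxodromic_of_infinite_order := by
    rintro _ ⟨r, s, hrs, rfl⟩ ho
    rcases GraphAction.fixed_or_axial h.isTree h.withoutInversion (r * s) with ⟨x, hx⟩ | ⟨v, hv⟩
    · rw [h.orderOf_eq_of_fixed hG hrs hx] at ho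
      exact absurd ho hp.ne_zero
    · exact hv.encard_limitSet
  card_le_two := h.card_le_two

end IsSTSplitting

end Splittings

/-! ### Criteria for acyclicity and connectedness -/

section TreeCriterion

variable {V : Type*} {T : SimpleGraph V}

/-- A graph is acyclic if its vertices have levels such that every vertex has at most one neighbour
which does not have a higher level. -/
theorem SimpleGraph.isAcyclic_of_level (ℓ : V → ℕ)
    (h : ∀ v u u', T.Adj v u → T.Adj v u' → ℓ u ≤ ℓ v → ℓ u' ≤ ℓ v → u = u') : T.IsAcyclic := by
  classical
  intro v c hc
  -- At a vertex of highest level on the cycle both neighbours are no higher, although they are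
  -- different.
  obtain ⟨w, hw, hmax⟩ := c.support.toFinset.exists_max_image ℓ
    ⟨v, List.mem_toFinset.2 c.start_mem_support⟩
  rw [List.mem_toFinset] at hw
  have hc' : (c.rotate w hw).IsCycle := (SimpleGraph.Walk.isCycle_rotate hw).2 hc
  have hmax' : ∀ u ∈ (c.rotate w hw).support, ℓ u ≤ ℓ w := fun u hu =>
    hmax u (List.mem_toFinset.2 ((SimpleGraph.Walk.mem_support_rotate_iff _ _ _).1 hu))
  have hnil := hc'.not_nil
  exact hc'.snd_ne_penultimate (h w _ _ (SimpleGraph.Walk.adj_snd hnil)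
    (SimpleGraph.Walk.adj_penultimate hnil).symm
    (hmax' _ (SimpleGraph.Walk.getVert_mem_support _ _))
    (hmax' _ (SimpleGraph.Walk.getVert_mem_support _ _)))

variable {Γ : Type*} [Group Γ] [MulAction Γ V] [GraphAction Γ T]

theorem GraphAction.reachable_smul (g : Γ) {a b : V} (h : T.Reachable a b) :
    T.Reachable (g • a) (g • b) := by
  let f : T →g T := ⟨fun v => g • v, fun {a b} h => GraphAction.smul_adj g a b h⟩
  exact h.map f

/-- The elements which move the vertex `v` inside its connected component. -/
def reachableSubgroup (Γ : Type*) [Group Γ] [MulAction Γ V] (T : SimpleGraph V)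
    [GraphAction Γ T] (v : V) : Subgroup Γ where
  carrier := {g | T.Reachable v (g • v)}
  one_mem' := by simp
  mul_mem' {a b} ha hb := by
    have := GraphAction.reachable_smul a (show T.Reachable v (b • v) from hb)
    rw [smul_smul] at this
    exact (show T.Reachable v (a • v) from ha).trans this
  inv_mem' {a} ha := by
    have := GraphAction.reachable_smul a⁻¹ (show T.Reachable v (a • v) from ha)
    rw [inv_smul_smul] at this
    exact this.symm

end TreeCriterion

/-! ### The Bass–Serre tree of an HNN extension -/

namespace HNNExtension

open NormalWord

variable {G : Type*} [Group G] {A B : Subgroup G} (φ : A ≃* B)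

/-- The vertex `gG` of the Bass–Serre tree. -/
def vertex (g : HNNExtension G A B φ) :
    HNNExtension G A B φ ⧸ (HNNExtension.of (φ := φ)).range := QuotientGroup.mk g

variable {φ}

theorem vertex_eq_iff {g k : HNNExtension G A B φ} :
    vertex φ g = vertex φ k ↔ ∃ x : G, k = g * of x := by
  rw [vertex, vertex, QuotientGroup.eq]
  constructor
  · rintro ⟨x, hx⟩; exact ⟨x, by rw [hx, mul_inv_cancel_left]⟩
  · rintro ⟨x, rfl⟩; exact ⟨x, by rw [inv_mul_cancel_left]⟩

theorem smul_vertex (k g : HNNExtension G A B φ) : k • vertex φ g = vertex φ (k * g) := rfl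

theorem exists_vertex (v : HNNExtension G A B φ ⧸ (HNNExtension.of (φ := φ)).range) :
    ∃ g, v = vertex φ g := by
  obtain ⟨g, rfl⟩ := QuotientGroup.mk_surjective v
  exact ⟨g, rfl⟩

/-- The sum of the exponents of the stable letter. -/
def degree : HNNExtension G A B φ →* Multiplicative ℤ :=
  lift 1 (Multiplicative.ofAdd 1) fun _ => by simp

theorem degree_of (x : G) : degree (of x : HNNExtension G A B φ) = 1 := by simp [degree]

theorem degree_t : degree (t : HNNExtension G A B φ) = Multiplicative.ofAdd 1 := by simp [degree]

theorem degree_eq_of_vertex_eq {g k : HNNExtension G A B φ} (h : vertex φ g = vertex φ k) :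
    degree g = degree k := by
  obtain ⟨x, rfl⟩ := vertex_eq_iff.1 h
  rw [map_mul, degree_of, mul_one]

/-- There is an edge `gA` from `u = gG` to `v = g t⁻¹ G`. -/
def Edge (u v : HNNExtension G A B φ ⧸ (HNNExtension.of (φ := φ)).range) : Prop :=
  ∃ g, u = vertex φ g ∧ v = vertex φ (g * t⁻¹)

theorem Edge.ne {u v : HNNExtension G A B φ ⧸ (HNNExtension.of (φ := φ)).range}
    (h : Edge u v) : u ≠ v := by
  rintro rfl
  obtain ⟨g, h1, h2⟩ := h
  have := degree_eq_of_vertex_eq (h1.symm.trans h2)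
  rw [map_mul, left_eq_mul, map_inv, degree_t] at this
  exact absurd this (by decide)

/-- The degree drops by one along an oriented edge. This orientation is also what rules out
inversions. -/
theorem Edge.asymm {u v : HNNExtension G A B φ ⧸ (HNNExtension.of (φ := φ)).range}
    (h : Edge u v) : ¬ Edge v u := by
  rintro ⟨k, h3, h4⟩
  obtain ⟨g, h1, h2⟩ := h
  have e1 := degree_eq_of_vertex_eq (h1.symm.trans h4)
  have e2 := degree_eq_of_vertex_eq (h2.symm.trans h3)
  rw [map_mul, map_inv, degree_t] at e1 e2
  rw [e1, mul_assoc, mul_eq_left] at e2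
  exact absurd e2 (by decide)

theorem hnnTree_adj_iff {u v : HNNExtension G A B φ ⧸ (HNNExtension.of (φ := φ)).range} :
    (hnnTree φ).Adj u v ↔ Edge u v ∨ Edge v u := by
  refine ⟨fun h => h.2, fun h => ⟨?_, h⟩⟩
  rcases h with h | h
  exacts [h.ne, h.ne.symm]

theorem edge_vertex_right {k : HNNExtension G A B φ}
    {u : HNNExtension G A B φ ⧸ (HNNExtension.of (φ := φ)).range} (h : Edge u (vertex φ k)) :
    ∃ b : G, u = vertex φ (k * of b * t) := by
  obtain ⟨g, rfl, h2⟩ := h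
  obtain ⟨b, hb⟩ := vertex_eq_iff.1 h2.symm
  exact ⟨b⁻¹, by rw [hb, map_inv]; group⟩

theorem edge_vertex_left {k : HNNExtension G A B φ}
    {u : HNNExtension G A B φ ⧸ (HNNExtension.of (φ := φ)).range} (h : Edge (vertex φ k) u) :
    ∃ a : G, u = vertex φ (k * of a * t⁻¹) := by
  obtain ⟨g, h1, rfl⟩ := h
  obtain ⟨a, rfl⟩ := vertex_eq_iff.1 h1
  exact ⟨a, rfl⟩

theorem edge_mul_t (k : HNNExtension G A B φ) : Edge (vertex φ (k * t)) (vertex φ k) :=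
  ⟨k * t, rfl, by rw [mul_inv_cancel_right]⟩

theorem edge_mul_t_inv (k : HNNExtension G A B φ) : Edge (vertex φ k) (vertex φ (k * t⁻¹)) :=
  ⟨k, rfl, rfl⟩

theorem exists_of_adj_vertex {g : HNNExtension G A B φ}
    {u : HNNExtension G A B φ ⧸ (HNNExtension.of (φ := φ)).range}
    (h : (hnnTree φ).Adj (vertex φ g) u) :
    ∃ (x : G) (ε : ℤˣ), u = vertex φ (g * of x * t ^ (ε : ℤ)) := by
  rcases hnnTree_adj_iff.1 h with h | h
  · obtain ⟨a, ha⟩ := edge_vertex_left h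
    exact ⟨a, -1, by simpa using ha⟩
  · obtain ⟨b, hb⟩ := edge_vertex_right h
    exact ⟨b, 1, by simpa using hb⟩

theorem of_mul_t_zpow (ε : ℤˣ) (x : toSubgroup A B (-ε)) :
    ∃ y : G, (of (x : G) * t ^ (ε : ℤ) : HNNExtension G A B φ) = t ^ (ε : ℤ) * of y := by
  rcases Int.units_eq_one_or ε with rfl | rfl
  · exact ⟨_, by simpa using of_mul_t (φ := φ) ⟨x, x.2⟩⟩
  · exact ⟨_, by simpa using of_mul_inv_t (φ := φ) ⟨x, x.2⟩⟩

/-- The number of stable letters in the normal form of the inverse of `g`. -/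
def stableLength (d : TransversalPair G A B) (g : HNNExtension G A B φ) : ℕ :=
  (g⁻¹ • (NormalWord.empty : NormalWord d)).toList.length

/-- Passing to the inverse turns right multiplication by `x` into a left multiplication, which
affects only the head of the normal form. Hence the length is a function on vertices. -/
theorem stableLength_mul_of (d : TransversalPair G A B) (g : HNNExtension G A B φ) (x : G) :
    stableLength d (g * of x) = stableLength d g := by
  rw [stableLength, mul_inv_rev, mul_smul, ← map_inv, of_smul_eq_smul, group_smul_toList]
  rfl

theorem cancels_of_length_le (d : TransversalPair G A B) (u : ℤˣ) (w : NormalWord d)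
    (h : (unitsSMul φ u w).toList.length ≤ w.toList.length) : Cancels u w := by
  classical
  by_contra hc
  rw [unitsSMul, dif_neg hc] at h
  simp at h

/-- A neighbour that is no longer must come from a cancellation. The first stable letter of the
normal form then prescribes the exponent, and the head prescribes `x` up to the associated subgroup,
that is, up to the vertex. -/
theorem stableLength_unique (d : TransversalPair G A B) (g : HNNExtension G A B φ) (x x' : G)
    (ε ε' : ℤˣ) (h : stableLength d (g * of x * t ^ (ε : ℤ)) ≤ stableLength d g)
    (h' : stableLength d (g * of x' * t ^ (ε' : ℤ)) ≤ stableLength d g) :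
    vertex φ (g * of x * t ^ (ε : ℤ)) = vertex φ (g * of x' * t ^ (ε' : ℤ)) := by
  set w := g⁻¹ • (NormalWord.empty : NormalWord d) with hw
  have key : ∀ (x : G) (ε : ℤˣ), stableLength d (g * of x * t ^ (ε : ℤ)) ≤ stableLength d g →
      x⁻¹ * w.head ∈ toSubgroup A B (-ε) ∧ w.toList.head?.map Prod.fst = some ε := by
    intro x ε h
    have e : (g * of x * t ^ (ε : ℤ))⁻¹ • (NormalWord.empty : NormalWord d) =
        unitsSMul φ (-ε) (x⁻¹ • w) := by
      rw [mul_inv_rev, mul_inv_rev, mul_smul, mul_smul, ← map_inv, of_smul_eq_smul, ← zpow_neg,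
        ← Units.val_neg, t_pow_smul_eq_unitsSMul]
    rw [stableLength, e] at h
    have hc := cancels_of_length_le d (-ε) (x⁻¹ • w) h
    exact ⟨hc.1, by simpa [Cancels] using hc.2⟩
  obtain ⟨h1, h2⟩ := key x ε h
  obtain ⟨h3, h4⟩ := key x' ε' h'
  obtain rfl : ε = ε' := by
    rw [h2] at h4
    exact Option.some_injective _ h4
  have h5 := Subgroup.mul_mem _ h1 (Subgroup.inv_mem _ h3)
  rw [mul_inv_rev, inv_inv, mul_assoc, mul_inv_cancel_left] at h5
  obtain ⟨y, hy⟩ := of_mul_t_zpow (φ := φ) ε ⟨_, h5⟩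
  refine vertex_eq_iff.2 ⟨y, ?_⟩
  rw [mul_assoc _ _ (of y), ← hy, map_mul, map_inv]
  group

theorem isTree_hnnTree : (hnnTree φ).IsTree := by
  obtain ⟨d⟩ : Nonempty (TransversalPair G A B) := inferInstance
  have hconn : ∀ g, g ∈ reachableSubgroup (HNNExtension G A B φ) (hnnTree φ) (vertex φ 1) := by
    intro g
    induction g using HNNExtension.induction_on with
    | of x =>
      show (hnnTree φ).Reachable _ _
      rw [smul_vertex, show vertex φ (of x * 1) = vertex φ 1 from
        (vertex_eq_iff.2 ⟨x, by simp⟩).symm]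
    | t =>
      refine (SimpleGraph.Adj.reachable ?_ : (hnnTree φ).Reachable _ _)
      rw [hnnTree_adj_iff, smul_vertex, mul_one]
      exact Or.inr (by simpa using edge_mul_t (1 : HNNExtension G A B φ))
    | mul x y hx hy => exact Subgroup.mul_mem _ hx hy
    | inv x hx => exact Subgroup.inv_mem _ hx
  have hconn' : ∀ v, (hnnTree φ).Reachable (vertex φ 1) v := by
    intro v
    obtain ⟨g, rfl⟩ := exists_vertex v
    have h : (hnnTree φ).Reachable _ _ := hconn g
    rwa [smul_vertex, mul_one] at h
  have : Nonempty (HNNExtension G A B φ ⧸ (HNNExtension.of (φ := φ)).range) := ⟨vertex φ 1⟩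
  refine ⟨⟨fun a b => (hconn' a).symm.trans (hconn' b)⟩, ?_⟩
  let ℓ : HNNExtension G A B φ ⧸ (HNNExtension.of (φ := φ)).range → ℕ :=
    Quotient.lift (stableLength d) fun g k hgk => by
      obtain ⟨x, rfl⟩ := vertex_eq_iff.1 (Quotient.sound hgk : vertex φ g = vertex φ k)
      rw [stableLength_mul_of]
  refine SimpleGraph.isAcyclic_of_level ℓ fun v u u' h h' hl hl' => ?_
  obtain ⟨g, rfl⟩ := exists_vertex v
  obtain ⟨x, ε, rfl⟩ := exists_of_adj_vertex h
  obtain ⟨x', ε', rfl⟩ := exists_of_adj_vertex h'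
  exact stableLength_unique d g x x' ε ε' hl hl'

theorem actsWithoutInversion : ActsWithoutInversion (HNNExtension G A B φ) (hnnTree φ) := by
  have key : ∀ (γ : HNNExtension G A B φ)
      (u v : HNNExtension G A B φ ⧸ (HNNExtension.of (φ := φ)).range),
      Edge u v → γ • u = v → γ • v ≠ u := by
    rintro γ u v huv h1 h2
    refine huv.asymm ?_
    obtain ⟨g, rfl, rfl⟩ := huv
    exact ⟨γ * g, h1.symm, by rw [← h2, smul_vertex, mul_assoc]⟩
  intro γ u v huv h1 h2
  rcases hnnTree_adj_iff.1 huv with h | h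
  exacts [key γ u v h h1 h2, key γ v u h h2 h1]

/-- Britton's lemma: for `x ∉ A` the word is reduced and contains stable letters. -/
theorem mem_of_t_mul_mul_t_inv {x : G}
    (h : (t * of x * t⁻¹ : HNNExtension G A B φ) ∈ (of (φ := φ)).range) : x ∈ A := by
  by_contra hx
  let w : ReducedWord G A B := ⟨1, [(1, x), (-1, 1)], by simp [hx]⟩
  have := ReducedWord.toList_eq_nil_of_mem_of_range φ w (by
    simpa [w, ReducedWord.prod, mul_assoc] using h)
  simp [w] at this

theorem mem_of_t_inv_mul_mul_t {x : G}
    (h : (t⁻¹ * of x * t : HNNExtension G A B φ) ∈ (of (φ := φ)).range) : x ∈ B := by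
  by_contra hx
  let w : ReducedWord G A B := ⟨1, [(-1, x), (1, 1)], by simp [hx]⟩
  have := ReducedWord.toList_eq_nil_of_mem_of_range φ w (by
    simpa [w, ReducedWord.prod, mul_assoc] using h)
  simp [w] at this

theorem mem_of_smul_vertex_mul_t_inv {k : HNNExtension G A B φ} {x : G}
    (h : (k * of x * k⁻¹) • vertex φ (k * t⁻¹) = vertex φ (k * t⁻¹)) : x ∈ A := by
  rw [smul_vertex, eq_comm, vertex_eq_iff] at h
  obtain ⟨y, hy⟩ := h
  refine mem_of_t_mul_mul_t_inv (φ := φ) ⟨y, ?_⟩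
  have : (of y : HNNExtension G A B φ) = (k * t⁻¹)⁻¹ * (k * of x * k⁻¹ * (k * t⁻¹)) := by
    rw [hy, inv_mul_cancel_left]
  rw [this]
  group

theorem mem_of_smul_vertex_mul_t {k : HNNExtension G A B φ} {x : G}
    (h : (k * of x * k⁻¹) • vertex φ (k * t) = vertex φ (k * t)) : x ∈ B := by
  rw [smul_vertex, eq_comm, vertex_eq_iff] at h
  obtain ⟨y, hy⟩ := h
  refine mem_of_t_inv_mul_mul_t (φ := φ) ⟨y, ?_⟩
  have : (of y : HNNExtension G A B φ) = (k * t)⁻¹ * (k * of x * k⁻¹ * (k * t)) := by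
    rw [hy, inv_mul_cancel_left]
  rw [this]
  group

theorem exists_conj_of_smul_vertex {γ k : HNNExtension G A B φ}
    (h : γ • vertex φ k = vertex φ k) : ∃ x : G, γ = k * of x * k⁻¹ := by
  rw [smul_vertex, eq_comm, vertex_eq_iff] at h
  obtain ⟨x, hx⟩ := h
  exact ⟨x, by rw [← hx, mul_inv_cancel_right]⟩

theorem exists_conj_of_adj {u v : HNNExtension G A B φ ⧸ (HNNExtension.of (φ := φ)).range}
    (h : (hnnTree φ).Adj u v) : ∃ k : HNNExtension G A B φ, ∀ γ : HNNExtension G A B φ,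
      γ • u = u → γ • v = v → ∃ a ∈ A, γ = k * of a * k⁻¹ := by
  have key : ∀ {u v : HNNExtension G A B φ ⧸ (HNNExtension.of (φ := φ)).range}, Edge u v →
      ∃ k : HNNExtension G A B φ, ∀ γ : HNNExtension G A B φ,
      γ • u = u → γ • v = v → ∃ a ∈ A, γ = k * of a * k⁻¹ := by
    rintro u v ⟨k, rfl, rfl⟩
    refine ⟨k, fun γ h1 h2 => ?_⟩
    obtain ⟨a, rfl⟩ := exists_conj_of_smul_vertex h1
    exact ⟨a, mem_of_smul_vertex_mul_t_inv h2, rfl⟩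
  rcases hnnTree_adj_iff.1 h with h | h
  · exact key h
  · obtain ⟨k, hk⟩ := key h
    exact ⟨k, fun γ h1 h2 => hk γ h2 h1⟩

end HNNExtension

theorem conj_mem_normalizer_zpowers {G : Type*} [Group G] {z k n : G}
    (hn : n ∈ Subgroup.normalizer (Subgroup.zpowers (k⁻¹ * z * k⁻¹⁻¹) : Set G)) :
    k * n * k⁻¹ ∈ Subgroup.normalizer (Subgroup.zpowers z : Set G) := by
  rw [mem_normalizer_zpowers] at hn ⊢
  have tr : ∀ m, m ∈ Subgroup.zpowers (k⁻¹ * z * k⁻¹⁻¹) → k * m * k⁻¹ ∈ Subgroup.zpowers z := by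
    rintro _ ⟨i, rfl⟩
    refine ⟨i, ?_⟩
    show z ^ i = k * (k⁻¹ * z * k⁻¹⁻¹) ^ i * k⁻¹
    rw [conj_zpow]; group
  constructor
  · have := tr _ hn.1
    convert this using 1; group
  · have := tr _ hn.2
    convert this using 1; group

theorem SimpleGraph.isAxial_of_adj {V : Type*} {T : SimpleGraph V} (hT : T.IsTree) {Γ : Type*}
    [Group Γ] [MulAction Γ V] [GraphAction Γ T] {g : Γ} {v : V} (h : T.Adj v (g • v))
    (hne : v ≠ g • g • v) : IsAxial T g v := by
  refine ⟨h.ne, ?_⟩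
  rw [hT.dist_eq_two h (GraphAction.smul_adj g _ _ h) hne, SimpleGraph.dist_eq_one_iff_adj.2 h]

/-! ### Fixed subtrees and the splitting given by an HNN extension -/

namespace HNNExtension

variable {G : Type*} [Group G] {A B : Subgroup G} {φ : A ≃* B}

section LocalStructure

variable {P : Type*} [Group P] {π : HNNExtension G A B φ →* P}
  (hAB : ∀ z x : G, π (of z) = 1 → z ∈ B → x⁻¹ * z * x ∈ A → z = 1)
  (hBB : ∀ z x : G, π (of z) = 1 → z ∈ B → x⁻¹ * z * x ∈ B → x ∉ B → z = 1)
include hAB hBB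

/-- Edges arriving at `v` correspond to cosets of `B` and edges leaving it to cosets of `A`. Fixing
an arriving edge and a second edge puts the element into `B` and a conjugate of `A`, or into two
conjugates of `B` as in `hBB`. -/
theorem eq_one_of_edge_of_adj {γ : HNNExtension G A B φ}
    {u v w : HNNExtension G A B φ ⧸ (HNNExtension.of (φ := φ)).range} (hγ : π γ = 1)
    (huv : Edge u v) (hvw : (hnnTree φ).Adj v w) (hne : w ≠ u) (hu : γ • u = u) (hv : γ • v = v)
    (hw : γ • w = w) : γ = 1 := by
  obtain ⟨g, rfl, rfl⟩ := huv
  obtain ⟨k, rfl⟩ : ∃ k, g = k * t := ⟨g * t⁻¹, by simp⟩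
  rw [mul_inv_cancel_right] at hv hvw
  obtain ⟨z, rfl⟩ := exists_conj_of_smul_vertex hv
  have hz : π (of z) = 1 := by
    rw [map_mul, map_mul, map_inv] at hγ
    rwa [mul_inv_eq_one, mul_eq_left] at hγ
  have hzB := mem_of_smul_vertex_mul_t hu
  have hconj : ∀ x : G, k * of z * k⁻¹ =
      k * of x * of (x⁻¹ * z * x) * (k * of x)⁻¹ := fun x => by
    simp only [map_mul, map_inv]; group
  suffices z = 1 by rw [this]; simp
  rcases hnnTree_adj_iff.1 hvw with h | h
  · obtain ⟨a, rfl⟩ := edge_vertex_left h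
    rw [hconj a] at hw
    exact hAB z a hz hzB (mem_of_smul_vertex_mul_t_inv hw)
  · obtain ⟨b, rfl⟩ := edge_vertex_right h
    rw [hconj b] at hw
    refine hBB z b hz hzB (mem_of_smul_vertex_mul_t hw) fun hb => hne ?_
    refine ((vertex_eq_iff (φ := φ)).2 ⟨((φ.symm ⟨b, hb⟩ : A) : G), ?_⟩).symm
    rw [mul_assoc, mul_assoc, ← of_mul_t (φ := φ) ⟨b, hb⟩]

/-- Why 3: the middle edge of a fixed path of length 3 is followed by another fixed edge at its
terminal vertex, whichever way it is oriented. -/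
theorem eq_one_of_far {γ : HNNExtension G A B φ}
    {u w : HNNExtension G A B φ ⧸ (HNNExtension.of (φ := φ)).range} (hγ : π γ = 1)
    (hu : γ • u = u) (hw : γ • w = w) (hd : 3 ≤ (hnnTree φ).dist u w) : γ = 1 := by
  have hT : (hnnTree φ).IsTree := isTree_hnnTree
  have step : ∀ x, γ • x = x → x ≠ w → ∃ y, (hnnTree φ).Adj x y ∧ γ • y = y ∧
      (hnnTree φ).dist y w + 1 = (hnnTree φ).dist x w := by
    intro x hx hxw
    obtain ⟨y, hy, hy'⟩ := hT.exists_adj_closer hxw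
    refine ⟨y, hy, GraphAction.smul_eq_of_between hT hx hw ?_, hy'⟩
    rw [SimpleGraph.dist_eq_one_iff_adj.2 hy]; omega
  obtain ⟨x₁, a1, f1, d1⟩ := step u hu (by rintro rfl; simp at hd)
  obtain ⟨x₂, a2, f2, d2⟩ := step x₁ f1 (by rintro rfl; simp at d1; omega)
  obtain ⟨x₃, a3, f3, d3⟩ := step x₂ f2 (by rintro rfl; simp at d2; omega)
  rcases hnnTree_adj_iff.1 a2 with h | h
  · exact eq_one_of_edge_of_adj hAB hBB hγ h a3 (by rintro rfl; omega) f1 f2 f3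
  · exact eq_one_of_edge_of_adj hAB hBB hγ h a1.symm (by rintro rfl; omega) f2 f1 hu

/-- On the fixed path joining two different origins, or prolonged by one of the given edges, some
edge would arrive at a vertex carrying a second fixed edge. -/
theorem origin_unique {γ : HNNExtension G A B φ}
    {u u' w w' : HNNExtension G A B φ ⧸ (HNNExtension.of (φ := φ)).range} (hγ : π γ = 1)
    (hγ1 : γ ≠ 1) (huu : Edge u u') (hww : Edge w w') (hu : γ • u = u) (hu' : γ • u' = u')
    (hw : γ • w = w) (hw' : γ • w' = w') : u = w := by
  by_contra hne
  have hT : (hnnTree φ).IsTree := isTree_hnnTree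
  have step : ∀ x, γ • x = x → x ≠ w → ∃ y, (hnnTree φ).Adj x y ∧ γ • y = y ∧
      (hnnTree φ).dist y w + 1 = (hnnTree φ).dist x w := by
    intro x hx hxw
    obtain ⟨y, hy, hy'⟩ := hT.exists_adj_closer hxw
    refine ⟨y, hy, GraphAction.smul_eq_of_between hT hx hw ?_, hy'⟩
    rw [SimpleGraph.dist_eq_one_iff_adj.2 hy]; omega
  obtain ⟨x₁, a1, f1, d1⟩ := step u hu hne
  rcases hnnTree_adj_iff.1 a1 with h | h
  · by_cases hx : x₁ = w
    · subst hx
      exact hγ1 (eq_one_of_edge_of_adj hAB hBB hγ h (hnnTree_adj_iff.2 (Or.inl hww))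
        (by rintro rfl; exact h.asymm hww) hu hw hw')
    · obtain ⟨x₂, a2, f2, d2⟩ := step x₁ f1 hx
      exact hγ1 (eq_one_of_edge_of_adj hAB hBB hγ h a2 (by rintro rfl; omega) hu f1 f2)
  · exact hγ1 (eq_one_of_edge_of_adj hAB hBB hγ h (hnnTree_adj_iff.2 (Or.inl huu))
      (by rintro rfl; exact h.asymm huu) f1 hu hu')

/-- The normalizer preserves the fixed set of `γ`. This set has a canonical vertex: the common
origin of its edges, or its only vertex if it has no edge. -/
theorem exists_fixed_by_normalizer {γ : HNNExtension G A B φ} (hγ : π γ = 1) (hγ1 : γ ≠ 1)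
    {x : HNNExtension G A B φ ⧸ (HNNExtension.of (φ := φ)).range} (hx : γ • x = x) :
    ∃ y : HNNExtension G A B φ ⧸ (HNNExtension.of (φ := φ)).range,
      ∀ n ∈ Subgroup.normalizer (Subgroup.zpowers γ : Set (HNNExtension G A B φ)),
        n • y = y := by
  have hT : (hnnTree φ).IsTree := isTree_hnnTree
  have hmove : ∀ n ∈ Subgroup.normalizer (Subgroup.zpowers γ : Set (HNNExtension G A B φ)),
      ∀ y : HNNExtension G A B φ ⧸ (HNNExtension.of (φ := φ)).range,
      γ • y = y → γ • n • y = n • y := by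
    intro n hn y hy
    have h1 : Subgroup.zpowers γ ≤ MulAction.stabilizer _ y := by
      rw [Subgroup.zpowers_le]; exact hy
    have h2 : (n⁻¹ * γ * n) • y = y := h1 (mem_normalizer_zpowers.1 hn).2
    rwa [mul_smul, mul_smul, inv_smul_eq_iff] at h2
  by_cases hE : ∃ u u' : HNNExtension G A B φ ⧸ (HNNExtension.of (φ := φ)).range,
      Edge u u' ∧ γ • u = u ∧ γ • u' = u'
  · obtain ⟨u, u', huu, hu, hu'⟩ := hE
    refine ⟨u, fun n hn => ?_⟩
    have h2 : Edge (n • u) (n • u') := by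
      obtain ⟨g, rfl, rfl⟩ := huu
      exact ⟨n * g, rfl, by rw [smul_vertex, mul_assoc]⟩
    exact origin_unique hAB hBB hγ hγ1 h2 huu (hmove n hn _ hu) (hmove n hn _ hu') hu hu'
  · refine ⟨x, fun n hn => ?_⟩
    by_contra hne
    have h1 := hmove n hn x hx
    obtain ⟨y, hy, hy'⟩ := hT.exists_adj_closer (Ne.symm hne)
    have h2 : γ • y = y := GraphAction.smul_eq_of_between hT hx h1 (by
      rw [SimpleGraph.dist_eq_one_iff_adj.2 hy]; omega)
    rcases hnnTree_adj_iff.1 hy with h | h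
    · exact hE ⟨x, y, h, hx, h2⟩
    · exact hE ⟨y, x, h, h2, hx⟩

end LocalStructure

theorem exists_ends {b : G} (hb : b ∉ B) :
    ∃ (v : HNNExtension G A B φ ⧸ (HNNExtension.of (φ := φ)).range)
      (h : Fin 3 → HNNExtension G A B φ), (∀ i, IsAxial (hnnTree φ) (h i) v) ∧ ∀ i j, i ≠ j →
      (hnnTree φ).dist (h i • v) (h j • v) =
        (hnnTree φ).dist v (h i • v) + (hnnTree φ).dist v (h j • v) := by
  have hT : (hnnTree φ).IsTree := isTree_hnnTree
  have hdeg : ∀ {g k : HNNExtension G A B φ}, degree g ≠ degree k → vertex φ g ≠ vertex φ k :=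
    fun h e => h (degree_eq_of_vertex_eq e)
  -- These move the base vertex along three different edges: the degree separates `t⁻¹` from the
  -- others, and `b ∉ B` separates `t` from `b t`.
  let h : Fin 3 → HNNExtension G A B φ := ![t, of b * t, t⁻¹]
  have hadj : ∀ i, (hnnTree φ).Adj (vertex φ 1) (h i • vertex φ 1) := by
    have h1 : vertex φ (of b) = vertex φ 1 := (vertex_eq_iff.2 ⟨b, by simp⟩).symm
    intro i
    rw [hnnTree_adj_iff, smul_vertex, mul_one]
    fin_cases i
    · exact Or.inr (by simpa [h] using edge_mul_t (1 : HNNExtension G A B φ))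
    · exact Or.inr (by simpa [h, h1] using edge_mul_t (of b : HNNExtension G A B φ))
    · exact Or.inl (by simpa [h] using edge_mul_t_inv (1 : HNNExtension G A B φ))
  have hne2 : ∀ i, vertex φ 1 ≠ h i • h i • vertex φ 1 := by
    intro i
    rw [smul_vertex, smul_vertex]
    refine hdeg ?_
    fin_cases i <;> simp [h, degree_of, degree_t] <;> decide
  have h01 : vertex φ t ≠ vertex φ (of b * t) := by
    intro e
    obtain ⟨x, hx⟩ := vertex_eq_iff.1 e
    refine hb (mem_of_t_inv_mul_mul_t (φ := φ) ⟨x, ?_⟩)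
    rw [mul_assoc, hx, inv_mul_cancel_left]
  have h02 : vertex φ t ≠ vertex φ t⁻¹ := hdeg (by simp [degree_t]; decide)
  have h12 : vertex φ (of b * t) ≠ vertex φ t⁻¹ := hdeg (by simp [degree_t, degree_of]; decide)
  have hinj : ∀ i j, i ≠ j → h i • vertex φ 1 ≠ h j • vertex φ 1 := by
    intro i j hij
    simp only [smul_vertex, mul_one]
    fin_cases i <;> fin_cases j
    exacts [absurd rfl hij, h01, h02, h01.symm, absurd rfl hij, h12, h02.symm, h12.symm,
      absurd rfl hij]
  refine ⟨vertex φ 1, h, fun i => SimpleGraph.isAxial_of_adj hT (hadj i) (hne2 i), ?_⟩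
  intro i j hij
  rw [hT.dist_eq_two (hadj i).symm (hadj j) (hinj i j hij),
    SimpleGraph.dist_eq_one_iff_adj.2 (hadj i), SimpleGraph.dist_eq_one_iff_adj.2 (hadj j)]

theorem isSTSplitting {π : HNNExtension G A B φ →* G ⧸ translationSubgroup G}
    (hπ : ∀ g, π (of g) = QuotientGroup.mk g)
    (hAB : ∀ z x : G, π (of z) = 1 → z ∈ B → x⁻¹ * z * x ∈ A → z = 1)
    (hBB : ∀ z x : G, π (of z) = 1 → z ∈ B → x⁻¹ * z * x ∈ B → x ∉ B → z = 1)
    {C : ℕ} (hC : (A : Set G).encard ≤ C)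
    (hA : ∀ a ∈ A, ∀ a' ∈ A, π (of a) ≠ 1 → π (of a') ≠ 1 → π (of (a * a')) = 1)
    {b : G} (hb : b ∉ B) : IsSTSplitting (of (φ := φ)) π (hnnTree φ) := by
  have hT : (hnnTree φ).IsTree := isTree_hnnTree
  have hret : IsInvolutionRetraction (of (φ := φ)) π := by
    refine ⟨of_injective φ, hπ, fun γ hγ => ?_⟩
    have hfin : Finite (Subgroup.zpowers γ) :=
      finite_zpowers.2 (orderOf_ne_zero_iff.1 (by omega))
    obtain ⟨x, hx⟩ := GraphAction.exists_fixed_of_finite hT actsWithoutInversion _ hfin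
    obtain ⟨k, rfl⟩ := exists_vertex x
    obtain ⟨y, hy⟩ := exists_conj_of_smul_vertex (hx γ (Subgroup.mem_zpowers γ))
    exact ⟨k⁻¹, y, by rw [hy]; group⟩
  have hconj : ∀ (k : HNNExtension G A B φ) (a : G), π (k * of a * k⁻¹) = 1 ↔ π (of a) = 1 := by
    intro k a
    rw [map_mul, map_mul, map_inv, mul_inv_eq_one, mul_eq_left]
  refine { hret with
    isTree := hT
    withoutInversion := actsWithoutInversion
    edge_bound := ⟨C, fun u v huv => ?_⟩
    edge_mul := ?_
    far_fixed := fun γ u v hγ => eq_one_of_far hAB hBB hγ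
    normalizer_le := ?_
    ends := exists_ends hb }
  · obtain ⟨k, hk⟩ := exists_conj_of_adj huv
    refine le_trans (Set.encard_le_encard (t := (fun a => k * of a * k⁻¹) '' A) ?_)
      ((Set.encard_image_le _ _).trans hC)
    rintro γ ⟨h1, h2⟩
    obtain ⟨a, ha, rfl⟩ := hk γ h1 h2
    exact ⟨a, ha, rfl⟩
  · intro u v γ γ' huv h1 h2 h1' h2' h3 h3'
    obtain ⟨k, hk⟩ := exists_conj_of_adj huv
    obtain ⟨a, ha, rfl⟩ := hk γ h1 h2
    obtain ⟨a', ha', rfl⟩ := hk γ' h1' h2'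
    rw [Ne, hconj] at h3 h3'
    have e : k * of a * k⁻¹ * (k * of a' * k⁻¹) = k * of (a * a') * k⁻¹ := by
      rw [map_mul]; group
    rw [e, hconj]
    exact hA a ha a' ha' h3 h3'
  · intro r s hrs x hx
    obtain ⟨y, hy⟩ := exists_fixed_by_normalizer hAB hBB
      (hret.map_translation ⟨r, s, hrs, rfl⟩) hrs.mul_ne_one hx
    obtain ⟨k, rfl⟩ := exists_vertex y
    refine ⟨k⁻¹, fun n hn => ?_⟩
    have hn' := conj_mem_normalizer_zpowers hn
    obtain ⟨z, hz⟩ := exists_conj_of_smul_vertex (hy _ hn')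
    exact ⟨z, by
      have : n = k⁻¹ * (k * n * k⁻¹) * k := by group
      rw [this, hz]; group⟩

end HNNExtension

/-! ### The Bass–Serre tree of a free product and its splitting -/

namespace Monoid.CoprodI

variable {ι : Type*} [DecidableEq ι] {M : ι → Type*} [∀ i, Group (M i)] [∀ i, DecidableEq (M i)]

/-- The number of syllables of the inverse of `c`, apart from an initial one in `M i`. -/
def tailLength (i : ι) (c : CoprodI M) : ℕ :=
  (Word.equivPair i (c⁻¹ • (Word.empty : Word M))).tail.toList.length

theorem tailLength_mul_of (i : ι) (c : CoprodI M) (m : M i) :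
    tailLength i (c * of m) = tailLength i c := by
  rw [tailLength, mul_inv_rev, mul_smul, ← map_inv, Word.equivPair_smul_same]
  rfl

/-- Unless `m` cancels the head exactly, a syllable in `M i` remains and is counted in the tail seen
from `j`. -/
theorem eq_head_of_tailLength_le {i j : ι} (hij : i ≠ j) (c : CoprodI M) (m : M i)
    (h : tailLength j (c * of m) ≤ tailLength i c) :
    m = (Word.equivPair i (c⁻¹ • (Word.empty : Word M))).head := by
  rw [tailLength, tailLength, mul_inv_rev, mul_smul, ← map_inv] at h
  set w := c⁻¹ • (Word.empty : Word M)
  by_contra hne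
  have h1 : m⁻¹ * (Word.equivPair i w).head ≠ 1 := fun e => hne (inv_mul_eq_one.1 e)
  have e : of m⁻¹ • w = Word.cons (m⁻¹ * (Word.equivPair i w).head) (Word.equivPair i w).tail
      (Word.equivPair i w).fstIdx_ne h1 := by
    rw [Word.of_smul_def, Word.rcons, dif_neg h1]
  rw [e, Word.equivPair_eq_of_fstIdx_ne (by simpa using hij)] at h
  simp [Word.cons] at h

end Monoid.CoprodI

namespace Monoid.Coprod

universe u v

variable {G : Type u} {H : Type v} [Group G] [Group H]

/-- The vertex `gG` of the Bass–Serre tree. -/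
def leftVertex (g : G ∗ H) : ((G ∗ H) ⧸ (inl : G →* G ∗ H).range) ⊕
    ((G ∗ H) ⧸ (inr : H →* G ∗ H).range) := Sum.inl (QuotientGroup.mk g)

/-- The vertex `gH` of the Bass–Serre tree. -/
def rightVertex (g : G ∗ H) : ((G ∗ H) ⧸ (inl : G →* G ∗ H).range) ⊕
    ((G ∗ H) ⧸ (inr : H →* G ∗ H).range) := Sum.inr (QuotientGroup.mk g)

theorem leftVertex_eq_iff {g k : G ∗ H} :
    leftVertex g = leftVertex k ↔ ∃ x : G, k = g * inl x := by
  rw [leftVertex, leftVertex, Sum.inl.injEq, QuotientGroup.eq]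
  constructor
  · rintro ⟨x, hx⟩; exact ⟨x, by rw [hx, mul_inv_cancel_left]⟩
  · rintro ⟨x, rfl⟩; exact ⟨x, by rw [inv_mul_cancel_left]⟩

theorem rightVertex_eq_iff {g k : G ∗ H} :
    rightVertex g = rightVertex k ↔ ∃ y : H, k = g * inr y := by
  rw [rightVertex, rightVertex, Sum.inr.injEq, QuotientGroup.eq]
  constructor
  · rintro ⟨x, hx⟩; exact ⟨x, by rw [hx, mul_inv_cancel_left]⟩
  · rintro ⟨x, rfl⟩; exact ⟨x, by rw [inv_mul_cancel_left]⟩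

theorem leftVertex_ne_rightVertex (g k : G ∗ H) : leftVertex g ≠ rightVertex k := Sum.inl_ne_inr

theorem smul_leftVertex (k g : G ∗ H) : k • leftVertex g = leftVertex (k * g) := rfl

theorem smul_rightVertex (k g : G ∗ H) : k • rightVertex g = rightVertex (k * g) := rfl

theorem exists_vertex (v : ((G ∗ H) ⧸ (inl : G →* G ∗ H).range) ⊕
    ((G ∗ H) ⧸ (inr : H →* G ∗ H).range)) :
    (∃ g, v = leftVertex g) ∨ ∃ g, v = rightVertex g := by
  rcases v with v | v
  all_goals obtain ⟨g, rfl⟩ := QuotientGroup.mk_surjective v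
  exacts [Or.inl ⟨g, rfl⟩, Or.inr ⟨g, rfl⟩]

theorem adj_leftVertex_rightVertex (g : G ∗ H) :
    (freeProductTree G H).Adj (leftVertex g) (rightVertex g) :=
  ⟨leftVertex_ne_rightVertex g g, Or.inl ⟨g, rfl, rfl⟩⟩

theorem exists_of_adj {u v : ((G ∗ H) ⧸ (inl : G →* G ∗ H).range) ⊕
    ((G ∗ H) ⧸ (inr : H →* G ∗ H).range)} (h : (freeProductTree G H).Adj u v) :
    ∃ g, u = leftVertex g ∧ v = rightVertex g ∨ v = leftVertex g ∧ u = rightVertex g := by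
  rcases h.2 with ⟨g, h1, h2⟩ | ⟨g, h1, h2⟩
  exacts [⟨g, Or.inl ⟨h1, h2⟩⟩, ⟨g, Or.inr ⟨h1, h2⟩⟩]

theorem exists_of_adj_leftVertex {g : G ∗ H} {u : ((G ∗ H) ⧸ (inl : G →* G ∗ H).range) ⊕
    ((G ∗ H) ⧸ (inr : H →* G ∗ H).range)} (h : (freeProductTree G H).Adj (leftVertex g) u) :
    ∃ x : G, u = rightVertex (g * inl x) := by
  obtain ⟨k, ⟨h1, rfl⟩ | ⟨-, h2⟩⟩ := exists_of_adj h
  · obtain ⟨x, rfl⟩ := leftVertex_eq_iff.1 h1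
    exact ⟨x, rfl⟩
  · exact absurd h2 (leftVertex_ne_rightVertex _ _)

theorem exists_of_adj_rightVertex {g : G ∗ H} {u : ((G ∗ H) ⧸ (inl : G →* G ∗ H).range) ⊕
    ((G ∗ H) ⧸ (inr : H →* G ∗ H).range)} (h : (freeProductTree G H).Adj (rightVertex g) u) :
    ∃ y : H, u = leftVertex (g * inr y) := by
  obtain ⟨k, ⟨h1, -⟩ | ⟨rfl, h2⟩⟩ := exists_of_adj h
  · exact absurd h1.symm (leftVertex_ne_rightVertex _ _)
  · obtain ⟨y, rfl⟩ := rightVertex_eq_iff.1 h2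
    exact ⟨y, rfl⟩

variable (G H) in
/-- The two factors of `G ∗ H`, as a family of groups. -/
def Factor : Bool → Type (max u v)
  | false => ULift.{v} G
  | true => ULift.{u} H

instance : ∀ i, Group (Factor G H i)
  | false => inferInstanceAs (Group (ULift G))
  | true => inferInstanceAs (Group (ULift H))

/-- The factor `G`, as a member of the family. -/
def leftFactor : G →* Factor G H false := (MulEquiv.ulift (α := G)).symm.toMonoidHom

/-- The factor `H`, as a member of the family. -/
def rightFactor : H →* Factor G H true := (MulEquiv.ulift (α := H)).symm.toMonoidHom

theorem leftFactor_injective : Function.Injective (leftFactor : G →* Factor G H false) :=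
  (MulEquiv.ulift (α := G)).symm.injective

theorem rightFactor_injective : Function.Injective (rightFactor : H →* Factor G H true) :=
  (MulEquiv.ulift (α := H)).symm.injective

/-- The homomorphism from `G ∗ H` to the indexed free product of its factors. -/
def toCoprodI : G ∗ H →* CoprodI (Factor G H) :=
  lift (CoprodI.of.comp leftFactor) (CoprodI.of.comp rightFactor)

theorem toCoprodI_inl (x : G) :
    toCoprodI (inl x : G ∗ H) = CoprodI.of (leftFactor (H := H) x) := rfl

theorem toCoprodI_inr (x : H) :
    toCoprodI (inr x : G ∗ H) = CoprodI.of (rightFactor (G := G) x) := rfl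

theorem isTree_freeProductTree : (freeProductTree G H).IsTree := by
  classical
  have hconn : ∀ g, g ∈ reachableSubgroup (G ∗ H) (freeProductTree G H) (leftVertex 1) := by
    intro g
    induction g using Monoid.Coprod.induction_on with
    | inl x =>
      show (freeProductTree G H).Reachable _ _
      rw [smul_leftVertex, show leftVertex (inl x * 1 : G ∗ H) = leftVertex 1 from
        (leftVertex_eq_iff.2 ⟨x, by simp⟩).symm]
    | inr y =>
      show (freeProductTree G H).Reachable _ _
      have h1 : rightVertex (inr y * 1 : G ∗ H) = rightVertex 1 :=
        (rightVertex_eq_iff.2 ⟨y, by simp⟩).symm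
      have h2 := (adj_leftVertex_rightVertex (inr y * 1 : G ∗ H)).symm
      rw [h1] at h2
      exact (adj_leftVertex_rightVertex 1).reachable.trans h2.reachable
    | mul x y hx hy => exact Subgroup.mul_mem _ hx hy
  have hconn' : ∀ v, (freeProductTree G H).Reachable (leftVertex 1) v := by
    have key : ∀ g : G ∗ H, (freeProductTree G H).Reachable (leftVertex 1) (leftVertex g) := by
      intro g
      have h : (freeProductTree G H).Reachable _ _ := hconn g
      rwa [smul_leftVertex, mul_one] at h
    intro v
    obtain ⟨g, rfl⟩ | ⟨g, rfl⟩ := exists_vertex v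
    · exact key g
    · exact (key g).trans (adj_leftVertex_rightVertex g).reachable
  have : Nonempty (((G ∗ H) ⧸ (inl : G →* G ∗ H).range) ⊕
    ((G ∗ H) ⧸ (inr : H →* G ∗ H).range)) := ⟨leftVertex 1⟩
  refine ⟨⟨fun a b => (hconn' a).symm.trans (hconn' b)⟩, ?_⟩
  -- The level of a coset ignores an initial syllable of the inverse in the corresponding factor,
  -- hence is well defined. At most one neighbour is not higher: the one cancelling that syllable.
  let ℓ : ((G ∗ H) ⧸ (inl : G →* G ∗ H).range) ⊕ ((G ∗ H) ⧸ (inr : H →* G ∗ H).range) → ℕ :=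
    Sum.elim
      (Quotient.lift (fun g => CoprodI.tailLength false (toCoprodI g)) fun g k hgk => by
        obtain ⟨x, rfl⟩ := leftVertex_eq_iff.1
          (congrArg Sum.inl (Quotient.sound hgk) : leftVertex g = leftVertex k)
        rw [map_mul, toCoprodI_inl, CoprodI.tailLength_mul_of])
      (Quotient.lift (fun g => CoprodI.tailLength true (toCoprodI g)) fun g k hgk => by
        obtain ⟨x, rfl⟩ := rightVertex_eq_iff.1
          (congrArg Sum.inr (Quotient.sound hgk) : rightVertex g = rightVertex k)
        rw [map_mul, toCoprodI_inr, CoprodI.tailLength_mul_of])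
  refine SimpleGraph.isAcyclic_of_level ℓ fun v u u' h h' hl hl' => ?_
  obtain ⟨g, rfl⟩ | ⟨g, rfl⟩ := exists_vertex v
  · obtain ⟨x, rfl⟩ := exists_of_adj_leftVertex h
    obtain ⟨x', rfl⟩ := exists_of_adj_leftVertex h'
    have key : ∀ x : G, ℓ (rightVertex (g * inl x)) ≤ ℓ (leftVertex g) →
        leftFactor x = (CoprodI.Word.equivPair false
          ((toCoprodI g)⁻¹ • (CoprodI.Word.empty : CoprodI.Word (Factor G H)))).head := by
      intro x hx
      refine CoprodI.eq_head_of_tailLength_le (i := false) (j := true) (by decide) _ _ ?_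
      have hx : CoprodI.tailLength true (toCoprodI (g * inl x)) ≤
        CoprodI.tailLength false (toCoprodI g) := hx
      rwa [map_mul, toCoprodI_inl] at hx
    rw [leftFactor_injective ((key x hl).trans (key x' hl').symm)]
  · obtain ⟨x, rfl⟩ := exists_of_adj_rightVertex h
    obtain ⟨x', rfl⟩ := exists_of_adj_rightVertex h'
    have key : ∀ x : H, ℓ (leftVertex (g * inr x)) ≤ ℓ (rightVertex g) →
        rightFactor x = (CoprodI.Word.equivPair true
          ((toCoprodI g)⁻¹ • (CoprodI.Word.empty : CoprodI.Word (Factor G H)))).head := by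
      intro x hx
      refine CoprodI.eq_head_of_tailLength_le (i := true) (j := false) (by decide) _ _ ?_
      have hx : CoprodI.tailLength false (toCoprodI (g * inr x)) ≤
        CoprodI.tailLength true (toCoprodI g) := hx
      rwa [map_mul, toCoprodI_inr] at hx
    rw [rightFactor_injective ((key x hl).trans (key x' hl').symm)]

theorem actsWithoutInversion : ActsWithoutInversion (G ∗ H) (freeProductTree G H) := by
  intro γ u v huv h1 h2
  obtain ⟨g, ⟨rfl, rfl⟩ | ⟨rfl, rfl⟩⟩ := exists_of_adj huv
  · exact leftVertex_ne_rightVertex _ _ h1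
  · exact leftVertex_ne_rightVertex _ _ h2

theorem exists_conj_of_smul_leftVertex {γ k : G ∗ H} (h : γ • leftVertex k = leftVertex k) :
    ∃ x : G, γ = k * inl x * k⁻¹ := by
  rw [smul_leftVertex, eq_comm, leftVertex_eq_iff] at h
  obtain ⟨x, hx⟩ := h
  exact ⟨x, by rw [← hx, mul_inv_cancel_right]⟩

theorem exists_conj_of_smul_rightVertex {γ k : G ∗ H} (h : γ • rightVertex k = rightVertex k) :
    ∃ y : H, γ = k * inr y * k⁻¹ := by
  rw [smul_rightVertex, eq_comm, rightVertex_eq_iff] at h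
  obtain ⟨x, hx⟩ := h
  exact ⟨x, by rw [← hx, mul_inv_cancel_right]⟩

/-- Up to conjugacy the element lies in both factors, and projecting to `G` kills `H`. -/
theorem eq_one_of_adj {γ : G ∗ H} {u v : ((G ∗ H) ⧸ (inl : G →* G ∗ H).range) ⊕
    ((G ∗ H) ⧸ (inr : H →* G ∗ H).range)} (h : (freeProductTree G H).Adj u v)
    (hu : γ • u = u) (hv : γ • v = v) : γ = 1 := by
  have key : ∀ g : G ∗ H, γ • leftVertex g = leftVertex g → γ • rightVertex g = rightVertex g →
      γ = 1 := by
    intro g h1 h2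
    obtain ⟨x, rfl⟩ := exists_conj_of_smul_leftVertex h1
    obtain ⟨y, hy⟩ := exists_conj_of_smul_rightVertex h2
    have h3 : (inl x : G ∗ H) = inr y := by simpa using hy
    have h4 : x = 1 := by simpa using congrArg fst h3
    simp [h4]
  obtain ⟨g, ⟨rfl, rfl⟩ | ⟨rfl, rfl⟩⟩ := exists_of_adj h
  exacts [key g hu hv, key g hv hu]

theorem eq_one_of_smul_eq {γ : G ∗ H} {u v : ((G ∗ H) ⧸ (inl : G →* G ∗ H).range) ⊕
    ((G ∗ H) ⧸ (inr : H →* G ∗ H).range)} (h : u ≠ v) (hu : γ • u = u) (hv : γ • v = v) :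
    γ = 1 := by
  have hT : (freeProductTree G H).IsTree := isTree_freeProductTree
  obtain ⟨w, hw, hw'⟩ := hT.exists_adj_closer h
  refine eq_one_of_adj hw hu (GraphAction.smul_eq_of_between hT hu hv ?_)
  rw [SimpleGraph.dist_eq_one_iff_adj.2 hw]; omega

theorem orderOf_ne_two_of_smul_rightVertex (hH : ∀ y : H, orderOf y ≠ 2) {γ k : G ∗ H}
    (h : γ • rightVertex k = rightVertex k) : orderOf γ ≠ 2 := by
  obtain ⟨y, rfl⟩ := exists_conj_of_smul_rightVertex h
  intro ho
  refine hH y ?_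
  rw [← orderOf_injective (inr : H →* G ∗ H) inr_injective, ← ho]
  exact (orderOf_injective (MulAut.conj k).toMonoidHom (MulAut.conj k).injective _).symm

/-- The products `a i * b` translate the base vertex by 2 through the midpoints `a i H`, which
differ from each other; there is no backtracking because `a i ≠ 1` and `b ≠ 1`. -/
theorem exists_ends {a : Fin 3 → G} (ha : Function.Injective a) (ha1 : ∀ i, a i ≠ 1) {b : H}
    (hb : b ≠ 1) :
    ∃ (v : ((G ∗ H) ⧸ (inl : G →* G ∗ H).range) ⊕ ((G ∗ H) ⧸ (inr : H →* G ∗ H).range))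
      (h : Fin 3 → G ∗ H), (∀ i, IsAxial (freeProductTree G H) (h i) v) ∧ ∀ i j, i ≠ j →
      (freeProductTree G H).dist (h i • v) (h j • v) =
        (freeProductTree G H).dist v (h i • v) + (freeProductTree G H).dist v (h j • v) := by
  have hT : (freeProductTree G H).IsTree := isTree_freeProductTree
  let h : Fin 3 → G ∗ H := fun i => inl (a i) * inr b
  let u : Fin 3 → ((G ∗ H) ⧸ (inl : G →* G ∗ H).range) ⊕ ((G ∗ H) ⧸ (inr : H →* G ∗ H).range) :=
    fun i => rightVertex (inl (a i))
  have h1 : ∀ i, (freeProductTree G H).Adj (leftVertex 1) (u i) := by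
    intro i
    rw [show leftVertex (1 : G ∗ H) = leftVertex (inl (a i)) from
      leftVertex_eq_iff.2 ⟨a i, by simp⟩]
    exact adj_leftVertex_rightVertex _
  have h2 : ∀ i, (freeProductTree G H).Adj (u i) (h i • leftVertex 1) := by
    intro i
    rw [smul_leftVertex, mul_one, show u i = rightVertex (h i) from
      rightVertex_eq_iff.2 ⟨b, rfl⟩]
    exact (adj_leftVertex_rightVertex _).symm
  have hne : ∀ i, leftVertex (1 : G ∗ H) ≠ h i • leftVertex 1 := by
    intro i e
    rw [smul_leftVertex, leftVertex_eq_iff] at e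
    obtain ⟨x, hx⟩ := e
    exact hb (by simpa [h] using congrArg snd hx)
  have hd : ∀ i, (freeProductTree G H).dist (leftVertex 1) (h i • leftVertex 1) = 2 := fun i =>
    hT.dist_eq_two (h1 i) (h2 i) (hne i)
  have d1 : ∀ i, (freeProductTree G H).dist (u i) (h i • leftVertex 1) = 1 := fun i =>
    SimpleGraph.dist_eq_one_iff_adj.2 (h2 i)
  have d2 : ∀ i, (freeProductTree G H).dist (u i) (leftVertex 1) = 1 := fun i =>
    SimpleGraph.dist_eq_one_iff_adj.2 (h1 i).symm
  refine ⟨leftVertex 1, h, fun i => ⟨hne i, ?_⟩, fun i j hij => ?_⟩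
  · have d3 : (freeProductTree G H).dist (h i • u i) (h i • h i • leftVertex 1) = 1 := by
      rw [GraphAction.dist_smul _ hT, d1]
    have hn : u i ≠ h i • u i := by
      intro e
      obtain ⟨y, hy⟩ := rightVertex_eq_iff.1 e
      exact ha1 i (by simpa [h] using congrArg fst hy)
    have e := hT.dist_of_ne_adj (x := leftVertex 1) (z := h i • h i • leftVertex 1) (h2 i).symm
      (GraphAction.smul_adj (T := freeProductTree G H) (h i) _ _ (h1 i))
      (by rw [d2, SimpleGraph.dist_comm, hd]) (by rw [d3, GraphAction.dist_smul _ hT, hd]) hn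
    rw [e, GraphAction.dist_smul _ hT]; ring
  · have hn : u i ≠ u j := by
      intro e
      obtain ⟨y, hy⟩ := rightVertex_eq_iff.1 e
      exact hij (ha (by simpa using (congrArg fst hy).symm))
    have e := hT.dist_of_ne_adj (h1 i) (h1 j) (by rw [d1, hd]) (by rw [d1, hd]) hn
    rw [e, SimpleGraph.dist_comm]

theorem isSTSplitting {π : G ∗ H →* G ⧸ translationSubgroup G}
    (hπ : ∀ g, π (inl g) = QuotientGroup.mk g) (hH : ∀ y : H, orderOf y ≠ 2)
    {a : Fin 3 → G} (ha : Function.Injective a) (ha1 : ∀ i, a i ≠ 1) {b : H} (hb : b ≠ 1) :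
    IsSTSplitting (inl : G →* G ∗ H) π (freeProductTree G H) where
  injective := inl_injective
  apply_eq := hπ
  involution_conj γ hγ := by
    have hfin : Finite (Subgroup.zpowers γ) :=
      finite_zpowers.2 (orderOf_ne_zero_iff.1 (by omega))
    obtain ⟨x, hx⟩ := GraphAction.exists_fixed_of_finite isTree_freeProductTree
      actsWithoutInversion _ hfin
    have hx := hx γ (Subgroup.mem_zpowers γ)
    obtain ⟨k, rfl⟩ | ⟨k, rfl⟩ := exists_vertex x
    · obtain ⟨y, rfl⟩ := exists_conj_of_smul_leftVertex hx
      exact ⟨k⁻¹, y, by group⟩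
    · exact absurd hγ (orderOf_ne_two_of_smul_rightVertex hH hx)
  isTree := isTree_freeProductTree
  withoutInversion := actsWithoutInversion
  edge_bound := ⟨1, fun u v huv => Set.encard_le_one_iff.2 fun γ γ' h h' =>
    (eq_one_of_adj huv h.1 h.2).trans (eq_one_of_adj huv h'.1 h'.2).symm⟩
  edge_mul u v γ γ' huv h1 h2 _ _ h3 := absurd (by rw [eq_one_of_adj huv h1 h2, map_one]) h3
  far_fixed γ u v _ hu hv hd := eq_one_of_smul_eq (by rintro rfl; simp at hd) hu hv
  normalizer_le r s hrs x hx := by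
    have hfix : ∀ n ∈ Subgroup.normalizer (Subgroup.zpowers (r * s) : Set (G ∗ H)),
        n • x = x := by
      intro n hn
      have h1 : Subgroup.zpowers (r * s) ≤ MulAction.stabilizer _ x := by
        rw [Subgroup.zpowers_le]; exact hx
      have h2 : (n⁻¹ * (r * s) * n) • x = x := h1 (mem_normalizer_zpowers.1 hn).2
      rw [mul_smul, mul_smul, inv_smul_eq_iff] at h2
      by_contra hne
      exact hrs.mul_ne_one (eq_one_of_smul_eq hne h2 hx)
    obtain ⟨k, rfl⟩ | ⟨k, rfl⟩ := exists_vertex x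
    · refine ⟨k⁻¹, fun n hn => ?_⟩
      obtain ⟨z, hz⟩ := exists_conj_of_smul_leftVertex (hfix _ (conj_mem_normalizer_zpowers hn))
      exact ⟨z, by
        have : n = k⁻¹ * (k * n * k⁻¹) * k := by group
        rw [this, hz]; group⟩
    -- The involution `r` normalizes the group of `r * s`, so it fixes the same vertex, which cannot
    -- be a coset of `H`.
    · exact absurd hrs.1 (orderOf_ne_two_of_smul_rightVertex hH (hfix r hrs.mem_normalizer.1))
  ends := exists_ends ha ha1 hb

end Monoid.Coprod

/-! ### Verification for the two extensions of G -/

section Extensions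

variable {G : Type*} [Group G] {p : ℕ}

theorem mk_eq_one_of_mem_zpowers {r s z : G} (h : IsInvolutionPair r s)
    (hz : z ∈ Subgroup.zpowers (r * s)) :
    (QuotientGroup.mk z : G ⧸ translationSubgroup G) = 1 :=
  (QuotientGroup.eq_one_iff z).2 ((Subgroup.zpowers_le (H := translationSubgroup G)).2
    (Subgroup.subset_closure ⟨r, s, h, rfl⟩) hz)

theorem mem_zpowers_or_mk_eq {r s z : G} (h : IsInvolutionPair r s)
    (hz : z ∈ dihedralSubgroup r s) : z ∈ Subgroup.zpowers (r * s) ∨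
      (QuotientGroup.mk z : G ⧸ translationSubgroup G) = QuotientGroup.mk r := by
  obtain ⟨n, rfl | rfl⟩ := h.mem_dihedralSubgroup hz
  · exact Or.inl ⟨n, rfl⟩
  · right
    rw [QuotientGroup.mk_mul, mk_eq_one_of_mem_zpowers h ⟨n, rfl⟩, mul_one]

theorem IsAlmostSharplyTwoTransitive.mk_ne_one (hG : IsAlmostSharplyTwoTransitive p G) {r : G}
    (hr : orderOf r = 2) : (QuotientGroup.mk r : G ⧸ translationSubgroup G) ≠ 1 :=
  fun e => hG.no_involution r ((QuotientGroup.eq_one_iff r).1 e) hr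

theorem IsAlmostSharplyTwoTransitive.mem_zpowers (hG : IsAlmostSharplyTwoTransitive p G)
    {r s z : G} (h : IsInvolutionPair r s) (hz : z ∈ dihedralSubgroup r s)
    (hz1 : (QuotientGroup.mk z : G ⧸ translationSubgroup G) = 1) :
    z ∈ Subgroup.zpowers (r * s) :=
  (mem_zpowers_or_mk_eq h hz).resolve_right fun e => hG.mk_ne_one h.1 (e.symm.trans hz1)

/-- Rotations die in the quotient and all reflections have the common class of involutions. This is
the compatibility needed to extend the quotient map to the HNN extension. -/
theorem mk_apply_dihedralSubgroup {r s r' s' : G} (h : IsInvolutionPair r s)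
    (h' : IsInvolutionPair r' s') (φ : dihedralSubgroup r s ≃* dihedralSubgroup r' s')
    (hr : (φ ⟨r, left_mem_dihedralSubgroup r s⟩ : G) = r')
    (hs : (φ ⟨s, right_mem_dihedralSubgroup r s⟩ : G) = s') (a : dihedralSubgroup r s) :
    (QuotientGroup.mk (φ a : G) : G ⧸ translationSubgroup G) = QuotientGroup.mk (a : G) := by
  obtain ⟨a, ha⟩ := a
  let R : dihedralSubgroup r s := ⟨r, left_mem_dihedralSubgroup r s⟩
  let S : dihedralSubgroup r s := ⟨s, right_mem_dihedralSubgroup r s⟩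
  have hpow : ∀ n : ℤ, (φ ((R * S) ^ n) : G) = (r' * s') ^ n := by
    intro n
    rw [map_zpow, map_mul, Subgroup.coe_zpow, Subgroup.coe_mul, hr, hs]
  obtain ⟨n, hn | hn⟩ := h.mem_dihedralSubgroup ha
  · have e : (⟨a, ha⟩ : dihedralSubgroup r s) = (R * S) ^ n := Subtype.ext (by simpa using hn)
    rw [e, hpow, mk_eq_one_of_mem_zpowers h' ⟨n, rfl⟩, ← e,
      mk_eq_one_of_mem_zpowers h ⟨n, hn.symm⟩]
  · have e : (⟨a, ha⟩ : dihedralSubgroup r s) = R * (R * S) ^ n :=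
      Subtype.ext (by simpa using hn)
    have e' : (φ (R * (R * S) ^ n) : G) = r' * (r' * s') ^ n := by
      rw [map_mul, Subgroup.coe_mul, hpow, hr]
    rw [e, e']
    show (QuotientGroup.mk _ : G ⧸ translationSubgroup G) = QuotientGroup.mk (r * (r * s) ^ n)
    rw [QuotientGroup.mk_mul, QuotientGroup.mk_mul,
      mk_eq_one_of_mem_zpowers h' ⟨n, rfl⟩, mk_eq_one_of_mem_zpowers h ⟨n, rfl⟩, mul_one, mul_one,
      mk_eq_mk_of_involutions h.1 h'.1]

theorem mem_zpowers_conj {z a x : G} (h : x⁻¹ * z * x ∈ Subgroup.zpowers a) :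
    z ∈ Subgroup.zpowers (MulAut.conj x a) := by
  obtain ⟨n, hn⟩ := h
  refine ⟨n, ?_⟩
  have hn : a ^ n = x⁻¹ * z * x := hn
  show (MulAut.conj x a) ^ n = z
  rw [← map_zpow, hn, MulAut.conj_apply]
  group

/-- Since `p` is prime, `z` and its conjugate both generate the group of `r * s`; so `x` normalizes
it, and minimality applies. -/
theorem IsMinimalPair.mem_of_conj_mem (hp : p.Prime) {r s z x : G} (h : IsMinimalPair p r s)
    (hz : z ∈ Subgroup.zpowers (r * s)) (hx : x⁻¹ * z * x ∈ Subgroup.zpowers (r * s))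
    (hz1 : z ≠ 1) : x ∈ dihedralSubgroup r s := by
  rw [← SetLike.mem_coe, ← h.2.2]
  have e := zpowers_eq_of_prime hp h.2.1 hz hz1
  have hx1 : x⁻¹ * z * x ≠ 1 := fun e' => hz1 (by
    rw [show z = x * (x⁻¹ * z * x) * x⁻¹ by group, e', mul_one, mul_inv_cancel])
  have e' := zpowers_eq_of_prime hp h.2.1 hx hx1
  rw [SetLike.mem_coe, ← e, mem_normalizer_zpowers]
  constructor
  · have hz' : x⁻¹ * (x * z * x⁻¹) * x ∈ Subgroup.zpowers (x⁻¹ * z * x) := by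
      rw [e', show x⁻¹ * (x * z * x⁻¹) * x = z by group]
      exact hz
    have := mem_zpowers_conj hz'
    rwa [MulAut.conj_apply, show x * (x⁻¹ * z * x) * x⁻¹ = z by group] at this
  · rwa [e]

theorem IsST.isSTPrime_hnnExtension {n₁ : ℕ} (hp : p.Prime) (hp2 : p ≠ 2) (hn : n₁ ≤ p)
    (hG : IsST p G) (hp3 : p ≠ 3) {r s r' s' : G} (h : IsAffinePair p r s)
    (h' : IsMinimalPair p r' s') (φ : dihedralSubgroup r s ≃* dihedralSubgroup r' s')
    (hr : (φ ⟨r, left_mem_dihedralSubgroup r s⟩ : G) = r')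
    (hs : (φ ⟨s, right_mem_dihedralSubgroup r s⟩ : G) = s') :
    IsSTPrime n₁ p (HNNExtension G (dihedralSubgroup r s) (dihedralSubgroup r' s') φ)
      (hnnTree φ) := by
  have : Fact p.Prime := ⟨hp⟩
  have ho : orderOf (r * s) = p := hG.order_translation _ ⟨r, s, h.1, rfl⟩
  let π : HNNExtension G (dihedralSubgroup r s) (dihedralSubgroup r' s') φ →*
      G ⧸ translationSubgroup G :=
    HNNExtension.lift (QuotientGroup.mk' (translationSubgroup G)) 1 fun a => by
      rw [one_mul, mul_one]
      exact (mk_apply_dihedralSubgroup h.1 h'.1 φ hr hs a).symm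
  have hπ : ∀ g : G, π (HNNExtension.of g) = QuotientGroup.mk g := fun g =>
    HNNExtension.lift_of _ _ _ g
  have hconj : ∀ z x : G, (QuotientGroup.mk z : G ⧸ translationSubgroup G) = 1 →
      (QuotientGroup.mk (x⁻¹ * z * x) : G ⧸ translationSubgroup G) = 1 := by
    intro z x hz
    rw [QuotientGroup.mk_mul, QuotientGroup.mk_mul, hz, mul_one, ← QuotientGroup.mk_mul,
      inv_mul_cancel, QuotientGroup.mk_one]
  have hAB : ∀ z x : G, π (HNNExtension.of z) = 1 → z ∈ dihedralSubgroup r' s' →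
      x⁻¹ * z * x ∈ dihedralSubgroup r s → z = 1 := by
    intro z x hz hzB hzA
    rw [hπ] at hz
    have h1 := mem_zpowers_conj (hG.almost.mem_zpowers h.1 hzA (hconj z x hz))
    have h2 : IsAffinePair p (MulAut.conj x r) (MulAut.conj x s) :=
      h.map (f := (MulAut.conj x).toMonoidHom) (MulAut.conj x).injective
    rw [map_mul] at h1
    exact h'.eq_one_of_mem_zpowers_affine hp2 hp3 h2
      (hG.order_translation _ ⟨_, _, h2.1, rfl⟩) h1 (hG.almost.mem_zpowers h'.1 hzB hz)
  -- The dihedral edge group has at most `2 * p` elements. The rotation `r * s` lies in `A`, so by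
  -- `hAB` with `x = 1` it is not in `B`.
  refine IsSTSplitting.isSTPrime (HNNExtension.isSTSplitting (π := π) (C := 2 * p) (b := r * s) hπ
    hAB ?_ ?_ ?_ ?_) hG hn hp hp2
  · intro z x hz hzB hxB hx
    rw [hπ] at hz
    by_contra hz1
    exact hx (h'.mem_of_conj_mem hp (hG.almost.mem_zpowers h'.1 hzB hz)
      (hG.almost.mem_zpowers h'.1 hxB (hconj z x hz)) hz1)
  · have := h.1.encard_dihedralSubgroup_le (by rw [ho]; exact hp.ne_zero)
    rw [ho] at this
    exact_mod_cast this
  · intro a ha a' ha' h1 h1'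
    rw [hπ] at h1 h1'
    rw [hπ, QuotientGroup.mk_mul,
      (mem_zpowers_or_mk_eq h.1 ha).resolve_left fun e => h1 (mk_eq_one_of_mem_zpowers h.1 e),
      (mem_zpowers_or_mk_eq h.1 ha').resolve_left fun e => h1' (mk_eq_one_of_mem_zpowers h.1 e),
      ← QuotientGroup.mk_mul, mul_self_of_orderOf_eq_two h.1.1, QuotientGroup.mk_one]
  · intro hB
    refine h.1.mul_ne_one (hAB (r * s) 1 ?_ hB ?_)
    · rw [hπ, mk_eq_one_of_mem_zpowers h.1 (Subgroup.mem_zpowers _)]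
    · rw [inv_one, one_mul, mul_one]
      exact Subgroup.mul_mem _ (left_mem_dihedralSubgroup r s) (right_mem_dihedralSubgroup r s)

theorem IsST.isSTPrime_coprod {n₁ : ℕ} (hp : p.Prime) (hp2 : p ≠ 2) (hn : n₁ ≤ p)
    (hG : IsST p G) {H : Type*} [Group H] [Nontrivial H] (hH : ∀ h : H, orderOf h ≠ 2) :
    IsSTPrime n₁ p (G ∗ H) (freeProductTree G H) := by
  obtain ⟨r, s, h⟩ := hG.almost.exists_affine
  obtain ⟨b, hb⟩ := exists_ne (1 : H)
  have hr : r ≠ 1 := by rintro rfl; simpa using h.1.1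
  have hs : s ≠ 1 := by rintro rfl; simpa using h.1.2.1
  have h1 : r ≠ r * s := fun e => hs (left_eq_mul.1 e)
  have h2 : s ≠ r * s := fun e => hr (right_eq_mul.1 e)
  refine IsSTSplitting.isSTPrime (Monoid.Coprod.isSTSplitting
    (π := Monoid.Coprod.lift (QuotientGroup.mk' (translationSubgroup G)) 1) (fun g => rfl) hH
    -- Three distinct nontrivial elements of `G`, supplied by any affine pair, give the three ends.
    (a := ![r, s, r * s]) ?_ ?_ hb) hG hn hp hp2
  · intro i j hij
    fin_cases i <;> fin_cases j
    exacts [rfl, absurd hij h.1.2.2, absurd hij h1, absurd hij.symm h.1.2.2, rfl, absurd hij h2,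
      absurd hij.symm h1, absurd hij.symm h2, rfl]
  · intro i
    fin_cases i
    exacts [hr, hs, h.1.mul_ne_one]

end Extensions

theorem proposition2p14 (p n₁ : ℕ) (hp : p.Prime) (hp2 : p ≠ 2) (hn : n₁ ≤ p)
    (G : Type*) [Group G] (hG : IsST p G) :
    (p ≠ 3 → ∀ r s r' s' : G, IsAffinePair p r s → IsMinimalPair p r' s' →
      ∃ φ : dihedralSubgroup r s ≃* dihedralSubgroup r' s',
        (φ ⟨r, left_mem_dihedralSubgroup r s⟩ : G) = r' ∧
        (φ ⟨s, right_mem_dihedralSubgroup r s⟩ : G) = s' ∧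
        IsSTPrime n₁ p (HNNExtension G (dihedralSubgroup r s) (dihedralSubgroup r' s') φ)
          (hnnTree φ)) ∧
    (∀ (H : Type*) [Group H] [Nontrivial H], (∀ h : H, orderOf h ≠ 2) →
      IsSTPrime n₁ p (G ∗ H) (freeProductTree G H)) := by
  refine ⟨fun hp3 r s r' s' h h' => ?_, fun H _ _ hH => hG.isSTPrime_coprod hp hp2 hn hH⟩
  have ho : orderOf (r * s) = p := hG.order_translation _ ⟨r, s, h.1, rfl⟩
  obtain ⟨φ, hr, hs⟩ := exists_dihedral_mulEquiv h.1 h'.1 (ho ▸ hp.odd_of_ne_two hp2)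
    (h'.2.1.trans ho.symm)
  exact ⟨φ, hr, hs, hG.isSTPrime_hnnExtension hp hp2 hn hp3 h h' φ hr hs⟩
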